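/- **Bounds for the relative free energy.** Let $\Omega\subset\mathbb R^3$ be a bounded domain with $\partial\Omega\in C^{1,1}$, let $0<m_*<1$, $\lambda,D,\tau>0$, $0\le p<1$, $q_0>3$, $\vec\mu\in\mathbb R^3$ with $|\vec\mu|=1$, and put $D_\pm=D/(1\pm p)$. Let $g\in L^\infty(\Omega)$, $g\ge 0$, let $n_D,V_D\in W^{2,q_0}(\Omega)$ (continuous on $\overline\Omega$) with $n_D\ge m_*$ on $\partial\Omega$, and let $M_0\in\mathbb R$. Then there exist constants $C_\phi,C_H>0$, depending only on these data and in particular neither on time nor on the initial data or the solutions below, such that the following holds. Let $n_0^0,\ \vec n^0\cdot\vec\mu\in L^\infty(\Omega)$ with $\frac12 n_0^0\pm\vec n^0\cdot\vec\mu\ge \frac{m_*}{2}$ and $n_0^0\le M_0$ a.e. in $\Omega$. Let $(n_+,n_-,V)$ be a global bounded weak solution of $$\partial_t n_\pm-\operatorname{div}\big(D_\pm(\nabla n_\pm+n_\pm\nabla V)\big)=\tfrac1{2\tau}(n_\mp-n_\pm),\qquad -\lambda^2\Delta V=n_++n_--g\quad\text{in }\Omega,\ t>0,$$ $$n_\pm=\tfrac12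 n_D,\quad V=V_D\ \text{ on }\partial\Omega,\qquad n_\pm(0)=\tfrac12 n_0^0\pm\vec n^0\cdot\vec\mu\ \text{ in }\Omega,$$ that is, $n_\pm\in C([0,\infty);L^2(\Omega))$ and $n_\pm\in L^2(0,T;H^1(\Omega))\cap L^\infty(0,T;L^\infty(\Omega))$, $V\in L^2(0,T;H^1(\Omega))$ for all $T>0$; $n_\pm(t)-\frac12 n_D\in H^1_0(\Omega)$ for a.e. $t>0$; $V(t)\in H^1(\Omega)$ is the weak solution of the Poisson problem for every $t>0$; and the evolution equations hold in the weak sense. Let $n_\infty,V_\infty\in H^1(\Omega)\cap L^\infty(\Omega)$ be a weak solution of $$\operatorname{div}(\nabla n_\infty+n_\infty\nabla V_\infty)=0,\quad -\lambda^2\Delta V_\infty=n_\infty-g\ \text{ in }\Omega,\qquad n_\infty=n_D,\quad V_\infty=V_D\ \text{ on }\partial\Omega.$$ Define $\phi_\pm=\log n_\pm+V$, $\phi_\infty=\log n_\infty+V_\infty$ and $$H(t)=\int_\Omega\Big(h(n_+|n_\infty)+h(n_-|n_\infty)+\tfrac{\lambda^2}{2}|\nabla(V-V_\infty)|^2\Big)(t)\,dx,\qquad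 h(n|n_\infty)=n\log\frac{2n}{n_\infty}-n+\tfrac12 n_\infty .$$ Then $n_\infty>0$ and, for every $t>0$, $n_\pm(t)>0$ a.e. in $\Omega$, the integrand of $H(t)$ is integrable, and $$H(t)\ge C_H\big(\|n_+(t)-\tfrac12n_\infty\|_{L^2(\Omega)}^2+\|n_-(t)-\tfrac12n_\infty\|_{L^2(\Omega)}^2\big).$$ Moreover, for every $t>0$ with $n_\pm(t)-\frac12n_D\in H^1_0(\Omega)$ (hence for a.e. $t>0$), $\phi_\pm(t)-\phi_\infty\in H^1(\Omega)$ and $$H(t)\le C_\phi\big(\|\nabla(\phi_+(t)-\phi_\infty)\|_{L^2(\Omega)}^2+\|\nabla(\phi_-(t)-\phi_\infty)\|_{L^2(\Omega)}^2\big).$$ -/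

import Mathlib

open MeasureTheory Set Filter Topology
open scoped ContDiff NNReal ENNReal

noncomputable section

namespace SpinDrift

/-- Three-dimensional Euclidean space. -/
abbrev E3 : Type := EuclideanSpace ℝ (Fin 3)

/-- `Ω` has a boundary of class `C^{1,1}`: near each boundary point, after an orthogonal change of
coordinates, `Ω` is the part above the graph of a `C¹` function with Lipschitz derivative. -/
def HasC11Boundary (Ω : Set E3) : Prop :=
  ∀ x₀ ∈ frontier Ω, ∃ r : ℝ, 0 < r ∧
    ∃ e : E3 ≃ₗᵢ[ℝ] WithLp 2 (EuclideanSpace ℝ (Fin 2) × ℝ),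
    ∃ γ : EuclideanSpace ℝ (Fin 2) → ℝ, ∃ L : ℝ≥0,
      ContDiff ℝ 1 γ ∧ LipschitzWith L (fderiv ℝ γ) ∧
      ∀ x ∈ Metric.ball x₀ r, (x ∈ Ω ↔ γ (e x).fst < (e x).snd)

/-- Test functions: `φ ∈ C_c^∞(Ω)`. -/
def IsTest (Ω : Set E3) (φ : E3 → ℝ) : Prop :=
  ContDiff ℝ ∞ φ ∧ HasCompactSupport φ ∧ tsupport φ ⊆ Ω

/-- `G` is a weak (distributional) gradient of `u` in `Ω`. -/
def HasWeakGrad (Ω : Set E3) (u : E3 → ℝ) (G : E3 → E3) : Prop :=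
  LocallyIntegrableOn u Ω ∧ LocallyIntegrableOn G Ω ∧
    ∀ φ : E3 → ℝ, IsTest Ω φ →
      ∫ x in Ω, u x • gradient φ x = - ∫ x in Ω, φ x • G x

/-- The weak gradient of `u` in `Ω` (unique up to null sets; arbitrary if there is none). -/
def weakGrad (Ω : Set E3) (u : E3 → ℝ) : E3 → E3 :=
  Classical.epsilon fun G => HasWeakGrad Ω u G

/-- `u ∈ H¹(Ω)`. -/
def MemH1 (Ω : Set E3) (u : E3 → ℝ) : Prop :=
  MemLp u 2 (volume.restrict Ω) ∧
    ∃ G : E3 → E3, HasWeakGrad Ω u G ∧ MemLp G 2 (volume.restrict Ω)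

/-- `u ∈ H¹₀(Ω)`, the closure of `C_c^∞(Ω)` in `H¹(Ω)`. -/
def MemH10 (Ω : Set E3) (u : E3 → ℝ) : Prop :=
  MemH1 Ω u ∧ ∀ ε : ℝ≥0∞, 0 < ε → ∃ φ : E3 → ℝ, IsTest Ω φ ∧
    eLpNorm (fun x => u x - φ x) 2 (volume.restrict Ω) ≤ ε ∧
    eLpNorm (fun x => weakGrad Ω u x - gradient φ x) 2 (volume.restrict Ω) ≤ ε

/-- `u ∈ W^{2,q}(Ω)`. -/
def MemW2 (Ω : Set E3) (q : ℝ≥0∞) (u : E3 → ℝ) : Prop :=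
  MemLp u q (volume.restrict Ω) ∧
    ∃ G : E3 → E3, HasWeakGrad Ω u G ∧ MemLp G q (volume.restrict Ω) ∧
      ∀ i : Fin 3, ∃ K : E3 → E3,
        HasWeakGrad Ω (fun x => G x i) K ∧ MemLp K q (volume.restrict Ω)

/-- `u ∈ L²(0,T;H¹(Ω))`. -/
def MemL2H1 (T : ℝ) (Ω : Set E3) (u : ℝ → E3 → ℝ) : Prop :=
  MemLp (Function.uncurry u) 2 ((volume.restrict (Ioo 0 T)).prod (volume.restrict Ω)) ∧
    ∃ G : ℝ → E3 → E3,
      MemLp (Function.uncurry G) 2 ((volume.restrict (Ioo 0 T)).prod (volume.restrict Ω)) ∧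
      ∀ᵐ t ∂(volume.restrict (Ioo 0 T)), HasWeakGrad Ω (u t) (G t)

/-- `V ∈ H¹(Ω)` is a weak solution of `-λ² ΔV = ρ` in `Ω`, `V = V_D` on `∂Ω`. -/
structure IsPoissonSol (Ω : Set E3) (lam : ℝ) (VD ρ V : E3 → ℝ) : Prop where
  mem : MemH1 Ω V
  bdry : MemH10 Ω fun x => V x - VD x
  eqn : ∀ φ : E3 → ℝ, IsTest Ω φ →
    lam ^ 2 * ∫ x in Ω, inner ℝ (weakGrad Ω V x) (gradient φ x) = ∫ x in Ω, ρ x * φ x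

/-- The regularity and the boundary condition of a global bounded weak solution component:
`u ∈ C([0,∞);L²(Ω))`, and `u ∈ L²(0,T;H¹(Ω)) ∩ L^∞(0,T;L^∞(Ω))` for every `T > 0`, with
`u(t) = u_D` on `∂Ω` for almost every `t > 0`. -/
structure IsBoundedEvolution (Ω : Set E3) (uD : E3 → ℝ) (u : ℝ → E3 → ℝ) : Prop where
  memL2 : ∀ t : ℝ, 0 ≤ t → MemLp (u t) 2 (volume.restrict Ω)
  cont : ∀ t₀ : ℝ, 0 ≤ t₀ →
    Tendsto (fun t => eLpNorm (fun x => u t x - u t₀ x) 2 (volume.restrict Ω))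
      (𝓝[Ici 0] t₀) (𝓝 0)
  memL2H1 : ∀ T : ℝ, 0 < T → MemL2H1 T Ω u
  bdd : ∀ T : ℝ, 0 < T → ∃ K : ℝ, ∀ t ∈ Icc 0 T, ∀ᵐ x ∂(volume.restrict Ω), |u t x| ≤ K
  bdry : ∀ᵐ t ∂(volume.restrict (Ioi (0 : ℝ))), MemH10 Ω fun x => u t x - uD x

/-- Weak form, integrated over `(0,t)`, of `∂ₜ u - div (d (∇u + u ∇V)) = (v - u) / (2τ)`. -/
def DriftDiffusionEq (Ω : Set E3) (d τ : ℝ) (V u v : ℝ → E3 → ℝ) : Prop :=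
  ∀ φ : E3 → ℝ, IsTest Ω φ → ∀ t : ℝ, 0 ≤ t →
    (∫ x in Ω, u t x * φ x) - (∫ x in Ω, u 0 x * φ x) =
      ∫ s in (0 : ℝ)..t,
        (-(d * ∫ x in Ω,
            inner ℝ (weakGrad Ω (u s) x + u s x • weakGrad Ω (V s) x) (gradient φ x))
          + 1 / (2 * τ) * ∫ x in Ω, (v s x - u s x) * φ x)

/-- `(n₊, n₋, V)` is a global bounded weak solution of the two-component spin drift-diffusion
Poisson system with diffusion constants `D₊ = D / (1 + p)` and `D₋ = D / (1 - p)`, boundary values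
`n_± = n_D / 2`, `V = V_D`, and initial values `n₊⁰`, `n₋⁰`. -/
structure IsWeakSolution (Ω : Set E3) (lam D p τ : ℝ) (g nD VD np0 nm0 : E3 → ℝ)
    (np nm V : ℝ → E3 → ℝ) : Prop where
  np_reg : IsBoundedEvolution Ω (fun x => nD x / 2) np
  nm_reg : IsBoundedEvolution Ω (fun x => nD x / 2) nm
  V_reg : ∀ T : ℝ, 0 < T → MemL2H1 T Ω V
  np_init : np 0 =ᵐ[volume.restrict Ω] np0
  nm_init : nm 0 =ᵐ[volume.restrict Ω] nm0
  np_eqn : DriftDiffusionEq Ω (D / (1 + p)) τ V np nm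
  nm_eqn : DriftDiffusionEq Ω (D / (1 - p)) τ V nm np
  poisson : ∀ t : ℝ, 0 < t → IsPoissonSol Ω lam VD (fun x => np t x + nm t x - g x) (V t)

/-- `(n_∞, V_∞)`, both in `H¹(Ω) ∩ L^∞(Ω)`, is a weak solution of
`div (∇n_∞ + n_∞ ∇V_∞) = 0`, `-λ² ΔV_∞ = n_∞ - g` in `Ω`, `n_∞ = n_D`, `V_∞ = V_D` on `∂Ω`. -/
structure IsStationarySolution (Ω : Set E3) (lam : ℝ) (g nD VD ninf Vinf : E3 → ℝ) : Prop where
  n_mem : MemH1 Ω ninf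
  n_bdd : MemLp ninf ∞ (volume.restrict Ω)
  V_bdd : MemLp Vinf ∞ (volume.restrict Ω)
  n_bdry : MemH10 Ω fun x => ninf x - nD x
  n_eqn : ∀ φ : E3 → ℝ, IsTest Ω φ →
    ∫ x in Ω, inner ℝ (weakGrad Ω ninf x + ninf x • weakGrad Ω Vinf x) (gradient φ x) = 0
  poisson : IsPoissonSol Ω lam VD (fun x => ninf x - g x) Vinf

/-- The electrochemical potential `log n + V`. -/
def chemPot (n V : E3 → ℝ) : E3 → ℝ := fun x => Real.log (n x) + V x

/-- `h(n | n_∞) = n log (2n / n_∞) - n + n_∞ / 2`. -/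
def relEntropy (n ninf : ℝ) : ℝ := n * Real.log (2 * n / ninf) - n + ninf / 2

/-- The integrand of the relative free energy. -/
def freeEnergyDensity (Ω : Set E3) (lam : ℝ) (ninf Vinf np nm V : E3 → ℝ) : E3 → ℝ := fun x =>
  relEntropy (np x) (ninf x) + relEntropy (nm x) (ninf x)
    + lam ^ 2 / 2 * ‖weakGrad Ω (fun y => V y - Vinf y) x‖ ^ 2

/-- The relative free energy `H`. -/
def freeEnergy (Ω : Set E3) (lam : ℝ) (ninf Vinf np nm V : E3 → ℝ) : ℝ :=
  ∫ x in Ω, freeEnergyDensity Ω lam ninf Vinf np nm V x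

end SpinDrift

end

open SpinDrift

/-! Put b = n_∞/2, a_± = n_± - b, θ_± = log n_± - log b and W = V - V_∞. Everything follows from the
pointwise bounds 0 < n_±, b ≤ M, where M = max(1, M₀, Kg, KD), with Kg and KD bounds for |g| and
|n_D|, depends on the data only. A positive lower bound is also needed, but only qualitatively: it
may depend on t and on the solutions, because it serves just to make logarithms admissible in H¹ and
never enters the constants.

Lower estimate: h(n | 2b) ≥ (n - b)²/(2M) pointwise (`sq_div_le_relEntropy`), so C_H = 1/(2M).

Upper estimate: ψ_± = θ_± + W differs from φ_± - φ_∞ by the constant log 2 and lies in H¹₀, hence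
∫ψ² ≤ C_P ∫|∇ψ|². Pointwise h(n | 2b) ≤ aθ and a² ≤ M aθ, and completing the square gives ½ aθ + aW
≤ (M/2) ψ² (`integral_sub_mul_le`). The difference of the Poisson equations, tested with W, gives λ²
∫|∇W|² = ∫(a₊ + a₋)W. Adding up, H ≤ M C_P (‖∇ψ₊‖² + ‖∇ψ₋‖²).

The bounds come from Stampacchia truncation (`barrier_comparison`). With k = (σ(n - l))⁺, σ = ±1,
one has n∇k = ∇(lk + σk²/2), so the Poisson equation turns the drift term into an integral against
the space charge, and no regularity of V beyond H¹ is needed. The coupling between the two densities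
is dissipative. The constant barrier M serves as upper bound, and m e^{-ARt} as lower barrier. For
n_∞ the upper bound is again truncation; the lower one uses the Slotboom variable n_∞ e^{V_∞}.

Two devices keep the functional analysis elementary. H¹₀ is described by annihilators in L² × L²
(`HasH10Grad`), which makes weak closedness immediate and avoids traces. The chain rule in time for
½∫k² is replaced by convexity and an averaging over time shifts (`sub_le_integral_of_increment_le`),
which avoids time derivatives in dual spaces. -/

namespace SpinDrift

/-! ### Gradients, integration by parts and cut-offs for test functions -/

section TestFunctions

variable {Ω : Set E3} {φ : E3 → ℝ}

theorem continuous_gradient {f : E3 → ℝ} (hf : ContDiff ℝ 1 f) : Continuous (gradient f) :=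
  (InnerProductSpace.toDual ℝ E3).symm.continuous.comp (hf.continuous_fderiv one_ne_zero)

theorem inner_gradient_right' (f : E3 → ℝ) (x v : E3) :
    inner ℝ v (gradient f x) = fderiv ℝ f x v := by
  rw [real_inner_comm, inner_gradient_left]

theorem norm_gradient (f : E3 → ℝ) (x : E3) : ‖gradient f x‖ = ‖fderiv ℝ f x‖ := by
  simp [gradient]

theorem gradient_eq_zero_of_notMem_tsupport {f : E3 → ℝ} {x : E3} (hx : x ∉ tsupport f) :
    gradient f x = 0 := by
  have : fderiv ℝ f x = 0 := by
    by_contra h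
    exact hx (support_fderiv_subset ℝ h)
  simp [gradient, this]

theorem hasCompactSupport_gradient {f : E3 → ℝ} (hf : HasCompactSupport f) :
    HasCompactSupport (gradient f) :=
  HasCompactSupport.of_support_subset_isCompact hf fun _ hx => by
    by_contra h
    exact hx (gradient_eq_zero_of_notMem_tsupport h)

theorem gradient_mul {f g : E3 → ℝ} {x : E3} (hf : DifferentiableAt ℝ f x)
    (hg : DifferentiableAt ℝ g x) :
    gradient (fun y => f y * g y) x = f x • gradient g x + g x • gradient f x := by
  simp only [gradient]
  rw [fderiv_fun_mul hf hg]
  simp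

theorem gradient_comp {f : E3 → ℝ} {x : E3} {Φ : ℝ → ℝ} {d : ℝ} (hΦ : HasDerivAt Φ d (f x))
    (hf : DifferentiableAt ℝ f x) : gradient (fun y => Φ (f y)) x = d • gradient f x := by
  simp only [gradient]
  have := (hΦ.comp_hasFDerivAt x hf.hasFDerivAt).fderiv
  rw [show (fun y => Φ (f y)) = Φ ∘ f from rfl, this]
  simp

/-- Integration by parts for `C¹` functions, one of which has compact support. -/
theorem integral_smul_gradient {f g : E3 → ℝ} (hf : ContDiff ℝ 1 f) (hg : ContDiff ℝ 1 g)
    (hc : HasCompactSupport g) :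
    ∫ x, f x • gradient g x = - ∫ x, g x • gradient f x := by
  have i1 : Integrable fun x => f x • gradient g x :=
    (hf.continuous.smul (continuous_gradient hg)).integrable_of_hasCompactSupport
      (hasCompactSupport_gradient hc).smul_left
  have i2 : Integrable fun x => g x • gradient f x :=
    (hg.continuous.smul (continuous_gradient hf)).integrable_of_hasCompactSupport hc.smul_right
  refine ext_inner_left ℝ fun v => ?_
  rw [inner_neg_right, ← integral_inner i1, ← integral_inner i2]
  simp only [inner_smul_right, inner_gradient_right']
  rw [integral_mul_fderiv_eq_neg_fderiv_mul_of_integrable]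
  · simp only [mul_comm]
  · have := i2.inner_const v (𝕜 := ℝ)
    simp only [real_inner_comm, inner_smul_right, inner_gradient_right'] at this
    simpa [mul_comm, inner_smul_left, inner_gradient_left] using this
  · have := i1.inner_const v (𝕜 := ℝ)
    simpa [mul_comm, inner_smul_left, inner_gradient_left] using this
  · exact (hf.continuous.mul hg.continuous).integrable_of_hasCompactSupport hc.mul_left
  · exact fun x _ => hf.differentiable one_ne_zero x
  · exact fun x _ => hg.differentiable one_ne_zero x

theorem IsTest.contDiff_one (h : IsTest Ω φ) : ContDiff ℝ 1 φ := h.1.of_le (by norm_cast)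

theorem IsTest.differentiable (h : IsTest Ω φ) : Differentiable ℝ φ :=
  h.contDiff_one.differentiable one_ne_zero

theorem IsTest.continuous (h : IsTest Ω φ) : Continuous φ := h.1.continuous

theorem IsTest.memLp (h : IsTest Ω φ) (p : ℝ≥0∞) (μ : Measure E3) [IsFiniteMeasureOnCompacts μ] :
    MemLp φ p μ := h.continuous.memLp_of_hasCompactSupport h.2.1

theorem IsTest.memLp_gradient (h : IsTest Ω φ) (p : ℝ≥0∞) (μ : Measure E3)
    [IsFiniteMeasureOnCompacts μ] : MemLp (gradient φ) p μ :=
  (continuous_gradient h.contDiff_one).memLp_of_hasCompactSupport (hasCompactSupport_gradient h.2.1)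

theorem IsTest.eq_zero (h : IsTest Ω φ) {x : E3} (hx : x ∉ Ω) : φ x = 0 :=
  image_eq_zero_of_notMem_tsupport fun hx' => hx (h.2.2 hx')

theorem IsTest.gradient_eq_zero (h : IsTest Ω φ) {x : E3} (hx : x ∉ Ω) : gradient φ x = 0 :=
  gradient_eq_zero_of_notMem_tsupport fun hx' => hx (h.2.2 hx')

theorem IsTest.mul {ψ : E3 → ℝ} (h : IsTest Ω φ) (hψ : ContDiff ℝ ∞ ψ) :
    IsTest Ω fun x => ψ x * φ x :=
  ⟨hψ.mul h.1, h.2.1.mul_left, (tsupport_mul_subset_right).trans h.2.2⟩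

theorem IsTest.zero : IsTest Ω fun _ => (0 : ℝ) :=
  ⟨contDiff_const, HasCompactSupport.zero (α := E3) (β := ℝ), by
    rw [show (fun _ : E3 => (0 : ℝ)) = 0 from rfl]; simp [tsupport]⟩

theorem IsTest.add {ψ : E3 → ℝ} (h : IsTest Ω φ) (hψ : IsTest Ω ψ) :
    IsTest Ω fun x => φ x + ψ x :=
  ⟨h.1.add hψ.1, h.2.1.add hψ.2.1, (tsupport_add φ ψ).trans (union_subset h.2.2 hψ.2.2)⟩

theorem IsTest.smul (h : IsTest Ω φ) (c : ℝ) : IsTest Ω fun x => c * φ x :=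
  h.mul contDiff_const

/-- A smooth cut-off function between a compact set and an open set. -/
theorem exists_isTest_eq_one {K : Set E3} (hK : IsCompact K) (hΩ : IsOpen Ω) (hKΩ : K ⊆ Ω) :
    ∃ χ, IsTest Ω χ ∧ (∀ᶠ x in 𝓝ˢ K, χ x = 1) := by
  obtain ⟨K₁, hK₁, hK1, h1Ω⟩ := exists_compact_between hK hΩ hKΩ
  obtain ⟨K₂, hK₂, hK2, h2Ω⟩ := exists_compact_between hK₁ hΩ h1Ω
  obtain ⟨χ, hχ, -, hsupp, hone⟩ := exists_contMDiff_support_eq_eq_one_iff (n := ⊤)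
    (modelWithCornersSelf ℝ E3) isOpen_interior hK₁.isClosed hK2
  have hts : tsupport χ ⊆ K₂ := by
    rw [tsupport, hsupp]
    exact closure_minimal interior_subset hK₂.isClosed
  refine ⟨χ, ⟨hχ.contDiff, hK₂.of_isClosed_subset (isClosed_tsupport χ) hts, hts.trans h2Ω⟩, ?_⟩
  rw [eventually_nhdsSet_iff_exists]
  exact ⟨interior K₁, isOpen_interior, hK1, fun x hx => (hone x).1 (interior_subset hx)⟩

end TestFunctions

/-! ### Calculus of weak gradients in H¹ -/

section WeakGradients

variable {Ω : Set E3} {u w : E3 → ℝ} {G F : E3 → E3}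

theorem IsTest.integrableOn_smul {φ : E3 → ℝ} (h : IsTest Ω φ) {F : Type*} [NormedAddCommGroup F]
    [NormedSpace ℝ F] {f : E3 → F} (hf : LocallyIntegrableOn f Ω) :
    IntegrableOn (fun x => φ x • f x) Ω := by
  have h1 : IntegrableOn (fun x => φ x • f x) (tsupport φ) :=
    (hf.integrableOn_compact_subset h.2.2 h.2.1).continuousOn_smul h.continuous.continuousOn h.2.1
  refine ((integrableOn_iff_integrable_of_support_subset ?_).1 h1).integrableOn
  intro x hx
  refine subset_tsupport φ fun h0 => hx ?_
  simp [h0]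

/-- Fundamental lemma of the calculus of variations for the difference of the two gradients. It lets
`weakGrad`, an arbitrary choice, be replaced by any concrete gradient. -/
theorem HasWeakGrad.unique (hΩ : IsOpen Ω) (h : HasWeakGrad Ω u G) (h' : HasWeakGrad Ω u F) :
    G =ᵐ[volume.restrict Ω] F := by
  have := hΩ.ae_eq_zero_of_integral_contDiff_smul_eq_zero (h.2.1.sub h'.2.1) (μ := volume) ?_
  · rw [EventuallyEq, ae_restrict_iff' hΩ.measurableSet]
    filter_upwards [this] with x hx hxΩ
    exact sub_eq_zero.1 (hx hxΩ)
  · intro φ h1 h2 h3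
    have ht : IsTest Ω φ := ⟨h1, h2, h3⟩
    have e : ∫ x in Ω, φ x • (G - F) x = 0 := by
      simp only [Pi.sub_apply, smul_sub]
      rw [integral_sub (ht.integrableOn_smul h.2.1) (ht.integrableOn_smul h'.2.1), sub_eq_zero,
        ← neg_inj, ← h.2.2 φ ht, ← h'.2.2 φ ht]
    rw [← e, setIntegral_eq_integral_of_forall_compl_eq_zero]
    intro x hx
    simp [ht.eq_zero hx]

/-- `u ∈ H¹(Ω)` with weak gradient `G`. -/
structure HasH1Grad (Ω : Set E3) (u : E3 → ℝ) (G : E3 → E3) : Prop where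
  memLp : MemLp u 2 (volume.restrict Ω)
  memLp_grad : MemLp G 2 (volume.restrict Ω)
  eqn : ∀ φ : E3 → ℝ, IsTest Ω φ → ∫ x in Ω, u x • gradient φ x = - ∫ x in Ω, φ x • G x

theorem locallyIntegrableOn_of_memLp_two {F : Type*} [NormedAddCommGroup F] {f : E3 → F}
    (hΩ : IsOpen Ω) (hf : MemLp f 2 (volume.restrict Ω)) : LocallyIntegrableOn f Ω := by
  rw [locallyIntegrableOn_iff hΩ.isLocallyClosed]
  intro k hk hkc
  have : IsFiniteMeasure (volume.restrict k) := ⟨by simpa using hkc.measure_lt_top⟩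
  have h2 : MemLp f 2 (volume.restrict k) := hf.mono_measure (Measure.restrict_mono hk le_rfl)
  exact h2.integrable (by norm_num)

theorem HasH1Grad.hasWeakGrad (hΩ : IsOpen Ω) (h : HasH1Grad Ω u G) : HasWeakGrad Ω u G :=
  ⟨locallyIntegrableOn_of_memLp_two hΩ h.memLp, locallyIntegrableOn_of_memLp_two hΩ h.memLp_grad,
    h.eqn⟩

theorem HasH1Grad.memH1 (hΩ : IsOpen Ω) (h : HasH1Grad Ω u G) : MemH1 Ω u :=
  ⟨h.memLp, G, h.hasWeakGrad hΩ, h.memLp_grad⟩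

theorem HasWeakGrad.weakGrad_ae_eq (hΩ : IsOpen Ω) (h : HasWeakGrad Ω u G) :
    weakGrad Ω u =ᵐ[volume.restrict Ω] G :=
  HasWeakGrad.unique hΩ (Classical.epsilon_spec (p := fun G => HasWeakGrad Ω u G) ⟨G, h⟩) h

theorem MemH1.hasH1Grad (hΩ : IsOpen Ω) (h : MemH1 Ω u) : HasH1Grad Ω u (weakGrad Ω u) := by
  obtain ⟨hu, G, hG, hG2⟩ := h
  exact ⟨hu, hG2.ae_eq (hG.weakGrad_ae_eq hΩ).symm,
    (Classical.epsilon_spec (p := fun G => HasWeakGrad Ω u G) ⟨G, hG⟩).2.2⟩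

theorem HasH1Grad.congr (h : HasH1Grad Ω u G) (hu : u =ᵐ[volume.restrict Ω] w)
    (hG : G =ᵐ[volume.restrict Ω] F) : HasH1Grad Ω w F := by
  refine ⟨h.memLp.ae_eq hu, h.memLp_grad.ae_eq hG, fun φ hφ => ?_⟩
  have e1 : ∫ x in Ω, w x • gradient φ x = ∫ x in Ω, u x • gradient φ x :=
    integral_congr_ae (by filter_upwards [hu] with x hx; rw [hx])
  have e2 : ∫ x in Ω, φ x • F x = ∫ x in Ω, φ x • G x :=
    integral_congr_ae (by filter_upwards [hG] with x hx; rw [hx])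
  rw [e1, e2, h.eqn φ hφ]

theorem IsTest.integrable_smul_of_memLp {φ : E3 → ℝ} (h : IsTest Ω φ) {F : Type*}
    [NormedAddCommGroup F] [NormedSpace ℝ F] {f : E3 → F} {μ : Measure E3}
    [IsFiniteMeasureOnCompacts μ] (hf : MemLp f 2 μ) : Integrable (fun x => φ x • f x) μ :=
  memLp_one_iff_integrable.1 (hf.smul (h.memLp 2 μ))

theorem IsTest.integrable_smul_gradient_of_memLp {φ : E3 → ℝ} (h : IsTest Ω φ) {u : E3 → ℝ}
    {μ : Measure E3} [IsFiniteMeasureOnCompacts μ] (hf : MemLp u 2 μ) :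
    Integrable (fun x => u x • gradient φ x) μ :=
  memLp_one_iff_integrable.1 ((h.memLp_gradient 2 μ).smul hf)

theorem HasH1Grad.add (h : HasH1Grad Ω u G) (h' : HasH1Grad Ω w F) :
    HasH1Grad Ω (fun x => u x + w x) (fun x => G x + F x) := by
  refine ⟨h.memLp.add h'.memLp, h.memLp_grad.add h'.memLp_grad, fun φ hφ => ?_⟩
  simp only [add_smul, smul_add]
  rw [integral_add (hφ.integrable_smul_gradient_of_memLp h.memLp)
    (hφ.integrable_smul_gradient_of_memLp h'.memLp), integral_add
    (hφ.integrable_smul_of_memLp h.memLp_grad) (hφ.integrable_smul_of_memLp h'.memLp_grad),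
    h.eqn φ hφ, h'.eqn φ hφ, neg_add]

theorem HasH1Grad.const_mul (h : HasH1Grad Ω u G) (c : ℝ) :
    HasH1Grad Ω (fun x => c * u x) (fun x => c • G x) := by
  refine ⟨h.memLp.const_mul c, h.memLp_grad.const_smul c, fun φ hφ => ?_⟩
  simp only [mul_smul, smul_comm _ c]
  rw [integral_smul, integral_smul, h.eqn φ hφ, smul_neg]

theorem HasH1Grad.neg (h : HasH1Grad Ω u G) : HasH1Grad Ω (fun x => -u x) (fun x => -G x) := by
  simpa using h.const_mul (-1)

theorem HasH1Grad.sub (h : HasH1Grad Ω u G) (h' : HasH1Grad Ω w F) :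
    HasH1Grad Ω (fun x => u x - w x) (fun x => G x - F x) := by
  simpa [sub_eq_add_neg] using h.add h'.neg

theorem HasH1Grad.of_contDiff [IsFiniteMeasure (volume.restrict Ω)] {f : E3 → ℝ}
    (hf : ContDiff ℝ 1 f) (h2 : MemLp f 2 (volume.restrict Ω))
    (h2' : MemLp (gradient f) 2 (volume.restrict Ω)) : HasH1Grad Ω f (gradient f) := by
  refine ⟨h2, h2', fun φ hφ => ?_⟩
  rw [setIntegral_eq_integral_of_forall_compl_eq_zero,
    setIntegral_eq_integral_of_forall_compl_eq_zero,
    integral_smul_gradient hf hφ.contDiff_one hφ.2.1]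
  · intro x hx; simp [hφ.eq_zero hx]
  · intro x hx; simp [hφ.gradient_eq_zero hx]

theorem HasH1Grad.const [IsFiniteMeasure (volume.restrict Ω)] (c : ℝ) :
    HasH1Grad Ω (fun _ => c) (fun _ => 0) := by
  have := HasH1Grad.of_contDiff (Ω := Ω) (f := fun _ => c) contDiff_const (memLp_const c)
    (by simp)
  simpa using this

/-- Product with a test function. -/
theorem HasH1Grad.test_mul (h : HasH1Grad Ω u G) {χ : E3 → ℝ} (hχ : IsTest Ω χ) :
    HasH1Grad Ω (fun x => χ x * u x) (fun x => χ x • G x + u x • gradient χ x) := by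
  refine ⟨h.memLp.mul (hχ.memLp ∞ _), (h.memLp_grad.smul (r := 2) (hχ.memLp ∞ _)).add
    ((hχ.memLp_gradient ∞ _).smul (r := 2) h.memLp), fun φ hφ => ?_⟩
  have e := h.eqn _ (hφ.mul hχ.1)
  simp only [fun x => gradient_mul (hχ.differentiable x) (hφ.differentiable x), smul_add] at e
  have i1 : IntegrableOn (fun x => u x • χ x • gradient φ x) Ω :=
    memLp_one_iff_integrable.1 (((hφ.memLp_gradient 2 _).smul (r := 2) (hχ.memLp ∞ _)).smul h.memLp)
  have i2 : IntegrableOn (fun x => u x • φ x • gradient χ x) Ω :=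
    memLp_one_iff_integrable.1 (((hχ.memLp_gradient 2 _).smul (r := 2) (hφ.memLp ∞ _)).smul h.memLp)
  have i3 : IntegrableOn (fun x => (χ x * φ x) • G x) Ω :=
    (hφ.mul hχ.1).integrable_smul_of_memLp h.memLp_grad
  rw [integral_add i1 i2] at e
  have e1 : ∫ x in Ω, (χ x * u x) • gradient φ x = ∫ x in Ω, u x • χ x • gradient φ x := by
    simp only [smul_smul, mul_comm]
  have e2 : ∫ x in Ω, φ x • (χ x • G x + u x • gradient χ x) =
      (∫ x in Ω, (χ x * φ x) • G x) + ∫ x in Ω, u x • φ x • gradient χ x := by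
    rw [← integral_add i3 i2]
    congr 1 with x : 1
    simp only [smul_add, smul_smul, mul_comm]
  rw [e1, e2, neg_add, ← e]
  abel

end WeakGradients

/-! ### Inner products and strong-to-weak convergence in L² -/

section LTwo

variable {X Z : Type*} [MeasurableSpace X] {μ : Measure X} [NormedAddCommGroup Z]
  [InnerProductSpace ℝ Z]

theorem toLp_inner_toLp {f g : X → Z} (hf : MemLp f 2 μ) (hg : MemLp g 2 μ) :
    inner ℝ (hf.toLp f) (hg.toLp g) = ∫ x, inner ℝ (f x) (g x) ∂μ := by
  rw [L2.inner_def]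
  refine integral_congr_ae ?_
  filter_upwards [hf.coeFn_toLp, hg.coeFn_toLp] with x h1 h2
  rw [h1, h2]

theorem MemLp.integrable_inner_two {f g : X → Z} (hf : MemLp f 2 μ) (hg : MemLp g 2 μ) :
    Integrable (fun x => inner ℝ (f x) (g x)) μ := by
  refine (L2.integrable_inner (𝕜 := ℝ) (hf.toLp f) (hg.toLp g)).congr ?_
  filter_upwards [hf.coeFn_toLp, hg.coeFn_toLp] with x h1 h2
  rw [h1, h2]

theorem abs_integral_inner_le {f g : X → Z} (hf : MemLp f 2 μ) (hg : MemLp g 2 μ) :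
    |∫ x, inner ℝ (f x) (g x) ∂μ| ≤ (eLpNorm f 2 μ).toReal * (eLpNorm g 2 μ).toReal := by
  rw [← toLp_inner_toLp hf hg, ← Lp.norm_toLp f hf, ← Lp.norm_toLp g hg]
  exact abs_real_inner_le_norm _ _

theorem integral_norm_sq_eq {f : X → Z} (hf : MemLp f 2 μ) :
    ∫ x, ‖f x‖ ^ 2 ∂μ = (eLpNorm f 2 μ).toReal ^ 2 := by
  rw [← Lp.norm_toLp f hf, ← real_inner_self_eq_norm_sq, toLp_inner_toLp]
  simp

theorem tendsto_integral_inner {ι : Type*} {l : Filter ι} {f : ι → X → Z} {g c : X → Z}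
    (hf : ∀ i, MemLp (f i) 2 μ) (hg : MemLp g 2 μ) (hc : MemLp c 2 μ)
    (h : Tendsto (fun i => eLpNorm (fun x => g x - f i x) 2 μ) l (𝓝 0)) :
    Tendsto (fun i => ∫ x, inner ℝ (c x) (f i x) ∂μ) l (𝓝 (∫ x, inner ℝ (c x) (g x) ∂μ)) := by
  have h' : Tendsto (fun i => (eLpNorm c 2 μ).toReal *
      (eLpNorm (fun x => g x - f i x) 2 μ).toReal) l (𝓝 0) := by
    have := (ENNReal.tendsto_toReal ENNReal.zero_ne_top).comp h
    simpa using this.const_mul (eLpNorm c 2 μ).toReal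
  rw [tendsto_iff_dist_tendsto_zero]
  refine squeeze_zero (fun _ => dist_nonneg) (fun i => ?_) h'
  have := abs_integral_inner_le hc (hg.sub (hf i))
  simp only [Pi.sub_apply, inner_sub_right] at this
  rw [integral_sub (MemLp.integrable_inner_two hc hg) (MemLp.integrable_inner_two hc (hf i))] at this
  rw [dist_comm, Real.dist_eq]
  exact this

end LTwo

/-! ### Continuity of translations in L² -/

section Translation

variable {X Z : Type*} [NormedAddCommGroup X] [NormedSpace ℝ X] [FiniteDimensional ℝ X]
  [MeasurableSpace X] [BorelSpace X] {μ : Measure X} [μ.IsAddHaarMeasure]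
  [NormedAddCommGroup Z] [InnerProductSpace ℝ Z]

/-- The correlation of two square integrable functions is continuous. -/
theorem continuous_integral_inner_translate {f g : X → Z} (hf : MemLp f 2 μ) (hg : MemLp g 2 μ) :
    Continuous fun z => ∫ x, inner ℝ (f (x - z)) (g x) ∂μ := by
  have : FiniteDimensional ℝ X := inferInstance
  have : ProperSpace X := FiniteDimensional.proper ℝ X
  let T : X → C(X, X) := fun z => ⟨fun x => x - z, by fun_prop⟩
  have hT : Continuous T := ContinuousMap.continuous_of_continuous_uncurry _ (by
    simp only [Function.uncurry_def, T, ContinuousMap.coe_mk]; fun_prop)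
  have hTm : ∀ z, MeasurePreserving (T z) μ μ := fun z => measurePreserving_sub_right μ z
  -- Strong continuity of translations: composition with a continuous family of measure preserving
  -- maps acts continuously on `Lp`.
  have hc := (continuous_const (y := hf.toLp f)).compMeasurePreservingLp hT hTm (by norm_num)
  have : ∀ z, ∫ x, inner ℝ (f (x - z)) (g x) ∂μ =
      inner ℝ (Lp.compMeasurePreserving (T z) (hTm z) (hf.toLp f)) (hg.toLp g) := by
    intro z
    rw [L2.inner_def]
    refine integral_congr_ae ?_
    filter_upwards [hg.coeFn_toLp, Lp.coeFn_compMeasurePreserving (hf.toLp f) (hTm z),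
      (hTm z).quasiMeasurePreserving.ae_eq_comp hf.coeFn_toLp] with x h1 h2 h3
    rw [h1, h2, h3]
    rfl
  simp only [this]
  exact hc.inner continuous_const

/-- Integrability of shifted correlations, for a family of shifts over a finite measure space. -/
theorem integrable_inner_translate_prod {S : Type*} [MeasurableSpace S] {ν : Measure S}
    [IsFiniteMeasure ν] {θ : S → X} (hθ : Measurable θ) {f g : X → Z} (hf : MemLp f 2 μ)
    (hg : MemLp g 2 μ) :
    Integrable (fun p : S × X => inner ℝ (f (p.2 - θ p.1)) (g p.2)) (ν.prod μ) := by
  have : ProperSpace X := FiniteDimensional.proper ℝ X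
  -- The shear (s, x) ↦ (s, x - θ s) preserves the product measure, so joint square integrability
  -- survives a shift that varies with s.
  have hmp : MeasurePreserving (fun p : S × X => (p.1, p.2 - θ p.1)) (ν.prod μ) (ν.prod μ) :=
    (MeasurePreserving.id ν).skew_product (g := fun s x => x - θ s)
      (measurable_snd.sub (hθ.comp measurable_fst))
      (Eventually.of_forall fun s => (measurePreserving_sub_right μ (θ s)).map_eq)
  exact MemLp.integrable_inner_two ((hf.comp_snd ν).comp_measurePreserving hmp) (hg.comp_snd ν)

end Translation

/-! ### H¹₀ described by duality -/

section HOneZero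

variable {Ω : Set E3} {u w : E3 → ℝ} {G F : E3 → E3}

/-- `u ∈ H¹₀(Ω)` with weak gradient `G`, described by duality: `(u, G)` is annihilated by every
pair of square integrable functions that annihilates the pairs `(φ, ∇φ)`, `φ` a test function. -/
structure HasH10Grad (Ω : Set E3) (u : E3 → ℝ) (G : E3 → E3) : Prop where
  memLp : MemLp u 2 (volume.restrict Ω)
  memLp_grad : MemLp G 2 (volume.restrict Ω)
  annih : ∀ (a : E3 → ℝ) (b : E3 → E3), MemLp a 2 (volume.restrict Ω) →
    MemLp b 2 (volume.restrict Ω) →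
    (∀ φ, IsTest Ω φ → (∫ x in Ω, a x * φ x) + ∫ x in Ω, inner ℝ (b x) (gradient φ x) = 0) →
    (∫ x in Ω, a x * u x) + ∫ x in Ω, inner ℝ (b x) (G x) = 0

theorem integral_mul_eq_inner {X : Type*} [MeasurableSpace X] {μ : Measure X} (a u : X → ℝ) :
    ∫ x, a x * u x ∂μ = ∫ x, inner ℝ (a x) (u x) ∂μ := by
  simp [mul_comm]

theorem MemLp.integrable_mul_two {X : Type*} [MeasurableSpace X] {μ : Measure X} {a u : X → ℝ}
    (ha : MemLp a 2 μ) (hu : MemLp u 2 μ) : Integrable (fun x => a x * u x) μ := by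
  simpa [mul_comm] using MemLp.integrable_inner_two ha hu

/-- Weak sequential closedness of `H¹₀`. -/
theorem HasH10Grad.of_tendsto {ι : Type*} {l : Filter ι} [l.NeBot] {v : ι → E3 → ℝ}
    {H : ι → E3 → E3} (hv : ∀ i, HasH10Grad Ω (v i) (H i))
    (hu : MemLp u 2 (volume.restrict Ω)) (hG : MemLp G 2 (volume.restrict Ω))
    (h1 : ∀ a, MemLp a 2 (volume.restrict Ω) →
      Tendsto (fun i => ∫ x in Ω, a x * v i x) l (𝓝 (∫ x in Ω, a x * u x)))
    (h2 : ∀ b, MemLp b 2 (volume.restrict Ω) →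
      Tendsto (fun i => ∫ x in Ω, inner ℝ (b x) (H i x)) l (𝓝 (∫ x in Ω, inner ℝ (b x) (G x)))) :
    HasH10Grad Ω u G := by
  refine ⟨hu, hG, fun a b ha hb h => ?_⟩
  refine tendsto_nhds_unique ((h1 a ha).add (h2 b hb)) ?_
  simp only [fun i => (hv i).annih a b ha hb h, tendsto_const_nhds]

theorem IsTest.hasH10Grad {φ : E3 → ℝ} (h : IsTest Ω φ) : HasH10Grad Ω φ (gradient φ) :=
  ⟨h.memLp 2 _, h.memLp_gradient 2 _, fun _ _ _ _ H => H φ h⟩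

theorem HasH10Grad.congr (h : HasH10Grad Ω u G) (hu : u =ᵐ[volume.restrict Ω] w)
    (hG : G =ᵐ[volume.restrict Ω] F) : HasH10Grad Ω w F := by
  refine ⟨h.memLp.ae_eq hu, h.memLp_grad.ae_eq hG, fun a b ha hb H => ?_⟩
  rw [← h.annih a b ha hb H]
  congr 1
  · exact integral_congr_ae (by filter_upwards [hu] with x hx; rw [hx])
  · exact integral_congr_ae (by filter_upwards [hG] with x hx; rw [hx])

theorem HasH10Grad.add (h : HasH10Grad Ω u G) (h' : HasH10Grad Ω w F) :
    HasH10Grad Ω (fun x => u x + w x) (fun x => G x + F x) := by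
  refine ⟨h.memLp.add h'.memLp, h.memLp_grad.add h'.memLp_grad, fun a b ha hb H => ?_⟩
  have e1 := h.annih a b ha hb H
  have e2 := h'.annih a b ha hb H
  simp only [mul_add, inner_add_right]
  rw [integral_add (MemLp.integrable_mul_two ha h.memLp) (MemLp.integrable_mul_two ha h'.memLp),
    integral_add (MemLp.integrable_inner_two hb h.memLp_grad)
      (MemLp.integrable_inner_two hb h'.memLp_grad)]
  linarith

theorem HasH10Grad.const_mul (h : HasH10Grad Ω u G) (c : ℝ) :
    HasH10Grad Ω (fun x => c * u x) (fun x => c • G x) := by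
  refine ⟨h.memLp.const_mul c, h.memLp_grad.const_smul c, fun a b ha hb H => ?_⟩
  have e1 := h.annih a b ha hb H
  simp only [inner_smul_right, mul_left_comm _ c]
  rw [integral_const_mul, integral_const_mul, ← mul_add, e1, mul_zero]

theorem HasH10Grad.neg (h : HasH10Grad Ω u G) : HasH10Grad Ω (fun x => -u x) (fun x => -G x) := by
  simpa using h.const_mul (-1)

theorem HasH10Grad.sub (h : HasH10Grad Ω u G) (h' : HasH10Grad Ω w F) :
    HasH10Grad Ω (fun x => u x - w x) (fun x => G x - F x) := by
  simpa [sub_eq_add_neg] using h.add h'.neg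

/-- The annihilation identity holds along approximating test functions and passes to the L² limit.
-/
theorem MemH10.hasH10Grad (hΩ : IsOpen Ω) (h : MemH10 Ω u) : HasH10Grad Ω u (weakGrad Ω u) := by
  have h1 := h.1.hasH1Grad hΩ
  have hp : ∀ n : ℕ, (0 : ℝ≥0∞) < ((n : ℝ≥0∞) + 1)⁻¹ := fun n => by simp
  choose φ hφ hφ1 hφ2 using fun n : ℕ => h.2 _ (hp n)
  have hlim : Tendsto (fun n : ℕ => ((n : ℝ≥0∞) + 1)⁻¹) atTop (𝓝 0) := by
    have := (ENNReal.tendsto_inv_nat_nhds_zero).comp (tendsto_add_atTop_nat 1)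
    simpa [Function.comp_def] using this
  refine HasH10Grad.of_tendsto (l := atTop) (fun n => (hφ n).hasH10Grad) h1.memLp h1.memLp_grad
    (fun a ha => ?_) (fun b hb => ?_)
  · simp only [integral_mul_eq_inner]
    exact tendsto_integral_inner (fun n => (hφ n).memLp 2 _) h1.memLp ha
      (tendsto_of_tendsto_of_tendsto_of_le_of_le tendsto_const_nhds hlim (fun _ => zero_le) hφ1)
  · exact tendsto_integral_inner (fun n => (hφ n).memLp_gradient 2 _) h1.memLp_grad hb
      (tendsto_of_tendsto_of_tendsto_of_le_of_le tendsto_const_nhds hlim (fun _ => zero_le) hφ2)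

/-- For a vector v and a test function φ, the pair (v·∇φ, φv) annihilates every (ψ, ∇ψ) by classical
integration by parts. Annihilation of (u, G) by this pair is the v-component of the weak gradient
identity. -/
theorem HasH10Grad.hasH1Grad (h : HasH10Grad Ω u G) : HasH1Grad Ω u G := by
  refine ⟨h.memLp, h.memLp_grad, fun φ hφ => ?_⟩
  refine ext_inner_left ℝ fun v => ?_
  have i1 := hφ.integrable_smul_gradient_of_memLp h.memLp
  have i2 := hφ.integrable_smul_of_memLp h.memLp_grad
  have hb : MemLp (fun x => φ x • v) 2 (volume.restrict Ω) :=
    (hφ.continuous.smul continuous_const).memLp_of_hasCompactSupport hφ.2.1.smul_right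
  have ha : MemLp (fun x => inner ℝ v (gradient φ x)) 2 (volume.restrict Ω) :=
    (hφ.memLp_gradient 2 _).const_inner v
  have key := h.annih _ _ ha hb fun ψ hψ => by
    have e := integral_smul_gradient hφ.contDiff_one hψ.contDiff_one hψ.2.1
    have e1 := congrArg (inner ℝ v) e
    rw [inner_neg_right, ← integral_inner (hψ.integrable_smul_gradient_of_memLp (hφ.memLp 2 _)),
      ← integral_inner (hφ.integrable_smul_gradient_of_memLp (hψ.memLp 2 _))] at e1
    rw [setIntegral_eq_integral_of_forall_compl_eq_zero,
      setIntegral_eq_integral_of_forall_compl_eq_zero]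
    · simp only [inner_smul_left, inner_smul_right] at e1 ⊢
      simp only [conj_trivial, mul_comm (inner ℝ v (gradient φ _))]
      rw [e1]; ring
    · intro x hx; simp [hφ.eq_zero hx]
    · intro x hx; simp [hψ.eq_zero hx]
  rw [inner_neg_right, ← integral_inner i1, ← integral_inner i2]
  simp only [inner_smul_left, inner_smul_right, conj_trivial] at key ⊢
  simp only [mul_comm (u _)]
  linarith

end HOneZero

/-! ### Compactly supported H¹ functions belong to H¹₀ -/

section Mollification

open scoped Convolution

variable {Ω K : Set E3} {u : E3 → ℝ} {G : E3 → E3}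

/-- Since u and G vanish off K, multiplying ψ by a cut-off equal to one near K changes neither
integral; thus ψ itself needs no support condition. -/
theorem integral_smul_gradient_of_support_subset (hΩ : IsOpen Ω) (hK : IsCompact K) (hKΩ : K ⊆ Ω)
    (h : HasH1Grad Ω u G) (hu : ∀ x, x ∉ K → u x = 0) (hG : ∀ x, x ∉ K → G x = 0)
    {ψ : E3 → ℝ} (hψ : ContDiff ℝ ∞ ψ) :
    ∫ x, u x • gradient ψ x = - ∫ x, ψ x • G x := by
  obtain ⟨χ, hχ, hχ1⟩ := exists_isTest_eq_one hK hΩ hKΩ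
  have e := h.eqn _ (hχ.mul hψ)
  rw [setIntegral_eq_integral_of_forall_compl_eq_zero
      (fun x hx => by simp [hu x fun h => hx (hKΩ h)]),
    setIntegral_eq_integral_of_forall_compl_eq_zero
      (fun x hx => by simp [hG x fun h => hx (hKΩ h)])] at e
  have hx1 : ∀ x ∈ K, ∀ᶠ y in 𝓝 x, χ y = 1 := fun x hx => hχ1.filter_mono (nhds_le_nhdsSet hx)
  have e1 : ∀ x, u x • gradient (fun y => ψ y * χ y) x = u x • gradient ψ x := by
    intro x
    by_cases hx : x ∈ K
    · rw [Filter.EventuallyEq.gradient_eq (f := ψ)]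
      filter_upwards [hx1 x hx] with y hy
      simp [hy]
    · simp [hu x hx]
  have e2 : ∀ x, (ψ x * χ x) • G x = ψ x • G x := by
    intro x
    by_cases hx : x ∈ K
    · simp [(hx1 x hx).self_of_nhds]
    · simp [hG x hx]
  simpa only [e1, e2] using e

theorem gradient_comp_const_sub {ψ : E3 → ℝ} (hψ : Differentiable ℝ ψ) (x t : E3) :
    gradient (fun y => ψ (x - y)) t = - gradient ψ (x - t) := by
  simp only [gradient]
  have := ((hψ (x - t)).hasFDerivAt.comp t ((hasFDerivAt_id t).const_sub x)).fderiv
  rw [show (fun y => ψ (x - y)) = ψ ∘ (HSub.hSub x) from rfl, this]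
  simp

/-- Mollification: properties of `η ⋆ u` for `u ∈ H¹` with compact support. -/
theorem exists_isTest_mollification (hΩ : IsOpen Ω) (hK : IsCompact K) (hKΩ : K ⊆ Ω)
    (h : HasH1Grad Ω u G) (hu : ∀ x, x ∉ K → u x = 0) (hG : ∀ x, x ∉ K → G x = 0) :
    ∃ δ > 0, ∀ f : ContDiffBump (0 : E3), f.rOut < δ → ∃ φ, IsTest Ω φ ∧
      (∀ x, φ x = ∫ z, f.normed volume z * u (x - z)) ∧
      (∀ x v, inner ℝ v (gradient φ x) = ∫ z, f.normed volume z * inner ℝ v (G (x - z))) := by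
  obtain ⟨δ, hδ, hδΩ⟩ := hK.exists_cthickening_subset_open hΩ hKΩ
  have hu1 : IntegrableOn u K := (locallyIntegrableOn_of_memLp_two hΩ h.memLp).integrableOn_compact_subset hKΩ hK
  have hu2 : Integrable u := (integrableOn_iff_integrable_of_support_subset
    fun x hx => by_contra fun h' => hx (hu x h')).1 hu1
  refine ⟨δ, hδ, fun f hf => ?_⟩
  set η : E3 → ℝ := f.normed volume with hη
  have hηc : ContDiff ℝ ∞ η := f.contDiff_normed
  have hηs : HasCompactSupport η := f.hasCompactSupport_normed
  have hηneg : ∀ x, η (-x) = η x := f.normed_neg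
  let φ : E3 → ℝ := u ⋆[ContinuousLinearMap.mul ℝ ℝ, volume] η
  have hφ : ∀ x, φ x = ∫ t, u t * η (x - t) := fun x => by
    simp [φ, convolution_def]
  have hsupp : Function.support φ ⊆ Metric.cthickening f.rOut K := by
    intro x hx
    by_contra hcon
    refine hx ?_
    rw [hφ]
    refine integral_eq_zero_of_ae (Eventually.of_forall fun t => ?_)
    by_cases ht : t ∈ K
    · have : η (x - t) = 0 := by
        by_contra h0
        have hm : x - t ∈ Function.support (f.normed volume) := h0
        rw [f.support_normed_eq, mem_ball_zero_iff, ← dist_eq_norm] at hm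
        exact hcon (Metric.mem_cthickening_of_dist_le x t _ K ht hm.le)
      simp [this]
    · simp [hu t ht]
  have hcth : IsCompact (Metric.cthickening f.rOut K) := hK.cthickening
  refine ⟨φ, ⟨hηs.contDiff_convolution_right _ hu2.locallyIntegrable hηc, ?_, ?_⟩, ?_, ?_⟩
  · exact HasCompactSupport.of_support_subset_isCompact hcth hsupp
  · exact (closure_minimal hsupp hcth.isClosed).trans
      ((Metric.cthickening_mono hf.le K).trans hδΩ)
  · intro x
    rw [hφ, ← integral_sub_left_eq_self _ volume x]
    simp [mul_comm]
  · intro x v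
    have hd := (hηs.hasFDerivAt_convolution_right (ContinuousLinearMap.mul ℝ ℝ)
      hu2.locallyIntegrable (hηc.of_le (by norm_cast)) x).fderiv
    -- Tested with y ↦ η(x - y), this moves the derivative in ∇(η ⋆ u) from η to u.
    have e := integral_smul_gradient_of_support_subset hΩ hK hKΩ h hu hG
      (ψ := fun y => η (x - y)) (hηc.comp (contDiff_const.sub contDiff_id))
    have hG1 : Integrable G := (integrableOn_iff_integrable_of_support_subset
      fun x hx => by_contra fun h' => hx (hG x h')).1
      ((locallyIntegrableOn_of_memLp_two hΩ h.memLp_grad).integrableOn_compact_subset hKΩ hK)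
    have hηx : HasCompactSupport fun y => η (x - y) :=
      hηs.comp_homeomorph (Homeomorph.subLeft x)
    obtain ⟨C, hC⟩ := (hηs.comp_homeomorph (Homeomorph.subLeft x)).exists_bound_of_continuous
      (hηc.continuous.comp (continuous_const.sub continuous_id))
    obtain ⟨C', hC'⟩ := (hasCompactSupport_gradient hηx).exists_bound_of_continuous
      (continuous_gradient (f := fun y => η (x - y)) ((hηc.comp (contDiff_const.sub contDiff_id)).of_le (by norm_cast)))
    have i1 : Integrable fun y => u y • gradient (fun y => η (x - y)) y :=
      hu2.smul_bdd C' (continuous_gradient (f := fun y => η (x - y))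
        ((hηc.comp (contDiff_const.sub contDiff_id)).of_le (by norm_cast))).aestronglyMeasurable
        (Eventually.of_forall hC')
    have i2 : Integrable fun y => η (x - y) • G y :=
      hG1.bdd_smul C (hηc.continuous.comp (continuous_const.sub continuous_id)).aestronglyMeasurable
        (Eventually.of_forall hC)
    have e1 := congrArg (inner ℝ v) e
    rw [inner_neg_right, ← integral_inner i1, ← integral_inner i2] at e1
    simp only [gradient_comp_const_sub (hηc.differentiable (by simp)), inner_smul_right, inner_neg_right, mul_neg,
      integral_neg, neg_inj] at e1
    rw [inner_gradient_right', hd, convolution_precompR_apply _ hu2.locallyIntegrable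
      (hηs.fderiv ℝ) (hηc.continuous_fderiv (by simp))]
    simp only [convolution_def, ContinuousLinearMap.mul_apply', ← inner_gradient_right']
    rw [e1, ← integral_sub_left_eq_self _ volume x]
    simp

theorem memLp_of_restrict_of_support {X Z : Type*} [MeasurableSpace X] {μ : Measure X}
    [NormedAddCommGroup Z] {s : Set X} (hs : MeasurableSet s) {f : X → Z} {p : ℝ≥0∞}
    (hf : MemLp f p (μ.restrict s)) (h0 : ∀ x, x ∉ s → f x = 0) : MemLp f p μ := by
  rw [← memLp_indicator_iff_restrict hs] at hf
  rwa [indicator_eq_self.2 fun x hx => by_contra fun h => hx (h0 x h)] at hf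

/-- Averages of a continuous function against normalized bumps concentrating at 0 approach its value
at 0; the reflection z ↦ c(-z) puts them into the form of a convolution at 0. -/
theorem eq_zero_of_integral_normed_mul_eq_zero {c : E3 → ℝ} (hc : Continuous c) {δ : ℝ}
    (hδ : 0 < δ) (h : ∀ f : ContDiffBump (0 : E3), f.rOut < δ →
      ∫ z, f.normed volume z * c z = 0) : c 0 = 0 := by
  refine eq_of_forall_dist_le fun ε hε => ?_
  obtain ⟨r, hr, hrc⟩ := Metric.continuousAt_iff.1 (hc.comp continuous_neg).continuousAt ε hε
  let f : ContDiffBump (0 : E3) :=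
    { rIn := min r δ / 4
      rOut := min r δ / 2
      rIn_pos := by positivity
      rIn_lt_rOut := by linarith [lt_min hr hδ] }
  have hm := lt_min hr hδ
  have h1 : f.rOut < δ := by simp only [f]; linarith [min_le_right r δ]
  have h2 : f.rOut < r := by simp only [f]; linarith [min_le_left r δ]
  have e := f.dist_normed_convolution_le (μ := volume) (g := fun z => c (-z)) (x₀ := 0) (ε := ε)
    (hc.comp continuous_neg).aestronglyMeasurable
    (fun x hx => (hrc (lt_trans (Metric.mem_ball.1 hx) h2)).le)
  simp only [convolution_def, zero_sub, neg_neg, neg_zero, ContinuousLinearMap.lsmul_apply,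
    smul_eq_mul, h f h1] at e
  rwa [dist_comm]

/-- If (a, b) annihilates test pairs, it annihilates every mollification of (u, G) at small scale.
By Fubini this says that the correlation c(z) of (a, b) with the translate of (u, G) by z has zero
average against every small bump. As c is continuous, c(0) = 0, which is the claim. Convergence of
mollifications in L² is never needed. -/
theorem HasH1Grad.hasH10Grad_of_zero_off (hΩ : IsOpen Ω) (hK : IsCompact K) (hKΩ : K ⊆ Ω)
    (h : HasH1Grad Ω u G) (hu : ∀ x, x ∉ K → u x = 0) (hG : ∀ x, x ∉ K → G x = 0) :
    HasH10Grad Ω u G := by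
  refine ⟨h.memLp, h.memLp_grad, fun a b ha hb H => ?_⟩
  obtain ⟨δ, hδ, hf⟩ := exists_isTest_mollification hΩ hK hKΩ h hu hG
  have hu2 : MemLp u 2 volume := memLp_of_restrict_of_support hΩ.measurableSet h.memLp
    fun x hx => hu x fun h' => hx (hKΩ h')
  have hG2 : MemLp G 2 volume := memLp_of_restrict_of_support hΩ.measurableSet h.memLp_grad
    fun x hx => hG x fun h' => hx (hKΩ h')
  let a' := Ω.indicator a
  let b' := Ω.indicator b
  have ha' : MemLp a' 2 volume := (memLp_indicator_iff_restrict hΩ.measurableSet).2 ha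
  have hb' : MemLp b' 2 volume := (memLp_indicator_iff_restrict hΩ.measurableSet).2 hb
  have ea : ∀ f : E3 → ℝ, ∫ x in Ω, a x * f x = ∫ x, a' x * f x := fun f => by
    rw [← integral_indicator hΩ.measurableSet]
    simp only [a', indicator_mul_left]
  have eb : ∀ f : E3 → E3, ∫ x in Ω, inner ℝ (b x) (f x) = ∫ x, inner ℝ (b' x) (f x) := fun f => by
    rw [← integral_indicator hΩ.measurableSet]
    congr 1 with x
    by_cases hx : x ∈ Ω <;> simp [b', hx]
  let c : E3 → ℝ := fun z => (∫ x, inner ℝ (u (x - z)) (a' x)) + ∫ x, inner ℝ (G (x - z)) (b' x)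
  have hc1 := continuous_integral_inner_translate hu2 ha'
  have hc2 := continuous_integral_inner_translate hG2 hb'
  have hc : Continuous c := hc1.add hc2
  have hc0 : ∀ f : ContDiffBump (0 : E3), f.rOut < δ → ∫ z, f.normed volume z * c z = 0 := by
    intro f hfδ
    obtain ⟨φ, hφ, e1, e2⟩ := hf f hfδ
    set η : E3 → ℝ := f.normed volume with hη
    have hηc : Continuous η := f.continuous_normed
    -- Restricting z to a ball containing the support of η gives a finite measure, as required for
    -- Fubini.
    let ν : Measure E3 := volume.restrict (Metric.closedBall 0 f.rOut)
    have : IsFiniteMeasure ν := ⟨by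
      simpa [ν] using (isCompact_closedBall (0 : E3) f.rOut).measure_lt_top (μ := volume)⟩
    have hν : ∀ F : E3 → ℝ, ∫ z, η z * F z = ∫ z, η z * F z ∂ν := fun F => by
      refine (setIntegral_eq_integral_of_forall_compl_eq_zero fun x hx => ?_).symm
      have : η x = 0 := by
        by_contra h0
        have hm : x ∈ Function.support (f.normed volume) := h0
        rw [f.support_normed_eq] at hm
        exact hx (Metric.ball_subset_closedBall hm)
      simp [this]
    obtain ⟨C, hC⟩ := f.hasCompactSupport_normed.exists_bound_of_continuous
      (f.continuous_normed (μ := volume))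
    have H' := H φ hφ
    rw [ea, eb] at H'
    have s1 : ∫ x, a' x * φ x = ∫ z, η z * ∫ x, inner ℝ (u (x - z)) (a' x) := by
      rw [hν]
      have hi := integrable_inner_translate_prod (ν := ν) measurable_id hu2 ha'
      have hi2 : Integrable (Function.uncurry fun z x => η z * inner ℝ (u (x - z)) (a' x))
          (ν.prod volume) := hi.bdd_mul
        (hηc.comp continuous_fst).aestronglyMeasurable (Eventually.of_forall fun p => hC p.1)
      simp only [← integral_const_mul]
      rw [integral_integral_swap hi2]
      refine integral_congr_ae (Eventually.of_forall fun x => ?_)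
      simp only [e1, hν, ← integral_const_mul]
      refine integral_congr_ae (Eventually.of_forall fun z => ?_)
      simp; ring
    have s2 : ∫ x, inner ℝ (b' x) (gradient φ x) = ∫ z, η z * ∫ x, inner ℝ (G (x - z)) (b' x) := by
      rw [hν]
      have hi := integrable_inner_translate_prod (ν := ν) measurable_id hG2 hb'
      have hi2 : Integrable (Function.uncurry fun z x => η z * inner ℝ (G (x - z)) (b' x))
          (ν.prod volume) := hi.bdd_mul
        (hηc.comp continuous_fst).aestronglyMeasurable (Eventually.of_forall fun p => hC p.1)
      simp only [← integral_const_mul]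
      rw [integral_integral_swap hi2]
      refine integral_congr_ae (Eventually.of_forall fun x => ?_)
      simp only [e2, hν]
      refine integral_congr_ae (Eventually.of_forall fun z => ?_)
      simp only [real_inner_comm]
    have hi : ∀ {c : E3 → ℝ}, Continuous c → Integrable fun z => η z * c z := fun hcc =>
      (hηc.mul hcc).integrable_of_hasCompactSupport f.hasCompactSupport_normed.mul_right
    simp only [c, mul_add]
    rw [integral_add (hi hc1) (hi hc2), ← s1, ← s2, H']
  have hc00 := eq_zero_of_integral_normed_mul_eq_zero hc hδ hc0
  rw [ea, eb, ← hc00]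
  simp only [c, sub_zero, integral_mul_eq_inner, real_inner_comm]

end Mollification

/-! ### Density of test functions, and limits of products -/

section Approximation

variable {Ω : Set E3} {u w : E3 → ℝ} {G F : E3 → E3}

/-- Pairs `(φ, ∇φ)`, with `φ` a test function, as a subspace of `L² × L²`. -/
def testPairs (Ω : Set E3) :
    Submodule ℝ (WithLp 2 (Lp ℝ 2 (volume.restrict Ω) × Lp E3 2 (volume.restrict Ω))) where
  carrier := {z | ∃ φ, IsTest Ω φ ∧ z.fst =ᵐ[volume.restrict Ω] φ ∧
    z.snd =ᵐ[volume.restrict Ω] gradient φ}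
  zero_mem' := ⟨_, IsTest.zero, Lp.coeFn_zero ℝ 2 (volume.restrict Ω), by
    rw [gradient_fun_const']
    exact Lp.coeFn_zero E3 2 (volume.restrict Ω)⟩
  add_mem' := by
    rintro y z ⟨φ, hφ, h1, h2⟩ ⟨ψ, hψ, h3, h4⟩
    refine ⟨_, hφ.add hψ, ?_, ?_⟩
    · filter_upwards [h1, h3, Lp.coeFn_add y.fst z.fst] with x e1 e2 e3
      rw [WithLp.add_fst, e3, Pi.add_apply, e1, e2]
    · filter_upwards [h2, h4, Lp.coeFn_add y.snd z.snd] with x e1 e2 e3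
      rw [WithLp.add_snd, e3, Pi.add_apply, e1, e2]
      simp only [gradient]
      rw [fderiv_fun_add (hφ.differentiable x) (hψ.differentiable x), map_add]
  smul_mem' := by
    rintro c z ⟨φ, hφ, h1, h2⟩
    refine ⟨_, hφ.smul c, ?_, ?_⟩
    · filter_upwards [h1, Lp.coeFn_smul c z.fst] with x e1 e3
      rw [WithLp.smul_fst, e3, Pi.smul_apply, e1, smul_eq_mul]
    · filter_upwards [h2, Lp.coeFn_smul c z.snd] with x e1 e3
      rw [WithLp.smul_snd, e3, Pi.smul_apply, e1,
        gradient_mul (differentiableAt_const c) (hφ.differentiable x)]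
      simp

/-- Functions in `H¹₀` are limits of test functions. -/
theorem HasH10Grad.exists_seq (h : HasH10Grad Ω u G) :
    ∃ φ : ℕ → E3 → ℝ, (∀ n, IsTest Ω (φ n)) ∧
      Tendsto (fun n => eLpNorm (fun x => u x - φ n x) 2 (volume.restrict Ω)) atTop (𝓝 0) ∧
      Tendsto (fun n => eLpNorm (fun x => G x - gradient (φ n) x) 2 (volume.restrict Ω))
        atTop (𝓝 0) ∧
      ∀ᵐ x ∂(volume.restrict Ω), Tendsto (fun n => φ n x) atTop (𝓝 (u x)) := by
  let z : WithLp 2 (Lp ℝ 2 (volume.restrict Ω) × Lp E3 2 (volume.restrict Ω)) :=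
    WithLp.toLp 2 (h.memLp.toLp u, h.memLp_grad.toLp G)
  -- In the Hilbert space L² × L², the closure of a subspace is its double orthogonal complement,
  -- and the duality definition says precisely that z is orthogonal to every y orthogonal to the
  -- test pairs.
  have hz : z ∈ (testPairs Ω).topologicalClosure := by
    rw [← Submodule.orthogonal_orthogonal_eq_closure, Submodule.mem_orthogonal]
    intro y hy
    rw [Submodule.mem_orthogonal'] at hy
    have hin : ∀ (a : E3 → ℝ) (b : E3 → E3) (ha : MemLp a 2 (volume.restrict Ω))
        (hb : MemLp b 2 (volume.restrict Ω)),
        inner ℝ y (WithLp.toLp 2 (ha.toLp a, hb.toLp b)) =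
          (∫ x in Ω, y.fst x * a x) + ∫ x in Ω, inner ℝ (y.snd x) (b x) := by
      intro a b ha hb
      rw [WithLp.prod_inner_apply, integral_mul_eq_inner,
        ← toLp_inner_toLp (Lp.memLp y.fst) ha, ← toLp_inner_toLp (Lp.memLp y.snd) hb,
        Lp.toLp_coeFn, Lp.toLp_coeFn]
      rfl
    rw [hin]
    refine h.annih _ _ (Lp.memLp _) (Lp.memLp _) fun φ hφ => ?_
    rw [← hin φ (gradient φ) (hφ.memLp 2 _) (hφ.memLp_gradient 2 _)]
    exact hy _ ⟨φ, hφ, (hφ.memLp 2 _).coeFn_toLp, (hφ.memLp_gradient 2 _).coeFn_toLp⟩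
  obtain ⟨zs, hzs, hlim⟩ := mem_closure_iff_seq_limit.1 hz
  choose φ hφ h1 h2 using hzs
  have l1 : Tendsto (fun n => eLpNorm (fun x => u x - φ n x) 2 (volume.restrict Ω))
      atTop (𝓝 0) := by
    have hc : Tendsto (fun n => (zs n).fst) atTop (𝓝 z.fst) :=
      ((WithLp.continuous_fst 2 _ _).tendsto z).comp hlim
    rw [Lp.tendsto_Lp_iff_tendsto_eLpNorm'] at hc
    refine hc.congr fun n => ?_
    rw [← eLpNorm_neg]
    refine eLpNorm_congr_ae ?_
    filter_upwards [h1 n, h.memLp.coeFn_toLp] with x e1 e2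
    rw [Pi.neg_apply, Pi.sub_apply, e1, neg_sub]
    exact congrArg (· - _) e2
  have l2 : Tendsto (fun n => eLpNorm (fun x => G x - gradient (φ n) x) 2 (volume.restrict Ω))
      atTop (𝓝 0) := by
    have hc : Tendsto (fun n => (zs n).snd) atTop (𝓝 z.snd) :=
      ((WithLp.continuous_snd 2 _ _).tendsto z).comp hlim
    rw [Lp.tendsto_Lp_iff_tendsto_eLpNorm'] at hc
    refine hc.congr fun n => ?_
    rw [← eLpNorm_neg]
    refine eLpNorm_congr_ae ?_
    filter_upwards [h2 n, h.memLp_grad.coeFn_toLp] with x e1 e2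
    rw [Pi.neg_apply, Pi.sub_apply, e1, neg_sub]
    exact congrArg (· - _) e2
  -- Almost everywhere convergence is available only along a subsequence, so the whole sequence is
  -- thinned at the end.
  have l3 : TendstoInMeasure (volume.restrict Ω) φ atTop u := by
    refine tendstoInMeasure_of_tendsto_eLpNorm (p := 2) (by norm_num)
      (fun n => (hφ n).continuous.aestronglyMeasurable) h.memLp.1 ?_
    refine l1.congr fun n => ?_
    rw [← eLpNorm_neg]
    congr 1 with x
    simp
  obtain ⟨ns, hns, hae⟩ := l3.exists_seq_tendsto_ae
  exact ⟨fun n => φ (ns n), fun n => hφ _, l1.comp hns.tendsto_atTop, l2.comp hns.tendsto_atTop, hae⟩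

/-- Weak continuity of products of a bounded, almost everywhere convergent sequence and a sequence
which converges in `L²`. -/
theorem tendsto_integral_inner_smul {X Z : Type*} [MeasurableSpace X] {μ : Measure X}
    [NormedAddCommGroup Z] [InnerProductSpace ℝ Z] {θ : ℕ → X → ℝ} {θ₀ : X → ℝ} {L : ℝ}
    {H : ℕ → X → Z} {H₀ c : X → Z}
    (hθm : ∀ n, AEStronglyMeasurable (θ n) μ) (hθb : ∀ n x, |θ n x| ≤ L)
    (hθ : ∀ᵐ x ∂μ, Tendsto (fun n => θ n x) atTop (𝓝 (θ₀ x)))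
    (hH : ∀ n, MemLp (H n) 2 μ) (hH₀ : MemLp H₀ 2 μ) (hc : MemLp c 2 μ)
    (h : Tendsto (fun n => eLpNorm (fun x => H₀ x - H n x) 2 μ) atTop (𝓝 0)) :
    Tendsto (fun n => ∫ x, inner ℝ (c x) (θ n x • H n x) ∂μ) atTop
      (𝓝 (∫ x, inner ℝ (c x) (θ₀ x • H₀ x) ∂μ)) := by
  have hmem : ∀ n, ∀ K : X → Z, MemLp K 2 μ → MemLp (fun x => θ n x • K x) 2 μ := fun n K hK =>
    hK.of_le_mul (c := L) ((hθm n).smul hK.1) (Eventually.of_forall fun x => by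
      rw [norm_smul]
      exact mul_le_mul_of_nonneg_right (hθb n x) (norm_nonneg _))
  -- Split θₙHₙ = θₙH₀ - θₙ(H₀ - Hₙ): dominated convergence handles the first term, Cauchy–Schwarz
  -- and |θₙ| ≤ L the second.
  have t1 : Tendsto (fun n => ∫ x, inner ℝ (c x) (θ n x • H₀ x) ∂μ) atTop
      (𝓝 (∫ x, inner ℝ (c x) (θ₀ x • H₀ x) ∂μ)) := by
    refine tendsto_integral_of_dominated_convergence (fun x => L * ‖inner ℝ (c x) (H₀ x)‖)
      (fun n => (MemLp.integrable_inner_two hc (hmem n _ hH₀)).1)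
      ((MemLp.integrable_inner_two hc hH₀).norm.const_mul L) (fun n => Eventually.of_forall fun x => ?_) ?_
    · rw [inner_smul_right, norm_mul]
      exact mul_le_mul_of_nonneg_right (hθb n x) (norm_nonneg _)
    · filter_upwards [hθ] with x hx
      exact tendsto_const_nhds.inner (hx.smul_const _)
  have t2 : Tendsto (fun n => ∫ x, inner ℝ (c x) (θ n x • (H₀ x - H n x)) ∂μ) atTop (𝓝 0) := by
    have h' : Tendsto (fun n => (eLpNorm c 2 μ).toReal * (L *
        (eLpNorm (fun x => H₀ x - H n x) 2 μ).toReal)) atTop (𝓝 0) := by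
      have := (ENNReal.tendsto_toReal ENNReal.zero_ne_top).comp h
      simpa using (this.const_mul L).const_mul (eLpNorm c 2 μ).toReal
    refine squeeze_zero_norm (fun n => ?_) h'
    refine (abs_integral_inner_le hc (hmem n _ (hH₀.sub (hH n)))).trans ?_
    refine mul_le_mul_of_nonneg_left ?_ ENNReal.toReal_nonneg
    rcases isEmpty_or_nonempty X with hX | ⟨⟨x₀⟩⟩
    · simp
    have hL : 0 ≤ L := (abs_nonneg _).trans (hθb 0 x₀)
    have hle : eLpNorm (fun x => θ n x • (H₀ - H n) x) 2 μ ≤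
        ENNReal.ofReal L * eLpNorm (fun x => H₀ x - H n x) 2 μ :=
      eLpNorm_le_mul_eLpNorm_of_ae_le_mul (Eventually.of_forall fun x => by
        rw [norm_smul]
        exact mul_le_mul_of_nonneg_right (hθb n x) (norm_nonneg _)) 2
    refine (ENNReal.toReal_mono (ENNReal.mul_ne_top ENNReal.ofReal_ne_top
      (hH₀.sub (hH n)).2.ne) hle).trans_eq ?_
    rw [ENNReal.toReal_mul, ENNReal.toReal_ofReal hL]
    rfl
  have := t1.sub t2
  rw [sub_zero] at this
  refine this.congr fun n => ?_
  rw [← integral_sub (MemLp.integrable_inner_two hc (hmem n _ hH₀))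
    (MemLp.integrable_inner_two hc (hmem n (fun x => H₀ x - H n x) (hH₀.sub (hH n))))]
  congr 1 with x
  rw [← inner_sub_right, ← smul_sub, sub_sub_cancel]

end Approximation

/-! ### Chain rules in H¹ and H¹₀ -/

section ChainRule

variable {Ω : Set E3} {u w b : E3 → ℝ} {G F B : E3 → E3} {Φ Φ' : ℝ → ℝ} {L : ℝ}

theorem abs_sub_le_of_hasDerivAt (hΦ : ∀ s, HasDerivAt Φ (Φ' s) s) (hb : ∀ s, |Φ' s| ≤ L)
    (s t : ℝ) : |Φ s - Φ t| ≤ L * |s - t| :=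
  convex_univ.norm_image_sub_le_of_norm_hasDerivWithin_le (f := Φ) (f' := Φ')
    (fun x _ => (hΦ x).hasDerivWithinAt) (fun x _ => hb x) (mem_univ t) (mem_univ s)

theorem memLp_comp_lipschitz [IsFiniteMeasure (volume.restrict Ω)]
    (hΦ : ∀ s, HasDerivAt Φ (Φ' s) s) (hb : ∀ s, |Φ' s| ≤ L)
    (hu : MemLp u 2 (volume.restrict Ω)) :
    MemLp (fun x => Φ (u x)) 2 (volume.restrict Ω) := by
  have hc : Continuous Φ := continuous_iff_continuousAt.2 fun s => (hΦ s).continuousAt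
  have : MemLp (fun x => Φ (u x) - Φ 0) 2 (volume.restrict Ω) :=
    hu.of_le_mul (c := L) ((hc.comp_aestronglyMeasurable hu.1).sub aestronglyMeasurable_const)
      (Eventually.of_forall fun x => by
        simpa using abs_sub_le_of_hasDerivAt hΦ hb (u x) 0)
  exact (this.add (memLp_const (Φ 0))).ae_eq (Eventually.of_forall fun x => by simp)

theorem memLp_smul_bdd {X Z : Type*} [MeasurableSpace X] {μ : Measure X} [NormedAddCommGroup Z]
    [NormedSpace ℝ Z] {θ : X → ℝ} {H : X → Z} (hθm : AEStronglyMeasurable θ μ)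
    (hθ : ∀ᵐ x ∂μ, |θ x| ≤ L) (hH : MemLp H 2 μ) : MemLp (fun x => θ x • H x) 2 μ :=
  hH.of_le_mul (c := L) (hθm.smul hH.1) (by
    filter_upwards [hθ] with x hx
    rw [norm_smul]
    exact mul_le_mul_of_nonneg_right hx (norm_nonneg _))

theorem tendsto_eLpNorm_comp_sub (hΦ : ∀ s, HasDerivAt Φ (Φ' s) s) (hb : ∀ s, |Φ' s| ≤ L)
    {μ : Measure E3} {v : ℕ → E3 → ℝ}
    (h : Tendsto (fun n => eLpNorm (fun x => u x - v n x) 2 μ) atTop (𝓝 0)) :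
    Tendsto (fun n => eLpNorm (fun x => Φ (u x) - Φ (v n x)) 2 μ) atTop (𝓝 0) := by
  have h' : Tendsto (fun n => ENNReal.ofReal L * eLpNorm (fun x => u x - v n x) 2 μ)
      atTop (𝓝 0) := by
    simpa using ENNReal.Tendsto.const_mul h (Or.inr ENNReal.ofReal_ne_top)
  refine tendsto_of_tendsto_of_tendsto_of_le_of_le tendsto_const_nhds h' (fun _ => zero_le)
    fun n => eLpNorm_le_mul_eLpNorm_of_ae_le_mul (Eventually.of_forall fun x =>
      abs_sub_le_of_hasDerivAt hΦ hb _ _) 2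

/-- Chain rule in `H¹` for `C¹` functions with bounded derivative. -/
theorem HasH1Grad.comp [IsFiniteMeasure (volume.restrict Ω)] (hΩ : IsOpen Ω)
    (h : HasH1Grad Ω u G) (hΦ : ∀ s, HasDerivAt Φ (Φ' s) s) (hc : Continuous Φ')
    (hb : ∀ s, |Φ' s| ≤ L) :
    HasH1Grad Ω (fun x => Φ (u x)) (fun x => Φ' (u x) • G x) := by
  have hΦc : Continuous Φ := continuous_iff_continuousAt.2 fun s => (hΦ s).continuousAt
  have hΦ1 : ContDiff ℝ 1 Φ := by
    rw [contDiff_one_iff_deriv]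
    exact ⟨fun s => (hΦ s).differentiableAt, by rwa [funext fun s => (hΦ s).deriv]⟩
  refine ⟨memLp_comp_lipschitz hΦ hb h.memLp, memLp_smul_bdd (hc.comp_aestronglyMeasurable h.memLp.1)
    (Eventually.of_forall fun x => hb _) h.memLp_grad, fun φ hφ => ?_⟩
  -- Only the values of u near the support of φ matter. With χ = 1 there, χu has compact support,
  -- hence is a limit of test functions, for which the chain rule is classical.
  obtain ⟨χ, hχ, hχ1⟩ := exists_isTest_eq_one hφ.2.1 hΩ hφ.2.2
  have hw : HasH10Grad Ω (fun x => χ x * u x) (fun x => χ x • G x + u x • gradient χ x) :=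
    (h.test_mul hχ).hasH10Grad_of_zero_off hΩ hχ.2.1 hχ.2.2
      (fun x hx => by simp [image_eq_zero_of_notMem_tsupport hx])
      (fun x hx => by
        simp [image_eq_zero_of_notMem_tsupport hx, gradient_eq_zero_of_notMem_tsupport hx])
  obtain ⟨ψ, hψ, l1, l2, l3⟩ := hw.exists_seq
  have hx1 : ∀ x ∈ tsupport φ, χ x = 1 ∧ gradient χ x = 0 := fun x hx => by
    have := hχ1.filter_mono (nhds_le_nhdsSet hx)
    refine ⟨this.self_of_nhds, ?_⟩
    rw [Filter.EventuallyEq.gradient_eq (f := fun _ => (1 : ℝ)) this, gradient_fun_const]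
  refine ext_inner_left ℝ fun v => ?_
  have hφv : MemLp (fun x => inner ℝ v (gradient φ x)) 2 (volume.restrict Ω) :=
    (hφ.memLp_gradient 2 _).const_inner v
  have hφv2 : MemLp (fun x => φ x • v) 2 (volume.restrict Ω) :=
    (hφ.continuous.smul continuous_const).memLp_of_hasCompactSupport hφ.2.1.smul_right
  have t1 := tendsto_integral_inner (fun n => memLp_comp_lipschitz hΦ hb ((hψ n).memLp 2 _))
    (memLp_comp_lipschitz hΦ hb hw.memLp) hφv (tendsto_eLpNorm_comp_sub hΦ hb l1)
  have t2 := tendsto_integral_inner_smul (θ := fun n x => Φ' (ψ n x))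
    (θ₀ := fun x => Φ' (χ x * u x)) (L := L)
    (fun n => (hc.comp (hψ n).continuous).aestronglyMeasurable) (fun n x => hb _)
    (by filter_upwards [l3] with x hx using (hc.tendsto _).comp hx)
    (fun n => (hψ n).memLp_gradient 2 _) hw.memLp_grad hφv2 l2
  have e : ∀ n, ∫ x in Ω, inner ℝ (inner ℝ v (gradient φ x)) (Φ (ψ n x)) =
      -∫ x in Ω, inner ℝ (φ x • v) (Φ' (ψ n x) • gradient (ψ n) x) := by
    intro n
    have hf : ContDiff ℝ 1 fun x => Φ (ψ n x) := hΦ1.comp (hψ n).contDiff_one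
    have hf2 : HasH1Grad Ω (fun x => Φ (ψ n x)) (gradient fun x => Φ (ψ n x)) := by
      refine HasH1Grad.of_contDiff hf (memLp_comp_lipschitz hΦ hb ((hψ n).memLp 2 _)) ?_
      rw [show (gradient fun x => Φ (ψ n x)) = fun x => Φ' (ψ n x) • gradient (ψ n) x from
        funext fun x => gradient_comp (hΦ _) ((hψ n).differentiable x)]
      exact memLp_smul_bdd (hc.comp (hψ n).continuous).aestronglyMeasurable
        (Eventually.of_forall fun x => hb _) ((hψ n).memLp_gradient 2 _)
    have e := congrArg (inner ℝ v) (hf2.eqn φ hφ)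
    rw [inner_neg_right, ← integral_inner (hφ.integrable_smul_gradient_of_memLp hf2.memLp),
      ← integral_inner (hφ.integrable_smul_of_memLp hf2.memLp_grad)] at e
    simp only [gradient_comp (hΦ _) ((hψ n).differentiable _), inner_smul_right] at e
    simp only [inner_smul_right, inner_smul_left, conj_trivial, RCLike.inner_apply]
    rw [e]
    congr 2 with x
    ring
  have key := tendsto_nhds_unique (t1.congr e) t2.neg
  rw [inner_neg_right, ← integral_inner, ← integral_inner]
  · have k1 : ∫ x in Ω, inner ℝ v (Φ (u x) • gradient φ x) =
        ∫ x in Ω, inner ℝ (inner ℝ v (gradient φ x)) (Φ (χ x * u x)) := by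
      congr 1 with x
      by_cases hx : x ∈ tsupport φ
      · simp [(hx1 x hx).1, inner_smul_right]
      · simp [gradient_eq_zero_of_notMem_tsupport hx]
    have k2 : ∫ x in Ω, inner ℝ v (φ x • Φ' (u x) • G x) = ∫ x in Ω, inner ℝ (φ x • v)
        (Φ' (χ x * u x) • (χ x • G x + u x • gradient χ x)) := by
      congr 1 with x
      by_cases hx : x ∈ tsupport φ
      · simp [(hx1 x hx).1, (hx1 x hx).2, inner_smul_right, inner_smul_left]; ring
      · simp [image_eq_zero_of_notMem_tsupport hx]
    rw [k1, k2, key]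
  · exact hφ.integrable_smul_of_memLp (memLp_smul_bdd (hc.comp_aestronglyMeasurable h.memLp.1)
      (Eventually.of_forall fun x => hb _) h.memLp_grad)
  · exact hφ.integrable_smul_gradient_of_memLp (memLp_comp_lipschitz hΦ hb h.memLp)

/-- A `C¹` function with bounded derivative maps functions with the same boundary values to
functions with the same boundary values. -/
theorem HasH10Grad.comp_add_sub_comp [IsFiniteMeasure (volume.restrict Ω)] (hΩ : IsOpen Ω)
    (hbB : HasH1Grad Ω b B) (h : HasH10Grad Ω w F) (hΦ : ∀ s, HasDerivAt Φ (Φ' s) s)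
    (hc : Continuous Φ') (hb : ∀ s, |Φ' s| ≤ L) :
    HasH10Grad Ω (fun x => Φ (b x + w x) - Φ (b x))
      (fun x => Φ' (b x + w x) • (B x + F x) - Φ' (b x) • B x) := by
  obtain ⟨ψ, hψ, l1, l2, l3⟩ := h.exists_seq
  have hψ1 : ∀ n, HasH1Grad Ω (ψ n) (gradient (ψ n)) := fun n => (hψ n).hasH10Grad.hasH1Grad
  have hA : HasH1Grad Ω (fun x => Φ (b x)) (fun x => Φ' (b x) • B x) := hbB.comp hΩ hΦ hc hb
  have hS := (hbB.add h.hasH1Grad).comp hΩ hΦ hc hb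
  have hSn := fun n => (hbB.add (hψ1 n)).comp hΩ hΦ hc hb
  -- Replacing w by a test function makes the difference vanish off a compact subset of Ω, whatever
  -- b is.
  have hn : ∀ n, HasH10Grad Ω (fun x => Φ (b x + ψ n x) - Φ (b x))
      (fun x => Φ' (b x + ψ n x) • (B x + gradient (ψ n) x) - Φ' (b x) • B x) := fun n =>
    ((hSn n).sub hA).hasH10Grad_of_zero_off hΩ (hψ n).2.1 (hψ n).2.2
      (fun x hx => by simp [image_eq_zero_of_notMem_tsupport hx])
      (fun x hx => by
        simp [image_eq_zero_of_notMem_tsupport hx, gradient_eq_zero_of_notMem_tsupport hx])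
  refine HasH10Grad.of_tendsto (l := atTop) hn (hS.sub hA).memLp (hS.sub hA).memLp_grad
    (fun a ha => ?_) (fun c hcm => ?_)
  · simp only [integral_mul_eq_inner]
    refine tendsto_integral_inner (fun n => ((hSn n).sub hA).memLp) (hS.sub hA).memLp ha ?_
    have l1' : Tendsto (fun n => eLpNorm (fun x => (b x + w x) - (b x + ψ n x)) 2
        (volume.restrict Ω)) atTop (𝓝 0) := by simpa using l1
    simpa using tendsto_eLpNorm_comp_sub hΦ hb l1'
  · simp only [inner_sub_right]
    have t2 := tendsto_integral_inner_smul (θ := fun n x => Φ' (b x + ψ n x))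
      (θ₀ := fun x => Φ' (b x + w x)) (L := L)
      (fun n => hc.comp_aestronglyMeasurable (hbB.add (hψ1 n)).memLp.1) (fun n x => hb _)
      (by filter_upwards [l3] with x hx using (hc.tendsto _).comp (tendsto_const_nhds.add hx))
      (fun n => (hbB.add (hψ1 n)).memLp_grad) (hbB.add h.hasH1Grad).memLp_grad hcm
      (by simpa using l2)
    rw [integral_sub (MemLp.integrable_inner_two hcm hS.memLp_grad)
      (MemLp.integrable_inner_two hcm hA.memLp_grad)]
    refine (t2.sub_const (∫ x in Ω, inner ℝ (c x) (Φ' (b x) • B x))).congr fun n => ?_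
    rw [integral_sub (MemLp.integrable_inner_two hcm (hSn n).memLp_grad)
      (MemLp.integrable_inner_two hcm hA.memLp_grad)]

/-- Extend the derivative by its endpoint values, which keeps it continuous and bounded, and
integrate from α. This makes `log`, `exp` and squares admissible for functions with values in a
compact interval. -/
theorem exists_extension_of_Icc {α β : ℝ} (hαβ : α ≤ β)
    (hΦ : ∀ s ∈ Icc α β, HasDerivAt Φ (Φ' s) s) (hc : ContinuousOn Φ' (Icc α β)) :
    ∃ Ψ Ψ' : ℝ → ℝ, ∃ L : ℝ, (∀ s, HasDerivAt Ψ (Ψ' s) s) ∧ Continuous Ψ' ∧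
      (∀ s, |Ψ' s| ≤ L) ∧ ∀ s ∈ Icc α β, Ψ s = Φ s ∧ Ψ' s = Φ' s := by
  let Ψ' : ℝ → ℝ := IccExtend hαβ ((Icc α β).domRestrict Φ')
  have hΨc : Continuous Ψ' := (continuousOn_iff_continuous_domRestrict.1 hc).Icc_extend'
  have hΨ' : ∀ s ∈ Icc α β, Ψ' s = Φ' s := fun s hs => by
    simp only [Ψ', IccExtend_of_mem hαβ _ hs]
    rfl
  obtain ⟨L, hL⟩ := isCompact_Icc.exists_bound_of_continuousOn hc
  refine ⟨fun s => Φ α + ∫ r in α..s, Ψ' r, Ψ', L, fun s => ?_, hΨc, fun s => ?_, fun s hs => ⟨?_, hΨ' s hs⟩⟩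
  · exact (intervalIntegral.integral_hasDerivAt_right (hΨc.intervalIntegrable _ _)
      hΨc.stronglyMeasurable.stronglyMeasurableAtFilter hΨc.continuousAt).const_add _
  · exact hL _ (projIcc α β hαβ s).2
  · have : ∫ r in α..s, Ψ' r = Φ s - Φ α := by
      refine intervalIntegral.integral_eq_sub_of_hasDerivAt (fun r hr => ?_)
        (hΨc.intervalIntegrable _ _)
      rw [uIcc_of_le hs.1] at hr
      have hr' : r ∈ Icc α β := ⟨hr.1, hr.2.trans hs.2⟩
      rw [hΨ' r hr']
      exact hΦ r hr'
    simp only [this]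
    ring

/-- Chain rule in `H¹` for functions with values in a compact interval. -/
theorem HasH1Grad.comp_of_mem_Icc [IsFiniteMeasure (volume.restrict Ω)] (hΩ : IsOpen Ω)
    (h : HasH1Grad Ω u G) {α β : ℝ} (hαβ : α ≤ β)
    (hu : ∀ᵐ x ∂(volume.restrict Ω), u x ∈ Icc α β)
    (hΦ : ∀ s ∈ Icc α β, HasDerivAt Φ (Φ' s) s) (hc : ContinuousOn Φ' (Icc α β)) :
    HasH1Grad Ω (fun x => Φ (u x)) (fun x => Φ' (u x) • G x) := by
  obtain ⟨Ψ, Ψ', L, h1, h2, h3, h4⟩ := exists_extension_of_Icc hαβ hΦ hc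
  refine (h.comp hΩ h1 h2 h3).congr ?_ ?_
  · filter_upwards [hu] with x hx using (h4 _ hx).1
  · filter_upwards [hu] with x hx
    rw [(h4 _ hx).2]

theorem HasH10Grad.comp_sub_comp_of_mem_Icc [IsFiniteMeasure (volume.restrict Ω)] (hΩ : IsOpen Ω)
    (hbB : HasH1Grad Ω b B) (h : HasH10Grad Ω (fun x => u x - b x) (fun x => G x - B x))
    {α β : ℝ} (hαβ : α ≤ β) (hu : ∀ᵐ x ∂(volume.restrict Ω), u x ∈ Icc α β)
    (hb : ∀ᵐ x ∂(volume.restrict Ω), b x ∈ Icc α β)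
    (hΦ : ∀ s ∈ Icc α β, HasDerivAt Φ (Φ' s) s) (hc : ContinuousOn Φ' (Icc α β)) :
    HasH10Grad Ω (fun x => Φ (u x) - Φ (b x)) (fun x => Φ' (u x) • G x - Φ' (b x) • B x) := by
  obtain ⟨Ψ, Ψ', L, h1, h2, h3, h4⟩ := exists_extension_of_Icc hαβ hΦ hc
  refine (HasH10Grad.comp_add_sub_comp hΩ hbB h h1 h2 h3).congr ?_ ?_
  · filter_upwards [hu, hb] with x hx hx'
    rw [add_sub_cancel, (h4 _ hx).1, (h4 _ hx').1]
  · filter_upwards [hu, hb] with x hx hx'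
    rw [add_sub_cancel, add_sub_cancel, (h4 _ hx).2, (h4 _ hx').2]

end ChainRule

/-! ### Truncation in H¹₀ -/

section PosPart

variable {Ω : Set E3} {u w b : E3 → ℝ} {G F B : E3 → E3}

theorem hasDerivAt_max_zero_sq (s : ℝ) : HasDerivAt (fun r : ℝ => max r 0 ^ 2) (2 * max s 0) s := by
  rcases lt_trichotomy s 0 with hs | rfl | hs
  · rw [max_eq_right hs.le, mul_zero]
    refine (hasDerivAt_const s (0 : ℝ)).congr_of_eventuallyEq ?_
    filter_upwards [eventually_lt_nhds hs] with r hr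
    simp [max_eq_right hr.le]
  · rw [hasDerivAt_iff_isLittleO]
    have : (fun r : ℝ => max r 0 ^ 2) =O[𝓝 0] fun r : ℝ => r ^ 2 := by
      refine Asymptotics.IsBigO.of_bound 1 (Eventually.of_forall fun r => ?_)
      rw [one_mul, norm_pow, norm_pow, Real.norm_eq_abs, Real.norm_eq_abs]
      refine pow_le_pow_left₀ (abs_nonneg _) ?_ 2
      rw [abs_of_nonneg (le_max_right r 0)]
      exact max_le (le_abs_self r) (abs_nonneg r)
    simpa using this.trans_isLittleO (Asymptotics.isLittleO_pow_id (by norm_num))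
  · rw [max_eq_left hs.le]
    refine (((hasDerivAt_id s).pow 2).congr_of_eventuallyEq ?_).congr_deriv (by simp)
    filter_upwards [eventually_gt_nhds hs] with r hr
    simp [max_eq_left hr.le]

/-- A `C¹` approximation of the positive part, vanishing on `(-∞, ε]`. -/
noncomputable def smoothPos (ε s : ℝ) : ℝ := √(max (s - ε) 0 ^ 2 + ε ^ 2) - ε

/-- The derivative of `smoothPos ε`. -/
noncomputable def smoothPosDeriv (ε s : ℝ) : ℝ := max (s - ε) 0 / √(max (s - ε) 0 ^ 2 + ε ^ 2)

theorem hasDerivAt_smoothPos {ε : ℝ} (hε : 0 < ε) (s : ℝ) :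
    HasDerivAt (smoothPos ε) (smoothPosDeriv ε s) s := by
  have h1 : HasDerivAt (fun r : ℝ => max (r - ε) 0 ^ 2) (2 * max (s - ε) 0) s := by
    simpa using (hasDerivAt_max_zero_sq (s - ε)).comp_sub_const s ε
  have h2 := ((h1.add_const (ε ^ 2)).sqrt (by positivity)).sub_const ε
  refine h2.congr_deriv ?_
  rw [smoothPosDeriv, mul_div_mul_left _ _ two_ne_zero]

theorem continuous_smoothPosDeriv {ε : ℝ} (hε : 0 < ε) : Continuous (smoothPosDeriv ε) := by
  unfold smoothPosDeriv
  refine Continuous.div (by fun_prop) (by fun_prop) fun s => ?_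
  positivity

theorem abs_smoothPosDeriv_le {ε : ℝ} (hε : 0 < ε) (s : ℝ) : |smoothPosDeriv ε s| ≤ 1 := by
  have h : 0 < √(max (s - ε) 0 ^ 2 + ε ^ 2) := by positivity
  rw [smoothPosDeriv, abs_of_nonneg (by positivity), div_le_one h]
  exact Real.le_sqrt_of_sq_le (by nlinarith)

theorem smoothPos_of_le {ε s : ℝ} (hε : 0 < ε) (hs : s ≤ ε) : smoothPos ε s = 0 := by
  simp [smoothPos, max_eq_right (sub_nonpos.2 hs), Real.sqrt_sq hε.le]

theorem smoothPosDeriv_of_le {ε s : ℝ} (hs : s ≤ ε) : smoothPosDeriv ε s = 0 := by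
  simp [smoothPosDeriv, max_eq_right (sub_nonpos.2 hs)]

theorem abs_smoothPos_le {ε : ℝ} (hε : 0 < ε) (s : ℝ) : |smoothPos ε s| ≤ |s| := by
  have := abs_sub_le_of_hasDerivAt (hasDerivAt_smoothPos hε) (abs_smoothPosDeriv_le hε) s 0
  simpa [smoothPos_of_le hε hε.le] using this

theorem tendsto_smoothPos (s : ℝ) : Tendsto (fun ε => smoothPos ε s) (𝓝 0) (𝓝 (max s 0)) := by
  have : Continuous fun ε => smoothPos ε s := by unfold smoothPos; fun_prop
  have h := this.tendsto 0
  simpa [smoothPos, Real.sqrt_sq] using h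

theorem tendsto_smoothPosDeriv (s : ℝ) :
    Tendsto (fun ε => smoothPosDeriv ε s) (𝓝[>] 0) (𝓝 (if 0 < s then 1 else 0)) := by
  split_ifs with hs
  · have h : ContinuousAt (fun ε => smoothPosDeriv ε s) 0 := by
      unfold smoothPosDeriv
      refine ContinuousAt.div (by fun_prop) (by fun_prop) ?_
      simp [max_eq_left hs.le, Real.sqrt_sq hs.le, hs.ne']
    have h' : Tendsto (fun ε => smoothPosDeriv ε s) (𝓝[>] 0) (𝓝 (smoothPosDeriv 0 s)) :=
      h.tendsto.mono_left nhdsWithin_le_nhds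
    simpa [smoothPosDeriv, max_eq_left hs.le, Real.sqrt_sq hs.le, hs.ne'] using h'
  · refine tendsto_const_nhds.congr' ?_
    filter_upwards [self_mem_nhdsWithin] with ε hε
    exact (smoothPosDeriv_of_le ((not_lt.1 hs).trans (le_of_lt hε))).symm

/-- Truncation: if `u` has the boundary values of a continuous function which is nonpositive on the
boundary, then the positive part of `u` is in `H¹₀`. -/
theorem HasH10Grad.posPart (hΩ : IsOpen Ω) (hΩb : Bornology.IsBounded Ω)
    (hbB : HasH1Grad Ω b B) (hbc : ContinuousOn b (closure Ω)) (hb0 : ∀ x ∈ frontier Ω, b x ≤ 0)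
    (h : HasH10Grad Ω (fun x => u x - b x) (fun x => G x - B x)) :
    HasH10Grad Ω (fun x => max (u x) 0) (fun x => (if 0 < u x then (1 : ℝ) else 0) • G x) := by
  have : IsFiniteMeasure (volume.restrict Ω) := ⟨by simpa using hΩb.measure_lt_top⟩
  have hu : HasH1Grad Ω u G := by
    refine (hbB.add h.hasH1Grad).congr ?_ ?_ <;> exact Eventually.of_forall fun x => by simp
  have hε : ∀ ε > 0, HasH10Grad Ω (fun x => smoothPos ε (u x))
      (fun x => smoothPosDeriv ε (u x) • G x) := by
    intro ε hε
    have h1 := HasH10Grad.comp_add_sub_comp hΩ hbB h (hasDerivAt_smoothPos hε)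
      (continuous_smoothPosDeriv hε) (abs_smoothPosDeriv_le hε)
    have h2 := hbB.comp hΩ (hasDerivAt_smoothPos hε)
      (continuous_smoothPosDeriv hε) (abs_smoothPosDeriv_le hε)
    -- Since b ≤ 0 < ε on the boundary, {b ≥ ε} is a compact subset of Ω. As `smoothPos ε` vanishes
    -- below ε, `smoothPos ε` of b is in H¹₀; adding `smoothPos ε` of u minus that of b gives the
    -- claim without a trace operator.
    let K : Set E3 := closure Ω ∩ b ⁻¹' Ici ε
    have hKc : IsCompact K := by
      refine hΩb.isCompact_closure.of_isClosed_subset ?_ inter_subset_left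
      exact hbc.preimage_isClosed_of_isClosed isClosed_closure isClosed_Ici
    have hKΩ : K ⊆ Ω := by
      rintro x ⟨hx, hx'⟩
      by_contra hxΩ
      have : x ∈ frontier Ω := by
        rw [frontier, hΩ.interior_eq]; exact ⟨hx, hxΩ⟩
      exact absurd (hb0 x this) (not_le.2 (lt_of_lt_of_le hε hx'))
    have hoff : ∀ x ∈ Ω, x ∉ K → b x ≤ ε := fun x hx hxK =>
      (not_le.1 fun h' => hxK ⟨subset_closure hx, h'⟩).le
    have e1 : (fun x => smoothPos ε (b x)) =ᵐ[volume.restrict Ω]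
        K.indicator fun x => smoothPos ε (b x) := by
      filter_upwards [ae_restrict_mem hΩ.measurableSet] with x hx
      by_cases hxK : x ∈ K
      · simp [hxK]
      · simp [hxK, smoothPos_of_le hε (hoff x hx hxK)]
    have e2 : (fun x => smoothPosDeriv ε (b x) • B x) =ᵐ[volume.restrict Ω]
        K.indicator fun x => smoothPosDeriv ε (b x) • B x := by
      filter_upwards [ae_restrict_mem hΩ.measurableSet] with x hx
      by_cases hxK : x ∈ K
      · simp [hxK]
      · simp [hxK, smoothPosDeriv_of_le (hoff x hx hxK)]
    have h3 := (h2.congr e1 e2).hasH10Grad_of_zero_off hΩ hKc hKΩ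
      (fun x hx => indicator_of_notMem hx _) (fun x hx => indicator_of_notMem hx _)
    refine (h1.add (h3.congr e1.symm e2.symm)).congr ?_ ?_
    · exact Eventually.of_forall fun x => by simp
    · exact Eventually.of_forall fun x => by simp
  have hm : AEStronglyMeasurable (fun x => if 0 < u x then (1 : ℝ) else 0) (volume.restrict Ω) := by
    have : Measurable fun s : ℝ => if 0 < s then (1 : ℝ) else 0 :=
      Measurable.ite measurableSet_Ioi measurable_const measurable_const
    exact (this.comp_aemeasurable hu.memLp.1.aemeasurable).aestronglyMeasurable
  have hG' : MemLp (fun x => (if 0 < u x then (1 : ℝ) else 0) • G x) 2 (volume.restrict Ω) :=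
    memLp_smul_bdd (L := 1) hm (Eventually.of_forall fun x => by split_ifs <;> simp) hu.memLp_grad
  have hu' : MemLp (fun x => max (u x) 0) 2 (volume.restrict Ω) :=
    hu.memLp.of_le ((continuous_id.max continuous_const).comp_aestronglyMeasurable hu.memLp.1)
      (Eventually.of_forall fun x => by
        simp only [Real.norm_eq_abs]
        rw [abs_of_nonneg (le_max_right _ _)]
        exact max_le (le_abs_self _) (abs_nonneg _))
  let ε : ℕ → ℝ := fun n => 1 / ((n : ℝ) + 1)
  have hε0 : ∀ n, 0 < ε n := fun n => by positivity
  have hεl : Tendsto ε atTop (𝓝[>] 0) := tendsto_nhdsWithin_iff.2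
    ⟨tendsto_one_div_add_atTop_nhds_zero_nat, Eventually.of_forall hε0⟩
  -- As ε → 0, functions and gradients converge pointwise and are dominated by |u| and |G|, so the
  -- pairings converge; weak closedness of H¹₀ concludes.
  refine HasH10Grad.of_tendsto (l := atTop) (fun n => hε (ε n) (hε0 n)) hu' hG'
    (fun a ha => ?_) (fun c hc => ?_)
  · refine tendsto_integral_of_dominated_convergence (fun x => ‖a x * u x‖)
      (fun n => (MemLp.integrable_mul_two ha (hε _ (hε0 n)).memLp).1)
      (MemLp.integrable_mul_two ha hu.memLp).norm (fun n => Eventually.of_forall fun x => ?_)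
      (Eventually.of_forall fun x => ?_)
    · rw [norm_mul, norm_mul]
      exact mul_le_mul_of_nonneg_left (abs_smoothPos_le (hε0 n) _) (norm_nonneg _)
    · exact ((tendsto_smoothPos (u x)).comp (hεl.mono_right nhdsWithin_le_nhds)).const_mul _
  · refine tendsto_integral_of_dominated_convergence (fun x => ‖inner ℝ (c x) (G x)‖)
      (fun n => (MemLp.integrable_inner_two hc (hε _ (hε0 n)).memLp_grad).1)
      (MemLp.integrable_inner_two hc hu.memLp_grad).norm
      (fun n => Eventually.of_forall fun x => ?_) (Eventually.of_forall fun x => ?_)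
    · rw [inner_smul_right, norm_mul]
      exact mul_le_of_le_one_left (norm_nonneg _) (abs_smoothPosDeriv_le (hε0 n) _)
    · exact tendsto_const_nhds.inner (((tendsto_smoothPosDeriv (u x)).comp hεl).smul_const _)

end PosPart

/-! ### Products of bounded functions -/

section Products

variable {Ω : Set E3} {u₁ u₂ w₁ w₂ : E3 → ℝ} {G₁ G₂ F₁ F₂ : E3 → E3}

theorem hasDerivAt_sq_div_four (s : ℝ) : HasDerivAt (fun r : ℝ => r ^ 2 / 4) (s / 2) s :=
  (((hasDerivAt_id s).pow 2).div_const 4).congr_deriv (by simp; ring)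

/-- Polarization, uw = (u + w)²/4 - (u - w)²/4, reduces products to the chain rule for s ↦ s²/4 on a
bounded interval. -/
theorem HasH1Grad.mul [IsFiniteMeasure (volume.restrict Ω)] (hΩ : IsOpen Ω)
    (h₁ : HasH1Grad Ω u₁ G₁) (h₂ : HasH1Grad Ω w₁ F₁) {K : ℝ}
    (hu : ∀ᵐ x ∂(volume.restrict Ω), |u₁ x| ≤ K) (hw : ∀ᵐ x ∂(volume.restrict Ω), |w₁ x| ≤ K) :
    HasH1Grad Ω (fun x => u₁ x * w₁ x) (fun x => w₁ x • G₁ x + u₁ x • F₁ x) := by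
  have hm : ∀ {v : E3 → ℝ}, (∀ᵐ x ∂(volume.restrict Ω), |v x| ≤ 2 * |K|) →
      ∀ᵐ x ∂(volume.restrict Ω), v x ∈ Icc (-(2 * |K|)) (2 * |K|) := fun hv => by
    filter_upwards [hv] with x hx using abs_le.1 hx
  have hK : -(2 * |K|) ≤ 2 * |K| := by linarith [abs_nonneg K]
  have a1 := (h₁.add h₂).comp_of_mem_Icc hΩ hK (hm (by
    filter_upwards [hu, hw] with x h1 h2
    linarith [abs_add_le (u₁ x) (w₁ x), le_abs_self K])) (fun s _ => hasDerivAt_sq_div_four s)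
    (by fun_prop)
  have a2 := (h₁.sub h₂).comp_of_mem_Icc hΩ hK (hm (by
    filter_upwards [hu, hw] with x h1 h2
    linarith [abs_sub (u₁ x) (w₁ x), le_abs_self K])) (fun s _ => hasDerivAt_sq_div_four s)
    (by fun_prop)
  refine (a1.sub a2).congr (Eventually.of_forall fun x => ?_) (Eventually.of_forall fun x => ?_)
  · simp only; ring
  · simp only; module

theorem HasH10Grad.mul_sub_mul [IsFiniteMeasure (volume.restrict Ω)] (hΩ : IsOpen Ω)
    (hu₂ : HasH1Grad Ω u₂ G₂) (hw₂ : HasH1Grad Ω w₂ F₂)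
    (h₁ : HasH10Grad Ω (fun x => u₁ x - u₂ x) (fun x => G₁ x - G₂ x))
    (h₂ : HasH10Grad Ω (fun x => w₁ x - w₂ x) (fun x => F₁ x - F₂ x)) {K : ℝ}
    (bu₁ : ∀ᵐ x ∂(volume.restrict Ω), |u₁ x| ≤ K) (bu₂ : ∀ᵐ x ∂(volume.restrict Ω), |u₂ x| ≤ K)
    (bw₁ : ∀ᵐ x ∂(volume.restrict Ω), |w₁ x| ≤ K) (bw₂ : ∀ᵐ x ∂(volume.restrict Ω), |w₂ x| ≤ K) :
    HasH10Grad Ω (fun x => u₁ x * w₁ x - u₂ x * w₂ x)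
      (fun x => (w₁ x • G₁ x + u₁ x • F₁ x) - (w₂ x • G₂ x + u₂ x • F₂ x)) := by
  have hm : ∀ {v : E3 → ℝ}, (∀ᵐ x ∂(volume.restrict Ω), |v x| ≤ 2 * |K|) →
      ∀ᵐ x ∂(volume.restrict Ω), v x ∈ Icc (-(2 * |K|)) (2 * |K|) := fun hv => by
    filter_upwards [hv] with x hx using abs_le.1 hx
  have hK : -(2 * |K|) ≤ 2 * |K| := by linarith [abs_nonneg K]
  have hadd : ∀ {u w : E3 → ℝ}, (∀ᵐ x ∂(volume.restrict Ω), |u x| ≤ K) →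
      (∀ᵐ x ∂(volume.restrict Ω), |w x| ≤ K) →
      ∀ᵐ x ∂(volume.restrict Ω), u x + w x ∈ Icc (-(2 * |K|)) (2 * |K|) := fun {u w} hu hw => hm (by
    filter_upwards [hu, hw] with x h1 h2
    linarith [abs_add_le (u x) (w x), le_abs_self K])
  have hsub : ∀ {u w : E3 → ℝ}, (∀ᵐ x ∂(volume.restrict Ω), |u x| ≤ K) →
      (∀ᵐ x ∂(volume.restrict Ω), |w x| ≤ K) →
      ∀ᵐ x ∂(volume.restrict Ω), u x - w x ∈ Icc (-(2 * |K|)) (2 * |K|) := fun {u w} hu hw => hm (by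
    filter_upwards [hu, hw] with x h1 h2
    linarith [abs_sub (u x) (w x), le_abs_self K])
  have a1 := HasH10Grad.comp_sub_comp_of_mem_Icc (u := fun x => u₁ x + w₁ x)
    (G := fun x => G₁ x + F₁ x) hΩ (hu₂.add hw₂)
    ((h₁.add h₂).congr (Eventually.of_forall fun x => by simp only; ring)
      (Eventually.of_forall fun x => by simp only; module)) hK (hadd bu₁ bw₁) (hadd bu₂ bw₂)
    (fun s _ => hasDerivAt_sq_div_four s) (by fun_prop)
  have a2 := HasH10Grad.comp_sub_comp_of_mem_Icc (u := fun x => u₁ x - w₁ x)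
    (G := fun x => G₁ x - F₁ x) hΩ (hu₂.sub hw₂)
    ((h₁.sub h₂).congr (Eventually.of_forall fun x => by simp only; ring)
      (Eventually.of_forall fun x => by simp only; module)) hK (hsub bu₁ bw₁) (hsub bu₂ bw₂)
    (fun s _ => hasDerivAt_sq_div_four s) (by fun_prop)
  refine (a1.sub a2).congr (Eventually.of_forall fun x => ?_) (Eventually.of_forall fun x => ?_)
  · simp only; ring
  · simp only; module

end Products

/-! ### Poincaré inequality -/

section Poincare

variable {Ω : Set E3}

theorem eLpNorm_restrict_eq_of_zero_off {Z : Type*} [NormedAddCommGroup Z] (hΩ : MeasurableSet Ω)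
    {f : E3 → Z} (h0 : ∀ x, x ∉ Ω → f x = 0) :
    eLpNorm f 2 (volume.restrict Ω) = eLpNorm f 2 volume := by
  rw [← eLpNorm_indicator_eq_eLpNorm_restrict hΩ,
    indicator_eq_self.2 fun x hx => by_contra fun h => hx (h0 x h)]

/-- **Poincaré inequality** in `H¹₀` of a bounded open set. -/
theorem exists_poincare (hΩ : IsOpen Ω) (hΩb : Bornology.IsBounded Ω) :
    ∃ C : ℝ, 0 ≤ C ∧ ∀ u G, HasH10Grad Ω u G →
      ∫ x in Ω, u x ^ 2 ≤ C * ∫ x in Ω, ‖G x‖ ^ 2 := by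
  let C : ℝ≥0 := eLpNormLESNormFDerivOfLeConst ℝ (volume : Measure E3) Ω 2 2
  have htest : ∀ φ, IsTest Ω φ → eLpNorm φ 2 (volume.restrict Ω) ≤
      C * eLpNorm (gradient φ) 2 (volume.restrict Ω) := by
    intro φ hφ
    rw [eLpNorm_restrict_eq_of_zero_off hΩ.measurableSet fun x hx => hφ.eq_zero hx,
      eLpNorm_restrict_eq_of_zero_off hΩ.measurableSet fun x hx => hφ.gradient_eq_zero hx,
      eLpNorm_congr_norm_ae (g := fderiv ℝ φ) (Eventually.of_forall fun x => norm_gradient φ x)]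
    -- Gagliardo–Nirenberg–Sobolev inequality on a bounded set with both exponents equal to 2,
    -- allowed because 2 < 3.
    exact eLpNorm_le_eLpNorm_fderiv_of_le volume hφ.contDiff_one
      (fun x hx => by_contra fun h => hx (hφ.eq_zero h)) (by norm_num)
      (by simp; norm_num) (by simp) hΩb
  refine ⟨(C : ℝ) ^ 2, by positivity, fun u G h => ?_⟩
  obtain ⟨φ, hφ, l1, l2, -⟩ := h.exists_seq
  have key : eLpNorm u 2 (volume.restrict Ω) ≤ C * eLpNorm G 2 (volume.restrict Ω) := by
    have hlim : Tendsto (fun n => eLpNorm (fun x => u x - φ n x) 2 (volume.restrict Ω) +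
        C * (eLpNorm (fun x => G x - gradient (φ n) x) 2 (volume.restrict Ω) +
          eLpNorm G 2 (volume.restrict Ω))) atTop
        (𝓝 (0 + C * (0 + eLpNorm G 2 (volume.restrict Ω)))) :=
      l1.add (ENNReal.Tendsto.const_mul (l2.add tendsto_const_nhds) (Or.inr ENNReal.coe_ne_top))
    rw [zero_add, zero_add] at hlim
    refine ge_of_tendsto' hlim fun n => ?_
    have e1 : eLpNorm u 2 (volume.restrict Ω) ≤
        eLpNorm (fun x => u x - φ n x) 2 (volume.restrict Ω) +
          eLpNorm (φ n) 2 (volume.restrict Ω) := by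
      refine le_trans (eLpNorm_congr_ae (Eventually.of_forall fun x => ?_)).le
        (eLpNorm_add_le (h.memLp.sub ((hφ n).memLp 2 _)).1 ((hφ n).memLp 2 _).1 (by norm_num))
      simp
    have e2 : eLpNorm (gradient (φ n)) 2 (volume.restrict Ω) ≤
        eLpNorm (fun x => G x - gradient (φ n) x) 2 (volume.restrict Ω) +
          eLpNorm G 2 (volume.restrict Ω) := by
      rw [add_comm]
      refine le_trans (eLpNorm_congr_ae (Eventually.of_forall fun x => ?_)).le
        (eLpNorm_sub_le h.memLp_grad.1 (h.memLp_grad.sub ((hφ n).memLp_gradient 2 _)).1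
          (by norm_num))
      simp
    exact e1.trans (add_le_add le_rfl ((htest _ (hφ n)).trans (mul_le_mul_right e2 _)))
  have k2 := ENNReal.toReal_mono (ENNReal.mul_ne_top ENNReal.coe_ne_top h.memLp_grad.2.ne) key
  rw [ENNReal.toReal_mul, ENNReal.coe_toReal] at k2
  have e := integral_norm_sq_eq h.memLp
  simp only [Real.norm_eq_abs, sq_abs] at e
  rw [e, integral_norm_sq_eq h.memLp_grad, ← mul_pow]
  exact pow_le_pow_left₀ ENNReal.toReal_nonneg k2 2

end Poincare

/-! ### An integrated chain-rule inequality by averaging over time shifts -/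

theorem setIntegral_prod_univ_eq_intervalIntegral {Y : Type*} [MeasurableSpace Y]
    {μ : Measure Y} [SFinite μ] {f : ℝ × Y → ℝ} {a T : ℝ}
    (hf : Integrable f (volume.prod μ)) (haT : a ≤ T) :
    ∫ p, (Ioc a T ×ˢ univ).indicator f p ∂(volume.prod μ) = ∫ t in a..T, ∫ x, f (t, x) ∂μ := by
  rw [integral_indicator (measurableSet_Ioc.prod MeasurableSet.univ),
    setIntegral_prod _ hf.integrableOn, intervalIntegral.integral_of_le haT]
  simp

section EnergyInequality

variable {Y Z : Type*} [NormedAddCommGroup Y] [NormedSpace ℝ Y] [FiniteDimensional ℝ Y]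
  [MeasurableSpace Y] [BorelSpace Y] {μ : Measure Y} [μ.IsAddHaarMeasure]
  [NormedAddCommGroup Z] [InnerProductSpace ℝ Z]
  {P R : ℝ × Y → Z} {y : ℝ → ℝ} {T a h : ℝ}

/-- Take s = t - h in the increment bound, substitute r ↦ t - r, integrate over t in (a, T] and
exchange integrals. The inner integral becomes the correlation of P, shifted by r in time, with R
cut off to (a, T]. The condition h < a keeps t - h positive. -/
theorem integral_shift_le_correlation (hP : MemLp P 2 (volume.prod μ))
    (hR : MemLp R 2 (volume.prod μ)) (h0 : 0 < h) (hha : h < a) (haT : a < T)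
    (hy : ContinuousOn y (Icc 0 T))
    (hineq : ∀ᵐ t ∂(volume.restrict (Ioo 0 T)), ∀ s ∈ Icc 0 t,
      y t - y s ≤ ∫ r in s..t, ∫ x, inner ℝ (P (r, x)) (R (t, x)) ∂μ) :
    ∫ t in a..T, (y t - y (t - h)) ≤ ∫ r in (0 : ℝ)..h,
      ∫ p, inner ℝ (P (p - (r, 0))) ((Ioc a T ×ˢ univ).indicator R p) ∂(volume.prod μ) := by
  have : ProperSpace Y := FiniteDimensional.proper ℝ Y
  set Ra : ℝ × Y → Z := (Ioc a T ×ˢ univ).indicator R with hRa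
  have hRa2 : MemLp Ra 2 (volume.prod μ) :=
    hR.indicator (measurableSet_Ioc.prod MeasurableSet.univ)
  let ν : Measure ℝ := volume.restrict (Ioc 0 h)
  have hθ : Measurable fun r : ℝ => ((r, 0) : ℝ × Y) := by fun_prop
  have hK := integrable_inner_translate_prod (ν := ν) hθ hP hRa2
  have hK' : Integrable (fun q : (ℝ × ℝ) × Y =>
      inner ℝ (P (q.1.2 - q.1.1, q.2)) (Ra (q.1.2, q.2))) ((ν.prod volume).prod μ) := by
    have hmp : MeasurePreserving (MeasurableEquiv.prodAssoc : (ℝ × ℝ) × Y ≃ᵐ ℝ × ℝ × Y)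
        ((ν.prod volume).prod μ) (ν.prod (volume.prod μ)) := measurePreserving_prodAssoc _ _ _
    have := hmp.integrable_comp_of_integrable hK
    refine this.congr (Eventually.of_forall fun q => ?_)
    simp [MeasurableEquiv.prodAssoc]
  let g : ℝ → ℝ → ℝ := fun r t => ∫ x, inner ℝ (P (t - r, x)) (Ra (t, x)) ∂μ
  have hg : Integrable (Function.uncurry g) (ν.prod volume) := hK'.integral_prod_left
  have e1 : ∫ r in (0 : ℝ)..h, ∫ p, inner ℝ (P (p - (r, 0))) (Ra p) ∂(volume.prod μ) =
      ∫ t, ∫ r, g r t ∂ν := by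
    rw [intervalIntegral.integral_of_le h0.le, ← integral_integral_swap hg]
    refine integral_congr_ae ?_
    filter_upwards [hK.prod_right_ae] with r hr
    rw [integral_prod _ hr]
    simp [g]
  have hgt : Integrable (fun t => ∫ r, g r t ∂ν) := hg.integral_prod_right
  have e2 : ∫ t, ∫ r, g r t ∂ν = ∫ t in Ioc a T, ∫ r, g r t ∂ν := by
    refine (setIntegral_eq_integral_of_forall_compl_eq_zero fun t ht => ?_).symm
    have : ∀ r, g r t = 0 := fun r => by
      simp only [g, Ra]
      rw [integral_eq_zero_of_ae]
      exact Eventually.of_forall fun x => by simp [ht]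
    simp [this]
  rw [e1, e2, intervalIntegral.integral_of_le haT.le]
  have hyc : ContinuousOn (fun t => y t - y (t - h)) (Icc a T) := by
    refine (hy.mono (Icc_subset_Icc (by linarith) le_rfl)).sub (hy.comp (by fun_prop) ?_)
    intro t ht
    exact ⟨by linarith [ht.1], by linarith [ht.2]⟩
  refine setIntegral_mono_on_ae (hyc.integrableOn_Icc.mono_set Ioc_subset_Icc_self)
    hgt.integrableOn measurableSet_Ioc ?_
  have hineq' : ∀ᵐ t : ℝ, t ∈ Ioo 0 T → ∀ s ∈ Icc 0 t,
      y t - y s ≤ ∫ r in s..t, ∫ x, inner ℝ (P (r, x)) (R (t, x)) ∂μ :=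
    (ae_restrict_iff' measurableSet_Ioo).1 hineq
  filter_upwards [hineq', Measure.ae_ne volume T] with t ht htT htaT
  refine (ht ⟨by linarith [htaT.1], lt_of_le_of_ne htaT.2 htT⟩ (t - h)
    ⟨by linarith [htaT.1], by linarith⟩).trans_eq ?_
  have hsub := intervalIntegral.integral_comp_sub_left
    (fun r => ∫ x, inner ℝ (P (r, x)) (R (t, x)) ∂μ) t (a := 0) (b := h)
  rw [sub_zero] at hsub
  rw [← hsub, intervalIntegral.integral_of_le h0.le]
  simp only [g, Ra, mem_prod, htaT, mem_univ, and_self, indicator_of_mem, ν]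

/-- The averaged form of the energy inequality, with positive initial time. -/
theorem sub_le_integral_of_shift_le (hP : MemLp P 2 (volume.prod μ))
    (hR : MemLp R 2 (volume.prod μ)) (ha : 0 < a) (haT : a < T) (hy : ContinuousOn y (Icc 0 T))
    (hineq : ∀ᵐ t ∂(volume.restrict (Ioo 0 T)), ∀ s ∈ Icc 0 t,
      y t - y s ≤ ∫ r in s..t, ∫ x, inner ℝ (P (r, x)) (R (t, x)) ∂μ) :
    y T - y a ≤ ∫ t in a..T, ∫ x, inner ℝ (P (t, x)) (R (t, x)) ∂μ := by
  have : ProperSpace Y := FiniteDimensional.proper ℝ Y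
  set Ra : ℝ × Y → Z := (Ioc a T ×ˢ univ).indicator R with hRa
  have hRa2 : MemLp Ra 2 (volume.prod μ) :=
    hR.indicator (measurableSet_Ioc.prod MeasurableSet.univ)
  let c : ℝ → ℝ := fun r => ∫ p, inner ℝ (P (p - (r, 0))) (Ra p) ∂(volume.prod μ)
  have hc : Continuous c := (continuous_integral_inner_translate hP hRa2).comp (by fun_prop)
  have hc0 : c 0 = ∫ t in a..T, ∫ x, inner ℝ (P (t, x)) (R (t, x)) ∂μ := by
    rw [← setIntegral_prod_univ_eq_intervalIntegral (MemLp.integrable_inner_two hP hR) haT.le]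
    refine integral_congr_ae (Eventually.of_forall fun p => ?_)
    by_cases hp : p ∈ Ioc a T ×ˢ (univ : Set Y)
    · simp only [Ra, indicator_of_mem hp, ← Prod.zero_eq_mk, sub_zero]
    · simp only [Ra, indicator_of_notMem hp, inner_zero_right]
  rw [← hc0]
  refine le_of_forall_pos_le_add fun ε hε => ?_
  -- The correlation c on [0, h] and y on [T - h, T] and [a - h, a] each deviate from their limits
  -- by at most ε/3; the averaged inequality is then divided by h.
  obtain ⟨δ₁, hδ₁, h₁⟩ := Metric.continuousAt_iff.1 (hc.continuousAt (x := 0)) (ε / 3) (by positivity)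
  obtain ⟨δ₂, hδ₂, h₂⟩ := Metric.continuousWithinAt_iff.1 (hy T ⟨by linarith, le_rfl⟩) (ε / 3)
    (by positivity)
  obtain ⟨δ₃, hδ₃, h₃⟩ := Metric.continuousWithinAt_iff.1 (hy a ⟨ha.le, haT.le⟩) (ε / 3)
    (by positivity)
  obtain ⟨h, h0, hh⟩ : ∃ h, 0 < h ∧ h < min (min δ₁ δ₂) (min δ₃ (min a (T - a))) :=
    exists_between (lt_min (lt_min hδ₁ hδ₂) (lt_min hδ₃ (lt_min ha (by linarith))))
  simp only [lt_min_iff] at hh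
  obtain ⟨⟨hh1, hh2⟩, hh3, hha, hhT⟩ := hh
  have key := integral_shift_le_correlation hP hR h0 hha haT hy hineq
  have hyi : ∀ b d, 0 ≤ b → b ≤ T → 0 ≤ d → d ≤ T → IntervalIntegrable y volume b d :=
    fun b d hb hb' hd hd' => (hy.mono (by
      intro z hz
      exact ⟨(le_min hb hd).trans hz.1, hz.2.trans (max_le hb' hd')⟩)).intervalIntegrable
  -- The integral of a difference of shifts telescopes to two boundary layers of width h.
  have e1 : ∫ t in a..T, (y t - y (t - h)) = (∫ t in (T - h)..T, y t) - ∫ t in (a - h)..a, y t := by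
    rw [intervalIntegral.integral_sub (hyi _ _ ha.le haT.le (by linarith) le_rfl)]
    · rw [intervalIntegral.integral_comp_sub_right (fun t => y t) h]
      have k1 := intervalIntegral.integral_add_adjacent_intervals
        (hyi (a - h) a (by linarith) (by linarith) ha.le haT.le)
        (hyi a T ha.le haT.le (by linarith) le_rfl)
      have k2 := intervalIntegral.integral_add_adjacent_intervals
        (hyi (a - h) (T - h) (by linarith) (by linarith) (by linarith) (by linarith))
        (hyi (T - h) T (by linarith) (by linarith) (by linarith) le_rfl)
      linarith
    · have := (hyi (a - h) (T - h) (by linarith) (by linarith) (by linarith)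
        (by linarith)).comp_sub_right h
      simpa using this
  have b1 : h * (y T - ε / 3) ≤ ∫ t in (T - h)..T, y t := by
    have := intervalIntegral.integral_mono_on (a := T - h) (b := T) (by linarith)
      (intervalIntegrable_const (c := y T - ε / 3))
      (hyi (T - h) T (by linarith) (by linarith) (by linarith) le_rfl) (fun t ht => by
        have := h₂ (x := t) ⟨by linarith [ht.1], ht.2⟩ (by
          rw [Real.dist_eq, abs_lt]; constructor <;> linarith [ht.1, ht.2])
        rw [Real.dist_eq, abs_lt] at this
        linarith [this.1])
    rw [intervalIntegral.integral_const, smul_eq_mul] at this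
    linarith
  have b2 : ∫ t in (a - h)..a, y t ≤ h * (y a + ε / 3) := by
    have := intervalIntegral.integral_mono_on (a := a - h) (b := a) (by linarith)
      (hyi (a - h) a (by linarith) (by linarith) ha.le haT.le)
      (intervalIntegrable_const (c := y a + ε / 3)) (fun t ht => by
        have := h₃ (x := t) ⟨by linarith [ht.1], by linarith [ht.2]⟩ (by
          rw [Real.dist_eq, abs_lt]; constructor <;> linarith [ht.1, ht.2])
        rw [Real.dist_eq, abs_lt] at this
        linarith [this.2])
    rw [intervalIntegral.integral_const, smul_eq_mul] at this
    linarith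
  have b3 : ∫ r in (0 : ℝ)..h, c r ≤ h * (c 0 + ε / 3) := by
    have := intervalIntegral.integral_mono_on (a := 0) (b := h) h0.le
      (hc.intervalIntegrable (μ := volume) _ _)
      (intervalIntegrable_const (c := c 0 + ε / 3)) (fun t ht => by
        have := h₁ (x := t) (by
          rw [Real.dist_eq, abs_lt]; constructor <;> linarith [ht.1, ht.2])
        rw [Real.dist_eq, abs_lt] at this
        linarith [this.2])
    rw [intervalIntegral.integral_const, smul_eq_mul] at this
    linarith
  rw [e1] at key
  have : h * (y T - y a) ≤ h * (c 0 + ε) := by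
    have : ∫ r in (0 : ℝ)..h, c r = ∫ r in (0 : ℝ)..h,
      ∫ p, inner ℝ (P (p - (r, 0))) ((Ioc a T ×ˢ univ).indicator R p) ∂(volume.prod μ) := rfl
    linarith
  exact le_of_mul_le_mul_left this h0

/-- An integrated chain-rule inequality: if the increments of `y` over `[s, t]` are bounded by the
integral over `[s, t]` of the pairing of `P` with `R(t)`, then the increment of `y` over `[0, T]` is
bounded by the integral of the pairing of `P(t)` with `R(t)`. -/
theorem sub_le_integral_of_increment_le (hP : MemLp P 2 (volume.prod μ))
    (hR : MemLp R 2 (volume.prod μ)) (hT : 0 < T) (hy : ContinuousOn y (Icc 0 T))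
    (hineq : ∀ᵐ t ∂(volume.restrict (Ioo 0 T)), ∀ s ∈ Icc 0 t,
      y t - y s ≤ ∫ r in s..t, ∫ x, inner ℝ (P (r, x)) (R (t, x)) ∂μ) :
    y T - y 0 ≤ ∫ t in (0 : ℝ)..T, ∫ x, inner ℝ (P (t, x)) (R (t, x)) ∂μ := by
  have : ProperSpace Y := FiniteDimensional.proper ℝ Y
  have hi : Integrable fun t => ∫ x, inner ℝ (P (t, x)) (R (t, x)) ∂μ :=
    (MemLp.integrable_inner_two hP hR).integral_prod_left
  have hev : ∀ᶠ a in 𝓝[>] (0 : ℝ), y T - y a ≤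
      (∫ t in (0 : ℝ)..T, ∫ x, inner ℝ (P (t, x)) (R (t, x)) ∂μ) -
        ∫ t in (0 : ℝ)..a, ∫ x, inner ℝ (P (t, x)) (R (t, x)) ∂μ := by
    filter_upwards [Ioo_mem_nhdsGT hT] with a ha
    rw [intervalIntegral.integral_interval_sub_left hi.intervalIntegrable hi.intervalIntegrable]
    exact sub_le_integral_of_shift_le hP hR ha.1 ha.2 hy hineq
  have t1 : Tendsto (fun a => y T - y a) (𝓝[>] 0) (𝓝 (y T - y 0)) := by
    have := (hy 0 ⟨le_rfl, hT.le⟩).mono_left (nhdsWithin_le_of_mem (Icc_mem_nhdsGT_of_mem ⟨le_rfl, hT⟩))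
    exact tendsto_const_nhds.sub this
  have t2 : Tendsto (fun a => (∫ t in (0 : ℝ)..T, ∫ x, inner ℝ (P (t, x)) (R (t, x)) ∂μ) -
        ∫ t in (0 : ℝ)..a, ∫ x, inner ℝ (P (t, x)) (R (t, x)) ∂μ) (𝓝[>] 0)
      (𝓝 ((∫ t in (0 : ℝ)..T, ∫ x, inner ℝ (P (t, x)) (R (t, x)) ∂μ) - 0)) := by
    have := (intervalIntegral.continuous_primitive (fun a b => hi.intervalIntegrable) 0).tendsto 0
    rw [intervalIntegral.integral_same] at this
    exact tendsto_const_nhds.sub (this.mono_left nhdsWithin_le_nhds)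
  rw [sub_zero] at t2
  exact le_of_tendsto_of_tendsto t1 t2 hev

end EnergyInequality

/-! ### Time slices of space-time functions -/

section Slices

variable {X Y Z : Type*} [MeasurableSpace X] [MeasurableSpace Y] {μ : Measure X} {ν : Measure Y}
  [SFinite ν] [NormedAddCommGroup Z]

theorem memLp_two_slice [SFinite μ] {f : X → Y → Z} (hf : MemLp (Function.uncurry f) 2 (μ.prod ν)) :
    ∀ᵐ x ∂μ, MemLp (f x) 2 ν := by
  filter_upwards [hf.1.prodMk_left, hf.integrable_norm_pow (by norm_num) |>.prod_right_ae]
    with x h1 h2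
  rw [← memLp_two_iff_integrable_sq_norm h1] at h2
  exact h2

theorem eLpNorm_two_comp_snd_le {f : Y → Z} (hf : AEStronglyMeasurable f ν) :
    eLpNorm (fun p : X × Y => f p.2) 2 (μ.prod ν) = μ univ ^ (1 / 2 : ℝ) * eLpNorm f 2 ν := by
  have h := eLpNorm_map_measure (μ := μ.prod ν) (f := Prod.snd) (g := f) (p := 2) (by
    rw [Measure.map_snd_prod]
    exact hf.smul_measure _) (by fun_prop)
  rw [Measure.map_snd_prod] at h
  rw [show (fun p : X × Y => f p.2) = f ∘ Prod.snd from rfl, ← h,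
    eLpNorm_smul_measure_of_ne_top (by norm_num)]
  simp

end Slices

/-! ### Energy inequality for positive parts -/

section PosPartEnergy

variable {Ω : Set E3} {T : ℝ} {v f : ℝ → E3 → ℝ} {F C : ℝ → E3 → E3}

/-- Convexity of s ↦ ½ max(s, 0)², whose derivative is max(s, 0). It bounds energy increments by the
equation tested with the truncation frozen at the final time. -/
theorem posPart_sq_sub_le (a b : ℝ) :
    1 / 2 * max a 0 ^ 2 - 1 / 2 * max b 0 ^ 2 ≤ max a 0 * (a - b) := by
  rcases le_total a 0 with ha | ha <;> rcases le_total b 0 with hb | hb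
  · simp [max_eq_right ha, max_eq_right hb]
  · simp only [max_eq_right ha, max_eq_left hb]; nlinarith
  · simp only [max_eq_left ha, max_eq_right hb]; nlinarith
  · simp only [max_eq_left ha, max_eq_left hb]; nlinarith [sq_nonneg (a - b)]

theorem memLp_posPart {X : Type*} [MeasurableSpace X] {μ : Measure X} {u : X → ℝ}
    (hu : MemLp u 2 μ) : MemLp (fun x => max (u x) 0) 2 μ :=
  hu.of_le ((continuous_id.max continuous_const).comp_aestronglyMeasurable hu.1)
    (Eventually.of_forall fun x => by
      rw [Real.norm_eq_abs, Real.norm_eq_abs]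
      exact abs_le.2 ⟨(neg_nonpos.2 (abs_nonneg (u x))).trans (le_max_right _ _),
        max_le (le_abs_self _) (abs_nonneg _)⟩)

theorem tendsto_integral_posPart_sq {ι X : Type*} [MeasurableSpace X] {μ : Measure X}
    {l : Filter ι} {u : ι → X → ℝ} {w : X → ℝ} (hu : ∀ᶠ i in l, MemLp (u i) 2 μ)
    (hw : MemLp w 2 μ) (h : Tendsto (fun i => eLpNorm (fun x => u i x - w x) 2 μ) l (𝓝 0)) :
    Tendsto (fun i => ∫ x, max (u i x) 0 ^ 2 ∂μ) l (𝓝 (∫ x, max (w x) 0 ^ 2 ∂μ)) := by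
  have hsq : ∀ {z : X → ℝ}, MemLp z 2 μ →
      ∫ x, max (z x) 0 ^ 2 ∂μ = (eLpNorm (fun x => max (z x) 0) 2 μ).toReal ^ 2 := fun hz => by
    rw [← integral_norm_sq_eq (memLp_posPart hz)]
    simp
  rw [hsq hw]
  have h1 : Tendsto (fun i => (eLpNorm (fun x => max (u i x) 0) 2 μ).toReal) l
      (𝓝 (eLpNorm (fun x => max (w x) 0) 2 μ).toReal) := by
    rw [tendsto_iff_dist_tendsto_zero]
    have h0 := (ENNReal.tendsto_toReal ENNReal.zero_ne_top).comp h
    rw [ENNReal.toReal_zero] at h0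
    refine squeeze_zero' (Eventually.of_forall fun _ => dist_nonneg) ?_ h0
    filter_upwards [hu] with i hi
    rw [← Lp.norm_toLp _ (memLp_posPart hi), ← Lp.norm_toLp _ (memLp_posPart hw)]
    refine (dist_norm_norm_le _ _).trans ?_
    rw [← MemLp.toLp_sub, Lp.norm_toLp]
    refine ENNReal.toReal_mono (hi.sub hw).2.ne (eLpNorm_mono fun x => ?_)
    exact abs_max_sub_max_le_abs _ _ _
  refine (h1.pow 2).congr' ?_
  filter_upwards [hu] with i hi using (hsq hi).symm

/-- Writes the right-hand side of the weak form as inner products in L² of space-time, where it is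
visibly continuous in the test pair (z, H). -/
theorem integral_integral_pairing_eq {X : Type*} [MeasurableSpace X] {μ : Measure X} [SFinite μ]
    {F : ℝ → X → E3} {f : ℝ → X → ℝ} {s t : ℝ} (hst : s ≤ t)
    (hF : MemLp (Function.uncurry F) 2 ((volume.restrict (Ioo s t)).prod μ))
    (hf : MemLp (Function.uncurry f) 2 ((volume.restrict (Ioo s t)).prod μ))
    {z : X → ℝ} {H : X → E3} (hz : MemLp z 2 μ) (hH : MemLp H 2 μ) :
    ∫ r in s..t, ((∫ x, inner ℝ (F r x) (H x) ∂μ) + ∫ x, f r x * z x ∂μ) =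
      (∫ p, inner ℝ (Function.uncurry F p) (H p.2) ∂((volume.restrict (Ioo s t)).prod μ)) +
        ∫ p, inner ℝ (Function.uncurry f p) (z p.2) ∂((volume.restrict (Ioo s t)).prod μ) := by
  have i1 := MemLp.integrable_inner_two hF (hH.comp_snd (volume.restrict (Ioo s t)))
  have i2 := MemLp.integrable_inner_two hf (hz.comp_snd (volume.restrict (Ioo s t)))
  rw [integral_prod _ i1, integral_prod _ i2, ← integral_add i1.integral_prod_left
    i2.integral_prod_left, intervalIntegral.integral_of_le hst, integral_Ioc_eq_integral_Ioo]
  simp only [Function.uncurry, integral_mul_eq_inner]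

theorem tendsto_eLpNorm_two_comp_snd {X Y Z : Type*} [MeasurableSpace X] [MeasurableSpace Y]
    {μ : Measure X} {ν : Measure Y} [IsFiniteMeasure μ] [SFinite ν] [NormedAddCommGroup Z]
    {g : ℕ → Y → Z} (hg : ∀ n, AEStronglyMeasurable (g n) ν)
    (hlim : Tendsto (fun n => eLpNorm (g n) 2 ν) atTop (𝓝 0)) :
    Tendsto (fun n => eLpNorm (fun p : X × Y => g n p.2) 2 (μ.prod ν)) atTop (𝓝 0) := by
  simp only [fun n => eLpNorm_two_comp_snd_le (μ := μ) (hg n)]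
  have hne : μ univ ^ (1 / 2 : ℝ) ≠ ⊤ := ENNReal.rpow_ne_top_of_nonneg (by norm_num)
    (measure_ne_top _ _)
  simpa using ENNReal.Tendsto.const_mul hlim (Or.inr hne)

/-- Both sides of the weak equation are continuous in the time-independent test pair for the L²
norms, so it extends from test functions to H¹₀ by density. -/
theorem integral_pairing_eq_of_hasH10Grad [IsFiniteMeasure (volume.restrict Ω)]
    (hv2 : ∀ t ∈ Icc 0 T, MemLp (v t) 2 (volume.restrict Ω))
    (hF : MemLp (Function.uncurry F) 2 ((volume.restrict (Ioo 0 T)).prod (volume.restrict Ω)))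
    (hf : MemLp (Function.uncurry f) 2 ((volume.restrict (Ioo 0 T)).prod (volume.restrict Ω)))
    (heq : ∀ φ, IsTest Ω φ → ∀ s t, 0 ≤ s → s ≤ t → t ≤ T →
      (∫ x in Ω, v t x * φ x) - ∫ x in Ω, v s x * φ x = ∫ r in s..t,
        ((∫ x in Ω, inner ℝ (F r x) (gradient φ x)) + ∫ x in Ω, f r x * φ x))
    {w : E3 → ℝ} {G : E3 → E3} (h : HasH10Grad Ω w G) {s t : ℝ} (hs : 0 ≤ s) (hst : s ≤ t)
    (ht : t ≤ T) :
    (∫ x in Ω, v t x * w x) - ∫ x in Ω, v s x * w x = ∫ r in s..t,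
        ((∫ x in Ω, inner ℝ (F r x) (G x)) + ∫ x in Ω, f r x * w x) := by
  obtain ⟨φ, hφ, l1, l2, -⟩ := h.exists_seq
  have hle : (volume.restrict (Ioo s t)).prod (volume.restrict Ω) ≤
      (volume.restrict (Ioo 0 T)).prod (volume.restrict Ω) := by
    rw [Measure.prod_restrict, Measure.prod_restrict]
    exact Measure.restrict_mono (prod_mono_left (Ioo_subset_Ioo hs ht)) le_rfl
  have hFν := hF.mono_measure hle
  have hfν := hf.mono_measure hle
  have hLHS : ∀ τ ∈ Icc 0 T, Tendsto (fun n => ∫ x in Ω, v τ x * φ n x) atTop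
      (𝓝 (∫ x in Ω, v τ x * w x)) := fun τ hτ => by
    simp only [integral_mul_eq_inner]
    exact tendsto_integral_inner (fun n => (hφ n).memLp 2 _) h.memLp (hv2 τ hτ) l1
  have l1' := tendsto_eLpNorm_two_comp_snd (μ := volume.restrict (Ioo s t))
    (fun n => (h.memLp.sub ((hφ n).memLp 2 _)).1) l1
  have l2' := tendsto_eLpNorm_two_comp_snd (μ := volume.restrict (Ioo s t))
    (fun n => (h.memLp_grad.sub ((hφ n).memLp_gradient 2 _)).1) l2
  have R1 := tendsto_integral_inner (fun n => ((hφ n).memLp_gradient 2 _).comp_snd _)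
    (h.memLp_grad.comp_snd _) hFν l2'
  have R2 := tendsto_integral_inner (fun n => ((hφ n).memLp 2 _).comp_snd _)
    (h.memLp.comp_snd _) hfν l1'
  rw [integral_integral_pairing_eq hst hFν hfν h.memLp h.memLp_grad]
  refine tendsto_nhds_unique ((hLHS t ⟨hs.trans hst, ht⟩).sub (hLHS s ⟨hs, hst.trans ht⟩)) ?_
  refine (R1.add R2).congr fun n => ?_
  rw [heq (φ n) (hφ n) s t hs hst ht,
    integral_integral_pairing_eq hst hFν hfν ((hφ n).memLp 2 _) ((hφ n).memLp_gradient 2 _)]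

/-- The energy inequality for the positive part of a weak solution of `∂ₜ v = -div F + f`. -/
theorem posPart_energy_le [IsFiniteMeasure (volume.restrict Ω)] (hΩ : IsOpen Ω) (hT : 0 < T)
    (hv2 : ∀ t ∈ Icc 0 T, MemLp (v t) 2 (volume.restrict Ω))
    (hvc : ∀ t₀ ∈ Icc 0 T, Tendsto (fun t => eLpNorm (fun x => v t x - v t₀ x) 2
      (volume.restrict Ω)) (𝓝[Icc 0 T] t₀) (𝓝 0))
    (hvm : MemLp (Function.uncurry v) 2 ((volume.restrict (Ioo 0 T)).prod (volume.restrict Ω)))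
    (hF : MemLp (Function.uncurry F) 2 ((volume.restrict (Ioo 0 T)).prod (volume.restrict Ω)))
    (hf : MemLp (Function.uncurry f) 2 ((volume.restrict (Ioo 0 T)).prod (volume.restrict Ω)))
    (hC : MemLp (Function.uncurry C) 2 ((volume.restrict (Ioo 0 T)).prod (volume.restrict Ω)))
    (hB : ∀ᵐ t ∂(volume.restrict (Ioo 0 T)), HasH10Grad Ω (fun x => max (v t x) 0) (C t))
    (heq : ∀ φ, IsTest Ω φ → ∀ s t, 0 ≤ s → s ≤ t → t ≤ T →
      (∫ x in Ω, v t x * φ x) - ∫ x in Ω, v s x * φ x = ∫ r in s..t,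
        ((∫ x in Ω, inner ℝ (F r x) (gradient φ x)) + ∫ x in Ω, f r x * φ x)) :
    ContinuousOn (fun t => 1 / 2 * ∫ x in Ω, max (v t x) 0 ^ 2) (Icc 0 T) ∧
    IntervalIntegrable (fun t => (∫ x in Ω, inner ℝ (F t x) (C t x)) +
      ∫ x in Ω, f t x * max (v t x) 0) volume 0 T ∧
    1 / 2 * (∫ x in Ω, max (v T x) 0 ^ 2) - 1 / 2 * ∫ x in Ω, max (v 0 x) 0 ^ 2 ≤
      ∫ t in (0 : ℝ)..T, ((∫ x in Ω, inner ℝ (F t x) (C t x)) +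
        ∫ x in Ω, f t x * max (v t x) 0) := by
  let S : Set (ℝ × E3) := Ioo 0 T ×ˢ Ω
  have hS : MeasurableSet S := measurableSet_Ioo.prod hΩ.measurableSet
  -- Bundling (f, F) and (v⁺, ∇v⁺) into single Hilbert-space valued functions, then extending by
  -- zero off (0, T) × Ω, fits the abstract inequality on the whole space-time.
  let P₀ : ℝ × E3 → WithLp 2 (ℝ × E3) := fun p => WithLp.toLp 2 (f p.1 p.2, F p.1 p.2)
  let R₀ : ℝ × E3 → WithLp 2 (ℝ × E3) := fun p => WithLp.toLp 2 (max (v p.1 p.2) 0, C p.1 p.2)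
  have hP₀ : MemLp P₀ 2 ((volume.restrict (Ioo 0 T)).prod (volume.restrict Ω)) :=
    MemLp.of_fst_of_snd_prodLp ⟨hf, hF⟩
  have hR₀ : MemLp R₀ 2 ((volume.restrict (Ioo 0 T)).prod (volume.restrict Ω)) :=
    MemLp.of_fst_of_snd_prodLp ⟨memLp_posPart hvm, hC⟩
  have hP : MemLp (S.indicator P₀) 2 ((volume : Measure ℝ).prod (volume : Measure E3)) := by
    rw [memLp_indicator_iff_restrict hS, ← Measure.prod_restrict]; exact hP₀
  have hR : MemLp (S.indicator R₀) 2 ((volume : Measure ℝ).prod (volume : Measure E3)) := by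
    rw [memLp_indicator_iff_restrict hS, ← Measure.prod_restrict]; exact hR₀
  have hcont : ContinuousOn (fun t => 1 / 2 * ∫ x in Ω, max (v t x) 0 ^ 2) (Icc 0 T) :=
    fun t₀ ht₀ => (tendsto_integral_posPart_sq (eventually_mem_nhdsWithin.mono fun t ht => hv2 t ht)
      (hv2 t₀ ht₀) (hvc t₀ ht₀)).const_mul _
  have hpair : ∀ r ∈ Ioo 0 T, ∀ t ∈ Ioo 0 T, MemLp (F r) 2 (volume.restrict Ω) →
      MemLp (f r) 2 (volume.restrict Ω) → MemLp (C t) 2 (volume.restrict Ω) →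
      ∫ x, inner ℝ (S.indicator P₀ (r, x)) (S.indicator R₀ (t, x)) =
        (∫ x in Ω, inner ℝ (F r x) (C t x)) + ∫ x in Ω, f r x * max (v t x) 0 := by
    intro r hr t ht h1 h2 h3
    have e : ∫ x, inner ℝ (S.indicator P₀ (r, x)) (S.indicator R₀ (t, x)) =
        ∫ x in Ω, inner ℝ (P₀ (r, x)) (R₀ (t, x)) := by
      rw [← integral_indicator hΩ.measurableSet]
      congr 1 with x
      by_cases hx : x ∈ Ω
      · simp [S, hx, hr.1, hr.2, ht.1, ht.2]
      · simp [S, hx]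
    rw [e, integral_mul_eq_inner, ← integral_add (MemLp.integrable_inner_two h1 h3)
      (MemLp.integrable_inner_two h2 (memLp_posPart (hv2 t ⟨ht.1.le, ht.2.le⟩)))]
    congr 1 with x
    simp only [P₀, R₀, WithLp.prod_inner_apply]
    exact add_comm _ _
  have hdiag : ∀ᵐ t ∂(volume.restrict (Ioo 0 T)),
      ∫ x, inner ℝ (S.indicator P₀ (t, x)) (S.indicator R₀ (t, x)) =
        (∫ x in Ω, inner ℝ (F t x) (C t x)) + ∫ x in Ω, f t x * max (v t x) 0 := by
    filter_upwards [memLp_two_slice hF, memLp_two_slice hf, memLp_two_slice hC,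
      ae_restrict_mem measurableSet_Ioo] with t h1 h2 h3 ht using hpair t ht t ht h1 h2 h3
  have hioo : ∀ᵐ t ∂(volume.restrict (Ioc 0 T)), 
      ∫ x, inner ℝ (S.indicator P₀ (t, x)) (S.indicator R₀ (t, x)) =
        (∫ x in Ω, inner ℝ (F t x) (C t x)) + ∫ x in Ω, f t x * max (v t x) 0 := by
    rwa [restrict_Ioo_eq_restrict_Ioc] at hdiag
  have hint : Integrable fun t => ∫ x, inner ℝ (S.indicator P₀ (t, x)) (S.indicator R₀ (t, x)) :=
    (MemLp.integrable_inner_two hP hR).integral_prod_left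
  refine ⟨hcont, ?_, ?_⟩
  · rw [intervalIntegrable_iff_integrableOn_Ioc_of_le hT.le]
    exact (hint.integrableOn (s := Ioc 0 T)).congr hioo
  -- For almost every t the truncation at time t is in H¹₀ and may be used as a fixed test function
  -- on [s, t]; convexity then gives the increment bound.
  have hinc : ∀ᵐ t ∂(volume.restrict (Ioo 0 T)), ∀ s ∈ Icc 0 t,
      1 / 2 * (∫ x in Ω, max (v t x) 0 ^ 2) - 1 / 2 * ∫ x in Ω, max (v s x) 0 ^ 2 ≤
        ∫ r in s..t, ∫ x, inner ℝ (S.indicator P₀ (r, x)) (S.indicator R₀ (t, x)) := by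
    filter_upwards [hB, memLp_two_slice hC, ae_restrict_mem measurableSet_Ioo] with t hBt hCt ht
    intro s hs
    have htT : t ∈ Icc 0 T := ⟨ht.1.le, ht.2.le⟩
    have hsT : s ∈ Icc 0 T := ⟨hs.1, hs.2.trans ht.2.le⟩
    have e1 : ∫ r in s..t, ∫ x, inner ℝ (S.indicator P₀ (r, x)) (S.indicator R₀ (t, x)) =
        ∫ r in s..t, ((∫ x in Ω, inner ℝ (F r x) (C t x)) +
          ∫ x in Ω, f r x * max (v t x) 0) := by
      rw [intervalIntegral.integral_of_le hs.2, intervalIntegral.integral_of_le hs.2,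
        integral_Ioc_eq_integral_Ioo, integral_Ioc_eq_integral_Ioo]
      refine integral_congr_ae ?_
      have hsub : Ioo s t ⊆ Ioo 0 T := Ioo_subset_Ioo hs.1 ht.2.le
      filter_upwards [ae_restrict_of_ae_restrict_of_subset hsub (memLp_two_slice hF),
        ae_restrict_of_ae_restrict_of_subset hsub (memLp_two_slice hf),
        ae_restrict_mem measurableSet_Ioo] with r h1 h2 hr using hpair r (hsub hr) t ht h1 h2 hCt
    rw [e1, ← integral_pairing_eq_of_hasH10Grad hv2 hF hf heq hBt hs.1 hs.2 ht.2.le]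
    have i1 := (memLp_posPart (hv2 t htT)).integrable_sq
    have i2 := (memLp_posPart (hv2 s hsT)).integrable_sq
    have j1 := MemLp.integrable_mul_two (hv2 t htT) (memLp_posPart (hv2 t htT))
    have j2 := MemLp.integrable_mul_two (hv2 s hsT) (memLp_posPart (hv2 t htT))
    rw [← integral_const_mul, ← integral_const_mul, ← integral_sub (i1.const_mul _)
      (i2.const_mul _), ← integral_sub j1 j2]
    refine integral_mono ((i1.const_mul _).sub (i2.const_mul _)) (j1.sub j2) fun x => ?_
    have := posPart_sq_sub_le (v t x) (v s x)
    simp only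
    linarith
  have key := sub_le_integral_of_increment_le hP hR hT hcont hinc
  refine key.trans_eq ?_
  rw [intervalIntegral.integral_of_le hT.le, intervalIntegral.integral_of_le hT.le]
  exact integral_congr_ae hioo

end PosPartEnergy

/-! ### Poisson equation and drift-diffusion equation in testable form -/

section Truncation

variable {Ω : Set E3} {u : E3 → ℝ} {G : E3 → E3}

theorem MemH10.hasH10Grad_of_hasH1Grad (hΩ : IsOpen Ω) (h : MemH10 Ω u) (hG : HasH1Grad Ω u G) :
    HasH10Grad Ω u G :=
  (h.hasH10Grad hΩ).congr EventuallyEq.rfl ((hG.hasWeakGrad hΩ).weakGrad_ae_eq hΩ)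

/-- Testing the Poisson equation with functions in `H¹₀`. -/
theorem IsPoissonSol.test (hΩ : IsOpen Ω) {lam : ℝ} {VD ρ V Q : E3 → ℝ} {H : E3 → E3}
    (h : IsPoissonSol Ω lam VD ρ V) (hρ : MemLp ρ 2 (volume.restrict Ω)) (hQ : HasH10Grad Ω Q H) :
    lam ^ 2 * ∫ x in Ω, inner ℝ (weakGrad Ω V x) (H x) = ∫ x in Ω, ρ x * Q x := by
  have hV := (h.mem.hasH1Grad hΩ).memLp_grad
  have key := hQ.annih _ _ hρ.neg (hV.const_smul (lam ^ 2)) fun φ hφ => by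
    have e := h.eqn φ hφ
    simp only [Pi.neg_apply, Pi.smul_apply, inner_smul_left, conj_trivial, neg_mul, integral_neg,
      integral_const_mul]
    linarith
  simp only [Pi.neg_apply, Pi.smul_apply, inner_smul_left, conj_trivial, neg_mul, integral_neg,
      integral_const_mul] at key
  linarith

/-- The slicewise bound says nothing about measurability of the exceptional set in the product, so
Fubini is applied to a measurable representative. -/
theorem ae_prod_abs_le {X Y : Type*} [MeasurableSpace X] [MeasurableSpace Y] {μ : Measure X}
    {ν : Measure Y} [SFinite μ] [SFinite ν] {f : X → Y → ℝ} {K : ℝ}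
    (hf : AEStronglyMeasurable (Function.uncurry f) (μ.prod ν))
    (h : ∀ᵐ x ∂μ, ∀ᵐ y ∂ν, |f x y| ≤ K) : ∀ᵐ p ∂(μ.prod ν), |Function.uncurry f p| ≤ K := by
  have hmeas : MeasurableSet {p | |hf.mk _ p| ≤ K} :=
    measurableSet_le (hf.stronglyMeasurable_mk.measurable.abs) measurable_const
  have h' : ∀ᵐ p ∂(μ.prod ν), |hf.mk _ p| ≤ K := by
    rw [Measure.ae_prod_iff_ae_ae hmeas]
    filter_upwards [h, Measure.ae_ae_of_ae_prod hf.ae_eq_mk] with x h1 h2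
    filter_upwards [h1, h2] with y h3 h4
    rw [← h4]
    exact h3
  filter_upwards [h', hf.ae_eq_mk] with p h1 h2
  rwa [h2]

theorem memLp_comp_fst_of_continuous [IsFiniteMeasure (volume.restrict Ω)] {f : ℝ → ℝ}
    (hf : Continuous f) (T : ℝ) :
    MemLp (fun p : ℝ × E3 => f p.1) 2 ((volume.restrict (Ioo 0 T)).prod (volume.restrict Ω)) := by
  refine MemLp.comp_fst ?_ _
  obtain ⟨C, hC⟩ := (isCompact_Icc (a := (0 : ℝ)) (b := T)).exists_bound_of_continuousOn
    hf.continuousOn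
  refine MemLp.of_bound hf.aestronglyMeasurable C ?_
  filter_upwards [ae_restrict_mem measurableSet_Ioo] with t ht using hC t (Ioo_subset_Icc_self ht)

variable {lam d τ : ℝ} {g uD VD : E3 → ℝ} {GD : E3 → E3} {n w V : ℝ → E3 → ℝ}
  {Gn GV : ℝ → E3 → E3} {σ T : ℝ} {l l' : ℝ → ℝ}

theorem IsBoundedEvolution.ae_hasH1Grad
    (hn : IsBoundedEvolution Ω uD n)
    (hGn : MemLp (Function.uncurry Gn) 2 ((volume.restrict (Ioo 0 T)).prod (volume.restrict Ω)))
    (hGn' : ∀ᵐ t ∂(volume.restrict (Ioo 0 T)), HasWeakGrad Ω (n t) (Gn t)) :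
    ∀ᵐ t ∂(volume.restrict (Ioo 0 T)), HasH1Grad Ω (n t) (Gn t) := by
  filter_upwards [memLp_two_slice hGn, hGn', ae_restrict_mem measurableSet_Ioo] with t h1 h2 ht
  exact ⟨hn.memL2 t ht.1.le, h1, h2.2.2⟩

/-- The weak formulation of a drift-diffusion equation, for the function `σ (n - l(t))`. -/
theorem DriftDiffusionEq.shifted [IsFiniteMeasure (volume.restrict Ω)] (hΩ : IsOpen Ω)
    (hn : IsBoundedEvolution Ω uD n) (hw : IsBoundedEvolution Ω uD w)
    (heq : DriftDiffusionEq Ω d τ V n w) (hσ : σ * σ = 1)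
    (hl : ∀ t, HasDerivAt l (l' t) t) (hl' : Continuous l')
    (hGn' : ∀ᵐ t ∂(volume.restrict (Ioo 0 T)), HasWeakGrad Ω (n t) (Gn t))
    (hGV' : ∀ᵐ t ∂(volume.restrict (Ioo 0 T)), HasWeakGrad Ω (V t) (GV t))
    (hF : MemLp (Function.uncurry fun t x => -(σ * d) • (Gn t x + n t x • GV t x)) 2
      ((volume.restrict (Ioo 0 T)).prod (volume.restrict Ω)))
    (hf : MemLp (Function.uncurry fun t x => σ * ((w t x - n t x) / (2 * τ) - l' t)) 2
      ((volume.restrict (Ioo 0 T)).prod (volume.restrict Ω)))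
    {φ : E3 → ℝ} (hφ : IsTest Ω φ) {s t : ℝ} (hs : 0 ≤ s) (hst : s ≤ t) (ht : t ≤ T) :
    (∫ x in Ω, σ * (n t x - l t) * φ x) - ∫ x in Ω, σ * (n s x - l s) * φ x =
      ∫ r in s..t, ((∫ x in Ω, inner ℝ (-(σ * d) • (Gn r x + n r x • GV r x)) (gradient φ x)) +
        ∫ x in Ω, σ * ((w r x - n r x) / (2 * τ) - l' r) * φ x) := by
  set J : ℝ → ℝ := fun r =>
    (∫ x in Ω, inner ℝ (-(σ * d) • (Gn r x + n r x • GV r x)) (gradient φ x)) +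
        ∫ x in Ω, σ * ((w r x - n r x) / (2 * τ) - l' r) * φ x with hJ
  set c : ℝ := ∫ x in Ω, φ x with hc
  have hφ1 : Integrable φ (volume.restrict Ω) := memLp_one_iff_integrable.1 (hφ.memLp 1 _)
  have hJi : IntegrableOn J (Ioc 0 T) := by
    rw [integrableOn_Ioc_iff_integrableOn_Ioo]
    have i1 := (MemLp.integrable_inner_two hF
      ((hφ.memLp_gradient 2 (volume.restrict Ω)).comp_snd _)).integral_prod_left
    have i2 := (MemLp.integrable_mul_two hf
      ((hφ.memLp 2 (volume.restrict Ω)).comp_snd _)).integral_prod_left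
    exact i1.add i2
  -- `weakGrad` is chosen separately at each time; here it is exchanged for the jointly measurable
  -- gradients. The factor σ is undone with σ² = 1.
  have hae : ∀ᵐ r ∂(volume.restrict (Ioo 0 T)),
      (-(d * ∫ x in Ω, inner ℝ (weakGrad Ω (n r) x + n r x • weakGrad Ω (V r) x) (gradient φ x))
          + 1 / (2 * τ) * ∫ x in Ω, (w r x - n r x) * φ x) = σ * J r + c * l' r := by
    filter_upwards [hGn', hGV', ae_restrict_mem measurableSet_Ioo] with r h1 h2 hr
    have e1 : ∫ x in Ω, inner ℝ (weakGrad Ω (n r) x + n r x • weakGrad Ω (V r) x) (gradient φ x) =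
        ∫ x in Ω, inner ℝ (Gn r x + n r x • GV r x) (gradient φ x) := by
      refine integral_congr_ae ?_
      filter_upwards [h1.weakGrad_ae_eq hΩ, h2.weakGrad_ae_eq hΩ] with x h3 h4
      rw [h3, h4]
    have e2 : ∫ x in Ω, σ * ((w r x - n r x) / (2 * τ) - l' r) * φ x =
        σ * (1 / (2 * τ) * (∫ x in Ω, (w r x - n r x) * φ x) - l' r * c) := by
      rw [hc, ← integral_const_mul, ← integral_const_mul, ← integral_sub, ← integral_const_mul]
      · congr 1 with x
        ring
      · exact (MemLp.integrable_mul_two ((hw.memL2 r hr.1.le).sub (hn.memL2 r hr.1.le))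
          (hφ.memLp 2 _)).const_mul _
      · exact hφ1.const_mul _
    simp only [hJ]
    rw [e1, e2]
    simp only [inner_smul_left, conj_trivial, integral_const_mul]
    linear_combination (d * (∫ x in Ω, inner ℝ (Gn r x + n r x • GV r x) (gradient φ x))
        - 1 / (2 * τ) * (∫ x in Ω, (w r x - n r x) * φ x) + c * l' r) * hσ
  have hfrom0 : ∀ t ∈ Icc 0 T, (∫ x in Ω, σ * (n t x - l t) * φ x) -
      ∫ x in Ω, σ * (n 0 x - l 0) * φ x = ∫ r in (0 : ℝ)..t, J r := by
    intro t ht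
    have hv : ∀ r, 0 ≤ r → ∫ x in Ω, σ * (n r x - l r) * φ x =
        σ * ((∫ x in Ω, n r x * φ x) - l r * c) := fun r hr => by
      rw [hc, ← integral_const_mul, ← integral_sub, ← integral_const_mul]
      · congr 1 with x
        ring
      · exact MemLp.integrable_mul_two (hn.memL2 r hr) (hφ.memLp 2 _)
      · exact hφ1.const_mul _
    have e := heq φ hφ t ht.1
    have hJt : IntervalIntegrable J volume 0 t := by
      rw [intervalIntegrable_iff_integrableOn_Ioc_of_le ht.1]
      exact hJi.mono_set (Ioc_subset_Ioc_right ht.2)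
    have e2 : ∫ r in (0 : ℝ)..t, (-(d * ∫ x in Ω,
          inner ℝ (weakGrad Ω (n r) x + n r x • weakGrad Ω (V r) x) (gradient φ x))
          + 1 / (2 * τ) * ∫ x in Ω, (w r x - n r x) * φ x) =
        σ * (∫ r in (0 : ℝ)..t, J r) + c * (l t - l 0) := by
      rw [← intervalIntegral.integral_eq_sub_of_hasDerivAt (fun r _ => hl r)
        (hl'.intervalIntegrable _ _), ← intervalIntegral.integral_const_mul,
        ← intervalIntegral.integral_const_mul, ← intervalIntegral.integral_add
        (hJt.const_mul σ) ((hl'.intervalIntegrable _ _).const_mul c),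
        intervalIntegral.integral_of_le ht.1, intervalIntegral.integral_of_le ht.1,
        integral_Ioc_eq_integral_Ioo, integral_Ioc_eq_integral_Ioo]
      exact integral_congr_ae
        (ae_restrict_of_ae_restrict_of_subset (Ioo_subset_Ioo_right ht.2) hae)
    rw [e2] at e
    rw [hv t ht.1, hv 0 le_rfl]
    linear_combination σ * e + (∫ r in (0 : ℝ)..t, J r) * hσ
  have hJs : ∀ t ∈ Icc 0 T, IntervalIntegrable J volume 0 t := fun t ht => by
    rw [intervalIntegrable_iff_integrableOn_Ioc_of_le ht.1]
    exact hJi.mono_set (Ioc_subset_Ioc_right ht.2)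
  have ht' : t ∈ Icc 0 T := ⟨hs.trans hst, ht⟩
  have hs' : s ∈ Icc 0 T := ⟨hs, hst.trans ht⟩
  rw [← intervalIntegral.integral_interval_sub_left (hJs t ht') (hJs s hs'), ← hfrom0 t ht',
    ← hfrom0 s hs']
  ring

end Truncation

/-! ### Energy inequality for truncated densities -/

section TruncationEnergy

variable {Ω : Set E3} {lam d τ : ℝ} {g uD VD : E3 → ℝ} {GD : E3 → E3} {n w V : ℝ → E3 → ℝ}
  {Gn GV : ℝ → E3 → E3} {σ T : ℝ} {l l' : ℝ → ℝ}

theorem abs_eq_one_of_mul_self (hσ : σ * σ = 1) : |σ| = 1 := by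
  rcases mul_self_eq_one_iff.1 hσ with h | h <;> simp [h]

theorem measurable_posIndicator : Measurable fun s : ℝ => if 0 < s then (1 : ℝ) else 0 :=
  Measurable.ite measurableSet_Ioi measurable_const measurable_const

theorem abs_posIndicator_le (s : ℝ) : |(if 0 < s then (1 : ℝ) else 0)| ≤ 1 := by
  split_ifs <;> simp

/-- Boundedness of the density is what makes the drift n∇V square integrable in space-time. -/
theorem memLp_flux {n : ℝ → E3 → ℝ} {K : ℝ}
    (hGn : MemLp (Function.uncurry Gn) 2 ((volume.restrict (Ioo 0 T)).prod (volume.restrict Ω)))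
    (hGV : MemLp (Function.uncurry GV) 2 ((volume.restrict (Ioo 0 T)).prod (volume.restrict Ω)))
    (hn : AEStronglyMeasurable (Function.uncurry n)
      ((volume.restrict (Ioo 0 T)).prod (volume.restrict Ω)))
    (hK : ∀ t ∈ Icc 0 T, ∀ᵐ x ∂(volume.restrict Ω), |n t x| ≤ K) (c : ℝ) :
    MemLp (Function.uncurry fun t x => c • (Gn t x + n t x • GV t x)) 2
      ((volume.restrict (Ioo 0 T)).prod (volume.restrict Ω)) := by
  have hK' : ∀ᵐ p ∂((volume.restrict (Ioo 0 T)).prod (volume.restrict Ω)),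
      |Function.uncurry n p| ≤ K := ae_prod_abs_le hn (by
    filter_upwards [ae_restrict_mem measurableSet_Ioo] with t ht using hK t (Ioo_subset_Icc_self ht))
  exact (hGn.add (memLp_smul_bdd hn hK' hGV)).const_smul c

/-- Pairing of the drift-diffusion flux with the gradient of a truncation, at a fixed time. -/
theorem integral_flux_inner_le [IsFiniteMeasure (volume.restrict Ω)] (hΩ : IsOpen Ω)
    (hlam : 0 < lam) (hd : 0 ≤ d) (hσ : σ * σ = 1) {n ρ V : E3 → ℝ} {Gn GV : E3 → E3} {ℓ K : ℝ}
    (hn : HasH1Grad Ω n Gn) (hGV : MemLp GV 2 (volume.restrict Ω)) (hV : HasWeakGrad Ω V GV)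
    (hK : ∀ᵐ x ∂(volume.restrict Ω), |n x| ≤ K) (hρ : MemLp ρ 2 (volume.restrict Ω))
    (hP : IsPoissonSol Ω lam VD ρ V)
    (hB : HasH10Grad Ω (fun x => max (σ * (n x - ℓ)) 0)
      (fun x => (if 0 < σ * (n x - ℓ) then (1 : ℝ) else 0) • σ • Gn x)) :
    ∫ x in Ω, inner ℝ (-(σ * d) • (Gn x + n x • GV x))
        ((if 0 < σ * (n x - ℓ) then (1 : ℝ) else 0) • σ • Gn x) ≤
      -(d / lam ^ 2 * ∫ x in Ω, ρ x *
        (σ * ℓ * max (σ * (n x - ℓ)) 0 + max (σ * (n x - ℓ)) 0 ^ 2 / 2)) := by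
  set k : E3 → ℝ := fun x => max (σ * (n x - ℓ)) 0 with hk
  set C : E3 → E3 := fun x => (if 0 < σ * (n x - ℓ) then (1 : ℝ) else 0) • σ • Gn x with hC
  have habs := abs_eq_one_of_mul_self hσ
  have hβ : (0 : ℝ) ≤ |K| + |ℓ| := by positivity
  have hkb : ∀ᵐ x ∂(volume.restrict Ω), k x ∈ Icc 0 (|K| + |ℓ|) := by
    filter_upwards [hK] with x hx
    refine ⟨le_max_right _ _, max_le ?_ hβ⟩
    calc σ * (n x - ℓ) ≤ |σ * (n x - ℓ)| := le_abs_self _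
      _ = |n x - ℓ| := by rw [abs_mul, habs, one_mul]
      _ ≤ |n x| + |ℓ| := abs_sub _ _
      _ ≤ |K| + |ℓ| := by linarith [le_abs_self K]
  -- Where k > 0 one has n = ℓ + σk, so n∇k is the gradient of ℓk + σk²/2. This is an admissible
  -- test function for the Poisson equation.
  have hQ : HasH10Grad Ω (fun x => ℓ * k x + σ * (k x ^ 2 / 2))
      (fun x => (ℓ + σ * k x) • C x) := by
    have h0 : HasH10Grad Ω (fun x => k x - (fun _ => (0 : ℝ)) x)
        (fun x => C x - (fun _ => (0 : E3)) x) := by simpa using hB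
    have := HasH10Grad.comp_sub_comp_of_mem_Icc (Φ := fun s => ℓ * s + σ * (s ^ 2 / 2))
      (Φ' := fun s => ℓ + σ * s) hΩ (HasH1Grad.const 0) h0 hβ hkb
      (Eventually.of_forall fun _ => ⟨le_rfl, hβ⟩) (fun s _ => by
        have := ((hasDerivAt_id s).const_mul ℓ).add
          ((((hasDerivAt_id s).pow 2).div_const 2).const_mul σ)
        exact this.congr_deriv (by simp)) (by fun_prop)
    simpa using this
  have hV' := hV.weakGrad_ae_eq hΩ
  have e1 : lam ^ 2 * ∫ x in Ω, inner ℝ (GV x) ((ℓ + σ * k x) • C x) =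
      ∫ x in Ω, ρ x * (ℓ * k x + σ * (k x ^ 2 / 2)) := by
    rw [← hP.test hΩ hρ hQ]
    congr 1
    refine integral_congr_ae ?_
    filter_upwards [hV'] with x hx
    rw [hx]
  have hflux : MemLp (fun x => -(σ * d) • (Gn x + n x • GV x)) 2 (volume.restrict Ω) := by
    have h := (hn.memLp_grad.add (memLp_smul_bdd hn.memLp.1 hK hGV)).const_smul (-(σ * d))
    exact h
  -- The diffusion part equals -d|∇n|² on {k > 0} and is dropped; only the drift part remains.
  have hle : ∫ x in Ω, inner ℝ (-(σ * d) • (Gn x + n x • GV x)) (C x) ≤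
      ∫ x in Ω, -(d * σ) * inner ℝ (GV x) ((ℓ + σ * k x) • C x) := by
    refine integral_mono (MemLp.integrable_inner_two hflux hB.memLp_grad)
      ((MemLp.integrable_inner_two hGV hQ.memLp_grad).const_mul _) fun x => ?_
    simp only
    by_cases hx : 0 < σ * (n x - ℓ)
    · have hkx : ℓ + σ * k x = n x := by
        simp only [k, max_eq_left hx.le]
        linear_combination (n x - ℓ) * hσ
      have hCx : C x = σ • Gn x := by simp [C, hx]
      rw [hkx, hCx]
      simp only [inner_smul_left, inner_smul_right, inner_add_left, conj_trivial, inner_neg_left,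
        neg_smul]
      have : 0 ≤ d * inner ℝ (Gn x) (Gn x) := mul_nonneg hd real_inner_self_nonneg
      have e : -(σ * d * (σ * (inner ℝ (Gn x) (Gn x) + n x * inner ℝ (GV x) (Gn x)))) =
          -(d * inner ℝ (Gn x) (Gn x)) - d * n x * inner ℝ (GV x) (Gn x) := by
        linear_combination (-d * (inner ℝ (Gn x) (Gn x) + n x * inner ℝ (GV x) (Gn x))) * hσ
      have e' : -(d * σ) * (n x * (σ * inner ℝ (GV x) (Gn x))) =
          - d * n x * inner ℝ (GV x) (Gn x) := by
        linear_combination (-d * (n x * inner ℝ (GV x) (Gn x))) * hσ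
      linarith
    · simp [C, hx]
  refine hle.trans_eq ?_
  rw [integral_const_mul]
  have e2 : ∫ x in Ω, ρ x * (σ * ℓ * k x + k x ^ 2 / 2) =
      σ * ∫ x in Ω, ρ x * (ℓ * k x + σ * (k x ^ 2 / 2)) := by
    rw [← integral_const_mul]
    congr 1 with x
    linear_combination (-(ρ x * (k x ^ 2 / 2))) * hσ
  rw [e2, ← e1]
  field_simp

/-- Energy inequality for the truncation `k = (σ (n - l(t)))⁺` of a density. -/
theorem truncation_energy_le (hΩ : IsOpen Ω) (hΩb : Bornology.IsBounded Ω) (hlam : 0 < lam)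
    (hd : 0 ≤ d) (huD : HasH1Grad Ω uD GD) (huDc : ContinuousOn uD (closure Ω))
    (hg : MemLp g 2 (volume.restrict Ω)) (hn : IsBoundedEvolution Ω uD n)
    (hw : IsBoundedEvolution Ω uD w) (hV : ∀ T, 0 < T → MemL2H1 T Ω V)
    (heq : DriftDiffusionEq Ω d τ V n w)
    (hP : ∀ t, 0 < t → IsPoissonSol Ω lam VD (fun x => n t x + w t x - g x) (V t))
    (hσ : σ * σ = 1) (hl : ∀ t, HasDerivAt l (l' t) t) (hl' : Continuous l') (hT : 0 < T)
    (hbd : ∀ t ∈ Ioo 0 T, ∀ x ∈ frontier Ω, σ * (uD x - l t) ≤ 0) :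
    ContinuousOn (fun t => 1 / 2 * ∫ x in Ω, max (σ * (n t x - l t)) 0 ^ 2) (Icc 0 T) ∧
    ∃ E : ℝ → ℝ, IntervalIntegrable E volume 0 T ∧
      1 / 2 * (∫ x in Ω, max (σ * (n T x - l T)) 0 ^ 2) -
        1 / 2 * (∫ x in Ω, max (σ * (n 0 x - l 0)) 0 ^ 2) ≤ ∫ t in (0 : ℝ)..T, E t ∧
      ∀ᵐ t ∂(volume.restrict (Ioo 0 T)), E t ≤
        -(d / lam ^ 2 * ∫ x in Ω, (n t x + w t x - g x) *
          (σ * l t * max (σ * (n t x - l t)) 0 + max (σ * (n t x - l t)) 0 ^ 2 / 2)) +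
        ∫ x in Ω, σ * ((w t x - n t x) / (2 * τ) - l' t) * max (σ * (n t x - l t)) 0 := by
  have : IsFiniteMeasure (volume.restrict Ω) := ⟨by simpa using hΩb.measure_lt_top⟩
  obtain ⟨hnm, Gn, hGn, hGn'⟩ := hn.memL2H1 T hT
  obtain ⟨hwm, -⟩ := hw.memL2H1 T hT
  obtain ⟨-, GV, hGV, hGV'⟩ := hV T hT
  obtain ⟨K, hK⟩ := hn.bdd T hT
  have hlc : Continuous l := continuous_iff_continuousAt.2 fun t => (hl t).continuousAt
  have hvm : MemLp (Function.uncurry fun t x => σ * (n t x - l t)) 2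
      ((volume.restrict (Ioo 0 T)).prod (volume.restrict Ω)) :=
    (hnm.sub (memLp_comp_fst_of_continuous hlc T)).const_mul σ
  have hF := memLp_flux hGn hGV hnm.1 hK (-(σ * d))
  have hf : MemLp (Function.uncurry fun t x => σ * ((w t x - n t x) / (2 * τ) - l' t)) 2
      ((volume.restrict (Ioo 0 T)).prod (volume.restrict Ω)) := by
    have := (((hwm.sub hnm).const_mul (2 * τ)⁻¹).sub
      (memLp_comp_fst_of_continuous hl' T)).const_mul σ
    refine this.ae_eq (Eventually.of_forall fun p => ?_)
    simp [Function.uncurry, div_eq_inv_mul]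
  have hC : MemLp (Function.uncurry fun t x =>
      (if 0 < σ * (n t x - l t) then (1 : ℝ) else 0) • σ • Gn t x) 2
      ((volume.restrict (Ioo 0 T)).prod (volume.restrict Ω)) :=
    memLp_smul_bdd (L := 1)
      (measurable_posIndicator.comp_aemeasurable hvm.1.aemeasurable).aestronglyMeasurable
      (Eventually.of_forall fun p => abs_posIndicator_le _) (hGn.const_smul σ)
  have hH1 := hn.ae_hasH1Grad hGn hGn'
  have hB : ∀ᵐ t ∂(volume.restrict (Ioo 0 T)), HasH10Grad Ω (fun x => max (σ * (n t x - l t)) 0)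
      (fun x => (if 0 < σ * (n t x - l t) then (1 : ℝ) else 0) • σ • Gn t x) := by
    filter_upwards [hH1, ae_restrict_of_ae_restrict_of_subset Ioo_subset_Ioi_self hn.bdry,
      ae_restrict_mem measurableSet_Ioo] with t h1 h2 ht
    have h3 := (h2.hasH10Grad_of_hasH1Grad hΩ (h1.sub huD)).const_mul σ
    refine HasH10Grad.posPart (b := fun x => σ * (uD x - l t)) (B := fun x => σ • GD x) hΩ hΩb
      ?_ ?_ (hbd t ht) ?_
    · refine ((huD.sub (HasH1Grad.const (l t))).const_mul σ).congr EventuallyEq.rfl ?_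
      exact Eventually.of_forall fun x => by simp
    · exact (huDc.sub continuousOn_const).const_smul σ
    · refine h3.congr (Eventually.of_forall fun x => ?_) (Eventually.of_forall fun x => ?_)
      · simp only; ring
      · simp only [smul_sub]
  have hv2 : ∀ t ∈ Icc 0 T, MemLp (fun x => σ * (n t x - l t)) 2 (volume.restrict Ω) :=
    fun t ht => ((hn.memL2 t ht.1).sub (memLp_const _)).const_mul σ
  have hvc : ∀ t₀ ∈ Icc 0 T, Tendsto (fun t => eLpNorm
      (fun x => σ * (n t x - l t) - σ * (n t₀ x - l t₀)) 2 (volume.restrict Ω))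
      (𝓝[Icc 0 T] t₀) (𝓝 0) := by
    intro t₀ ht₀
    have l1 := (hn.cont t₀ ht₀.1).mono_left (nhdsWithin_mono t₀ (Icc_subset_Ici_self : Icc 0 T ⊆ Ici 0))
    have l2 : Tendsto (fun t => eLpNorm (fun _ : E3 => l t - l t₀) 2 (volume.restrict Ω))
        (𝓝[Icc 0 T] t₀) (𝓝 0) := by
      have hc : Tendsto (fun t => ‖l t - l t₀‖ₑ) (𝓝[Icc 0 T] t₀) (𝓝 0) := by
        have : Continuous fun t => ‖l t - l t₀‖ₑ := (hlc.sub continuous_const).enorm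
        simpa using (this.tendsto t₀).mono_left nhdsWithin_le_nhds
      simp only [eLpNorm_const' _ (two_ne_zero (α := ℝ≥0∞)) ENNReal.ofNat_ne_top]
      have hne : (volume.restrict Ω) univ ^ (1 / (2 : ℝ≥0∞).toReal) ≠ ⊤ :=
        ENNReal.rpow_ne_top_of_nonneg (by simp) (measure_ne_top _ _)
      simpa using ENNReal.Tendsto.mul_const hc (Or.inr hne)
    have l3 := l1.add l2
    rw [add_zero] at l3
    refine tendsto_of_tendsto_of_tendsto_of_le_of_le' tendsto_const_nhds l3
      (Eventually.of_forall fun _ => zero_le) ?_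
    filter_upwards [self_mem_nhdsWithin] with t ht
    refine le_trans (le_of_eq ?_) (eLpNorm_sub_le
      ((hn.memL2 t ht.1).sub (hn.memL2 t₀ ht₀.1)).1 aestronglyMeasurable_const (by norm_num))
    rw [← eLpNorm_norm]
    conv_rhs => rw [← eLpNorm_norm]
    congr 1 with x
    simp only [Pi.sub_apply, ← mul_sub, norm_mul, Real.norm_eq_abs, abs_eq_one_of_mul_self hσ,
      one_mul]
    congr 1
    ring
  obtain ⟨r1, r2, r3⟩ := posPart_energy_le (v := fun t x => σ * (n t x - l t)) hΩ hT hv2 hvc hvm hF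
    hf hC hB (fun φ hφ s t hs hst ht =>
      heq.shifted hΩ hn hw hσ hl hl' hGn' hGV' hF hf hφ hs hst ht)
  refine ⟨r1, _, r2, r3, ?_⟩
  filter_upwards [hH1, hB, hGV', memLp_two_slice hGV, ae_restrict_mem measurableSet_Ioo]
    with t h1 h2 h3 h4 ht
  refine add_le_add ?_ le_rfl
  exact integral_flux_inner_le hΩ hlam hd hσ h1 h4 h3 (hK t ⟨ht.1.le, ht.2.le⟩)
    (((hn.memL2 t ht.1.le).add (hw.memL2 t ht.1.le)).sub hg) (hP t ht.1) h2

end TruncationEnergy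

/-! ### Grönwall and comparison with a barrier -/

section EvolutionBounds

/-- Integral form of Grönwall's inequality with vanishing initial value. -/
theorem eq_zero_of_le_mul_integral {Y : ℝ → ℝ} {C T : ℝ} (hT : 0 < T)
    (hY : ContinuousOn Y (Icc 0 T)) (h0 : ∀ t ∈ Icc 0 T, 0 ≤ Y t)
    (h : ∀ t ∈ Ioc 0 T, Y t ≤ C * ∫ s in (0 : ℝ)..t, Y s) : ∀ t ∈ Ioc 0 T, Y t = 0 := by
  have hI : IntervalIntegrable Y volume 0 T := by
    apply ContinuousOn.intervalIntegrable
    rwa [uIcc_of_le hT.le]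
  have hZ0 : ∀ t ∈ Icc 0 T, 0 ≤ ∫ s in (0 : ℝ)..t, Y s := fun t ht =>
    intervalIntegral.integral_nonneg ht.1 fun s hs => h0 s ⟨hs.1, hs.2.trans ht.2⟩
  -- The inequality is assumed only for t > 0; at t = 0 it follows by continuity.
  have hYc : Y 0 ≤ 0 := by
    have l1 : Tendsto Y (𝓝[Ioc 0 T] 0) (𝓝 (Y 0)) :=
      (hY 0 ⟨le_rfl, hT.le⟩).mono Ioc_subset_Icc_self
    have l2 : Tendsto (fun t => C * ∫ s in (0 : ℝ)..t, Y s) (𝓝[Ioc 0 T] 0) (𝓝 0) := by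
      have := (intervalIntegral.continuousOn_primitive_interval' hI left_mem_uIcc) 0 left_mem_uIcc
      rw [uIcc_of_le hT.le] at this
      have := (this.mono Ioc_subset_Icc_self).tendsto.const_mul C
      simpa using this
    have : (𝓝[Ioc 0 T] (0 : ℝ)).NeBot := by
      rw [nhdsWithin_Ioc_eq_nhdsGT hT]; infer_instance
    exact le_of_tendsto_of_tendsto l1 l2 (eventually_mem_nhdsWithin.mono h)
  have hY' : ∀ t ∈ Icc 0 T, Y t ≤ C * ∫ s in (0 : ℝ)..t, Y s := fun t ht => by
    rcases ht.1.eq_or_lt with rfl | h1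
    · simpa using hYc
    · exact h t ⟨h1, ht.2⟩
  -- The primitive Z of Y has Z(0) = 0 and |Z'| ≤ C|Z| for its right derivative, hence vanishes.
  have key := eq_zero_of_abs_deriv_le_mul_abs_self_of_eq_zero_right
    (f := fun t => ∫ s in (0 : ℝ)..t, Y s) (f' := Y) (K := C) (a := 0) (b := T)
    (by
      have := intervalIntegral.continuousOn_primitive_interval' hI left_mem_uIcc
      rwa [uIcc_of_le hT.le] at this)
    (fun t ht => by
      have hc : ContinuousWithinAt Y (Ioi t) t := by
        refine ((hY t ⟨ht.1, ht.2.le⟩).mono ?_).mono_of_mem_nhdsWithin (Ioc_mem_nhdsGT ht.2)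
        exact fun s hs => ⟨ht.1.trans hs.1.le, hs.2⟩
      refine intervalIntegral.integral_hasDerivWithinAt_right (t := Ioi t) (hI.mono_set ?_) ?_ hc
      · rw [uIcc_of_le ht.1, uIcc_of_le hT.le]
        exact Icc_subset_Icc_right ht.2.le
      · refine ⟨Ioc t T, Ioc_mem_nhdsGT ht.2, ?_⟩
        exact (hY.mono fun s hs => ⟨ht.1.trans hs.1.le, hs.2⟩).aestronglyMeasurable
          measurableSet_Ioc)
    (by simp) (fun t ht => by
      have ht' : t ∈ Icc 0 T := ⟨ht.1, ht.2.le⟩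
      rw [Real.norm_eq_abs, Real.norm_eq_abs, abs_of_nonneg (h0 t ht'), abs_of_nonneg (hZ0 t ht')]
      exact hY' t ht')
  intro t ht
  have ht' := Ioc_subset_Icc_self ht
  refine le_antisymm ?_ (h0 t ht')
  have := h t ht
  rwa [key t ht', mul_zero] at this

variable {Ω : Set E3}

theorem memLp_top_max_zero {X : Type*} [MeasurableSpace X] {μ : Measure X} {u : X → ℝ}
    (hu : MemLp u ⊤ μ) : MemLp (fun x => max (u x) 0) ⊤ μ :=
  hu.mono (hu.1.aemeasurable.max aemeasurable_const).aestronglyMeasurable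
    (Eventually.of_forall fun x => by
      rw [Real.norm_eq_abs, Real.norm_eq_abs, abs_of_nonneg (le_max_right _ _)]
      exact max_le (le_abs_self _) (abs_nonneg _))

theorem MemLp.mul_top {X : Type*} [MeasurableSpace X] {μ : Measure X} {u v : X → ℝ}
    (hu : MemLp u ⊤ μ) (hv : MemLp v ⊤ μ) : MemLp (fun x => u x * v x) ⊤ μ :=
  _root_.MeasureTheory.MemLp.mul' (p := ⊤) (q := ⊤) hv hu

/-- Passes from the pointwise source estimate to the integrated one; all terms are bounded on a
finite measure space, so the integrals may be split. -/
theorem source_integral_add_le [IsFiniteMeasure (volume.restrict Ω)] {n w g : E3 → ℝ}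
    {σ ℓ ℓ' d₁ d₂ lam τ C : ℝ} (hn : MemLp n ⊤ (volume.restrict Ω))
    (hw : MemLp w ⊤ (volume.restrict Ω)) (hg : MemLp g ⊤ (volume.restrict Ω))
    (h : ∀ᵐ x ∂(volume.restrict Ω),
      -(d₁ / lam ^ 2 * ((n x + w x - g x) *
          (σ * ℓ * max (σ * (n x - ℓ)) 0 + max (σ * (n x - ℓ)) 0 ^ 2 / 2))) +
        σ * ((w x - n x) / (2 * τ) - ℓ') * max (σ * (n x - ℓ)) 0 +
      (-(d₂ / lam ^ 2 * ((w x + n x - g x) *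
          (σ * ℓ * max (σ * (w x - ℓ)) 0 + max (σ * (w x - ℓ)) 0 ^ 2 / 2))) +
        σ * ((n x - w x) / (2 * τ) - ℓ') * max (σ * (w x - ℓ)) 0) ≤
      C * (max (σ * (n x - ℓ)) 0 ^ 2 / 2 + max (σ * (w x - ℓ)) 0 ^ 2 / 2)) :
    (-(d₁ / lam ^ 2 * ∫ x in Ω, (n x + w x - g x) *
          (σ * ℓ * max (σ * (n x - ℓ)) 0 + max (σ * (n x - ℓ)) 0 ^ 2 / 2)) +
        ∫ x in Ω, σ * ((w x - n x) / (2 * τ) - ℓ') * max (σ * (n x - ℓ)) 0) +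
      (-(d₂ / lam ^ 2 * ∫ x in Ω, (w x + n x - g x) *
          (σ * ℓ * max (σ * (w x - ℓ)) 0 + max (σ * (w x - ℓ)) 0 ^ 2 / 2)) +
        ∫ x in Ω, σ * ((n x - w x) / (2 * τ) - ℓ') * max (σ * (w x - ℓ)) 0) ≤
      C * (1 / 2 * (∫ x in Ω, max (σ * (n x - ℓ)) 0 ^ 2) +
        1 / 2 * ∫ x in Ω, max (σ * (w x - ℓ)) 0 ^ 2) := by
  have hc : ∀ c : ℝ, MemLp (fun _ : E3 => c) ⊤ (volume.restrict Ω) := fun c => memLp_const c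
  have hk : ∀ {u : E3 → ℝ}, MemLp u ⊤ (volume.restrict Ω) →
      MemLp (fun x => max (σ * (u x - ℓ)) 0) ⊤ (volume.restrict Ω) := fun hu =>
    memLp_top_max_zero ((hu.sub (hc ℓ)).const_mul σ)
  have hk2 : ∀ {u : E3 → ℝ}, MemLp u ⊤ (volume.restrict Ω) →
      MemLp (fun x => max (σ * (u x - ℓ)) 0 ^ 2) ⊤ (volume.restrict Ω) := fun hu => by
    simpa only [pow_two] using MemLp.mul_top (hk hu) (hk hu)
  have hA : ∀ {u v : E3 → ℝ}, MemLp u ⊤ (volume.restrict Ω) → MemLp v ⊤ (volume.restrict Ω) →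
      Integrable (fun x => (u x + v x - g x) *
        (σ * ℓ * max (σ * (u x - ℓ)) 0 + max (σ * (u x - ℓ)) 0 ^ 2 / 2)) (volume.restrict Ω) :=
    fun hu hv => by
      have h1 := MemLp.mul_top ((hu.add hv).sub hg) (((hk hu).const_mul (σ * ℓ)).add
        ((hk2 hu).const_mul 2⁻¹))
      refine (h1.integrable le_top).congr (Eventually.of_forall fun x => ?_)
      simp [div_eq_inv_mul]
  have hB : ∀ {u v : E3 → ℝ}, MemLp u ⊤ (volume.restrict Ω) → MemLp v ⊤ (volume.restrict Ω) →
      Integrable (fun x => σ * ((v x - u x) / (2 * τ) - ℓ') * max (σ * (u x - ℓ)) 0)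
        (volume.restrict Ω) :=
    fun hu hv => by
      have h1 := MemLp.mul_top ((((hv.sub hu).const_mul (2 * τ)⁻¹).sub (hc ℓ')).const_mul σ) (hk hu)
      refine (h1.integrable le_top).congr (Eventually.of_forall fun x => ?_)
      simp [div_eq_inv_mul]
  have i1 := ((hA hn hw).const_mul (d₁ / lam ^ 2)).neg.add (hB hn hw)
  have i2 := ((hA hw hn).const_mul (d₂ / lam ^ 2)).neg.add (hB hw hn)
  have j1 := ((hk2 hn).integrable le_top).div_const 2
  have j2 := ((hk2 hw).integrable le_top).div_const 2
  have key := integral_mono_ae (i1.add i2) ((j1.add j2).const_mul C) h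
  rw [integral_add' i1 i2, integral_add' ((hA hn hw).const_mul _).neg (hB hn hw),
    integral_add' ((hA hw hn).const_mul _).neg (hB hw hn), integral_neg', integral_neg',
    integral_const_mul, integral_const_mul, integral_const_mul, integral_add' j1 j2,
    integral_div, integral_div] at key
  linarith

variable {lam d₁ d₂ τ : ℝ} {g uD VD : E3 → ℝ} {GD : E3 → E3} {n w V : ℝ → E3 → ℝ}
  {σ T C : ℝ} {l l' : ℝ → ℝ}

theorem ae_nonpos_of_integral_max_sq_eq_zero {X : Type*} [MeasurableSpace X] {μ : Measure X}
    {u : X → ℝ} (hu : MemLp u 2 μ) (h : ∫ x, max (u x) 0 ^ 2 ∂μ = 0) : ∀ᵐ x ∂μ, u x ≤ 0 := by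
  have hi : Integrable (fun x => max (u x) 0 ^ 2) μ := (memLp_posPart hu).integrable_sq
  have := (integral_eq_zero_iff_of_nonneg (fun x => sq_nonneg _) hi).1 h
  filter_upwards [this] with x hx
  have : max (u x) 0 = 0 := by simpa using hx
  exact max_eq_right_iff.1 this

theorem IsBoundedEvolution.memLp_top (hn : IsBoundedEvolution Ω uD n) {t : ℝ} (ht : 0 ≤ t) :
    MemLp (n t) ⊤ (volume.restrict Ω) := by
  obtain ⟨K, hK⟩ := hn.bdd (t + 1) (by linarith)
  exact memLp_top_of_bound (hn.memL2 t ht).1 K (hK t ⟨ht, by linarith⟩)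

/-- Comparison principle for two coupled densities with a common spatially constant barrier. -/
theorem barrier_comparison (hΩ : IsOpen Ω) (hΩb : Bornology.IsBounded Ω) (hlam : 0 < lam)
    (hd₁ : 0 ≤ d₁) (hd₂ : 0 ≤ d₂) (huD : HasH1Grad Ω uD GD) (huDc : ContinuousOn uD (closure Ω))
    (hg : MemLp g ⊤ (volume.restrict Ω)) (hn : IsBoundedEvolution Ω uD n)
    (hw : IsBoundedEvolution Ω uD w) (hV : ∀ T, 0 < T → MemL2H1 T Ω V)
    (heq₁ : DriftDiffusionEq Ω d₁ τ V n w) (heq₂ : DriftDiffusionEq Ω d₂ τ V w n)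
    (hP : ∀ t, 0 < t → IsPoissonSol Ω lam VD (fun x => n t x + w t x - g x) (V t))
    (hσ : σ * σ = 1) (hl : ∀ t, HasDerivAt l (l' t) t) (hl' : Continuous l') (hT : 0 < T)
    (hbd : ∀ t ∈ Ioo 0 T, ∀ x ∈ frontier Ω, σ * (uD x - l t) ≤ 0)
    (hn0 : ∀ᵐ x ∂(volume.restrict Ω), σ * (n 0 x - l 0) ≤ 0)
    (hw0 : ∀ᵐ x ∂(volume.restrict Ω), σ * (w 0 x - l 0) ≤ 0)
    (hS : ∀ t ∈ Ioo 0 T, ∀ᵐ x ∂(volume.restrict Ω),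
      -(d₁ / lam ^ 2 * ((n t x + w t x - g x) *
          (σ * l t * max (σ * (n t x - l t)) 0 + max (σ * (n t x - l t)) 0 ^ 2 / 2))) +
        σ * ((w t x - n t x) / (2 * τ) - l' t) * max (σ * (n t x - l t)) 0 +
      (-(d₂ / lam ^ 2 * ((w t x + n t x - g x) *
          (σ * l t * max (σ * (w t x - l t)) 0 + max (σ * (w t x - l t)) 0 ^ 2 / 2))) +
        σ * ((n t x - w t x) / (2 * τ) - l' t) * max (σ * (w t x - l t)) 0) ≤
      C * (max (σ * (n t x - l t)) 0 ^ 2 / 2 + max (σ * (w t x - l t)) 0 ^ 2 / 2)) :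
    ∀ t ∈ Ioc 0 T, (∀ᵐ x ∂(volume.restrict Ω), σ * (n t x - l t) ≤ 0) ∧
      ∀ᵐ x ∂(volume.restrict Ω), σ * (w t x - l t) ≤ 0 := by
  have : IsFiniteMeasure (volume.restrict Ω) := ⟨by simpa using hΩb.measure_lt_top⟩
  have hg2 : MemLp g 2 (volume.restrict Ω) := hg.mono_exponent le_top
  have hP' : ∀ t, 0 < t → IsPoissonSol Ω lam VD (fun x => w t x + n t x - g x) (V t) :=
    fun t ht => by simpa only [add_comm] using hP t ht
  set Yn : ℝ → ℝ := fun t => 1 / 2 * ∫ x in Ω, max (σ * (n t x - l t)) 0 ^ 2 with hYn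
  set Yw : ℝ → ℝ := fun t => 1 / 2 * ∫ x in Ω, max (σ * (w t x - l t)) 0 ^ 2 with hYw
  have hn' : ∀ t, 0 ≤ Yn t := fun t => mul_nonneg (by norm_num) (integral_nonneg fun x => sq_nonneg _)
  have hw' : ∀ t, 0 ≤ Yw t := fun t => mul_nonneg (by norm_num) (integral_nonneg fun x => sq_nonneg _)
  have hcn := (truncation_energy_le hΩ hΩb hlam hd₁ huD huDc hg2 hn hw hV heq₁ hP hσ hl hl' hT hbd).1
  have hcw := (truncation_energy_le hΩ hΩb hlam hd₂ huD huDc hg2 hw hn hV heq₂ hP' hσ hl hl' hT hbd).1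
  have hz : ∀ {u : ℝ → E3 → ℝ}, (∀ᵐ x ∂(volume.restrict Ω), σ * (u 0 x - l 0) ≤ 0) →
      1 / 2 * (∫ x in Ω, max (σ * (u 0 x - l 0)) 0 ^ 2) = 0 := fun {u} hu => by
    rw [integral_eq_zero_of_ae, mul_zero]
    filter_upwards [hu] with x hx
    simp [max_eq_right hx]
  -- The two energies must be added before estimating, since the coupling terms have a sign only
  -- jointly. The initial energies vanish.
  have hle : ∀ t ∈ Ioc 0 T, Yn t + Yw t ≤ C * ∫ s in (0 : ℝ)..t, (Yn s + Yw s) := by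
    intro t ht
    have hbd' : ∀ s ∈ Ioo 0 t, ∀ x ∈ frontier Ω, σ * (uD x - l s) ≤ 0 := fun s hs =>
      hbd s ⟨hs.1, hs.2.trans_le ht.2⟩
    obtain ⟨-, E₁, hE₁, h₁, h₁'⟩ := truncation_energy_le hΩ hΩb hlam hd₁ huD huDc hg2 hn hw hV heq₁
      hP hσ hl hl' ht.1 hbd'
    obtain ⟨-, E₂, hE₂, h₂, h₂'⟩ := truncation_energy_le hΩ hΩb hlam hd₂ huD huDc hg2 hw hn hV heq₂
      hP' hσ hl hl' ht.1 hbd'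
    rw [hz hn0] at h₁
    rw [hz hw0] at h₂
    have hI : IntervalIntegrable (fun s => C * (Yn s + Yw s)) volume 0 t := by
      apply ContinuousOn.intervalIntegrable
      rw [uIcc_of_le ht.1.le]
      exact continuousOn_const.mul ((hcn.add hcw).mono (Icc_subset_Icc_right ht.2))
    have := intervalIntegral.integral_mono_ae_restrict ht.1.le (hE₁.add hE₂) hI (by
      rw [← Measure.restrict_congr_set Ioo_ae_eq_Icc]
      filter_upwards [h₁', h₂', ae_restrict_mem measurableSet_Ioo] with s e₁ e₂ hs
      exact (add_le_add e₁ e₂).trans (source_integral_add_le (hn.memLp_top hs.1.le)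
        (hw.memLp_top hs.1.le) hg (hS s ⟨hs.1, hs.2.trans_le ht.2⟩)))
    rw [intervalIntegral.integral_const_mul] at this
    rw [intervalIntegral.integral_add hE₁ hE₂] at this
    simp only [Yn, Yw] at this ⊢
    linarith
  have hzero := eq_zero_of_le_mul_integral hT (hcn.add hcw)
    (fun t _ => add_nonneg (hn' t) (hw' t)) hle
  intro t ht
  have h1 : Yn t + Yw t = 0 := hzero t ht
  have h2 : Yn t = 0 := by linarith [hn' t, hw' t]
  have h3 : Yw t = 0 := by linarith [hn' t, hw' t]
  have hm : ∀ {u : ℝ → E3 → ℝ}, MemLp (u t) 2 (volume.restrict Ω) →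
      MemLp (fun x => σ * (u t x - l t)) 2 (volume.restrict Ω) := fun hu =>
    (hu.sub (memLp_const _)).const_mul σ
  exact ⟨ae_nonpos_of_integral_max_sq_eq_zero (hm (hn.memL2 t ht.1.le)) (by simpa [Yn] using h2),
    ae_nonpos_of_integral_max_sq_eq_zero (hm (hw.memL2 t ht.1.le)) (by simpa [Yw] using h3)⟩

end EvolutionBounds

/-! ### Positive lower bound and uniform upper bound for the densities -/

section DensityBounds

theorem exists_ae_abs_le {X : Type*} [MeasurableSpace X] {μ : Measure X} {u : X → ℝ}
    (hu : MemLp u ⊤ μ) : ∃ K : ℝ, 0 ≤ K ∧ ∀ᵐ x ∂μ, |u x| ≤ K := by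
  refine ⟨(eLpNorm u ⊤ μ).toReal, ENNReal.toReal_nonneg, ?_⟩
  have h := ae_le_eLpNormEssSup (f := u) (μ := μ)
  rw [← eLpNorm_exponent_top] at h
  filter_upwards [h] with x hx
  have := ENNReal.toReal_mono hu.2.ne hx
  simpa using this

/-- Truncation is monotone in σn; hence the exchange between the two densities, tested with their
truncations, is dissipative. -/
theorem mul_max_sub_max_nonneg (σ n w ℓ : ℝ) :
    0 ≤ σ * (n - w) * (max (σ * (n - ℓ)) 0 - max (σ * (w - ℓ)) 0) := by
  rcases le_total (σ * n) (σ * w) with h | h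
  · have := max_le_max (show σ * (n - ℓ) ≤ σ * (w - ℓ) by linarith) (le_refl (0 : ℝ))
    exact mul_nonneg_of_nonpos_of_nonpos (by linarith) (by linarith)
  · have := max_le_max (show σ * (w - ℓ) ≤ σ * (n - ℓ) by linarith) (le_refl (0 : ℝ))
    exact mul_nonneg (by linarith) (by linarith)

theorem neg_mul_mul_le {a A ρ R X Z : ℝ} (ha : 0 ≤ a) (haA : a ≤ A) (hρ : |ρ| ≤ R)
    (hX : |X| ≤ Z) : -(a * (ρ * X)) ≤ A * R * Z := by
  have hR : 0 ≤ R := (abs_nonneg _).trans hρ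
  calc -(a * (ρ * X)) ≤ |a * (ρ * X)| := neg_le_abs _
    _ = a * (|ρ| * |X|) := by rw [abs_mul, abs_mul, abs_of_nonneg ha]
    _ ≤ A * (R * Z) := by gcongr; exact ha.trans haA
    _ = A * R * Z := by ring

/-- With l' = -ARl, the decay of the barrier contributes -ARlk, which absorbs the linear part of
AR(lk + k²/2), the bound for the charge term. Only the quadratic part, suited to Grönwall, survives.
-/
theorem lower_source_le {a₁ a₂ A R τ ℓ n w g : ℝ} (ha₁ : 0 ≤ a₁) (ha₂ : 0 ≤ a₂) (h₁ : a₁ ≤ A)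
    (h₂ : a₂ ≤ A) (hρ : |n + w - g| ≤ R) (hτ : 0 < τ) (hℓ : 0 ≤ ℓ) :
    -(a₁ * ((n + w - g) * (-1 * ℓ * max (-1 * (n - ℓ)) 0 + max (-1 * (n - ℓ)) 0 ^ 2 / 2))) +
        -1 * ((w - n) / (2 * τ) - -(A * R * ℓ)) * max (-1 * (n - ℓ)) 0 +
      (-(a₂ * ((w + n - g) * (-1 * ℓ * max (-1 * (w - ℓ)) 0 + max (-1 * (w - ℓ)) 0 ^ 2 / 2))) +
        -1 * ((n - w) / (2 * τ) - -(A * R * ℓ)) * max (-1 * (w - ℓ)) 0) ≤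
      A * R * (max (-1 * (n - ℓ)) 0 ^ 2 / 2 + max (-1 * (w - ℓ)) 0 ^ 2 / 2) := by
  have hx := mul_max_sub_max_nonneg (-1) n w ℓ
  have hk := le_max_right (-1 * (n - ℓ)) 0
  have hj := le_max_right (-1 * (w - ℓ)) 0
  set k := max (-1 * (n - ℓ)) 0
  set j := max (-1 * (w - ℓ)) 0
  have hX : ∀ s : ℝ, 0 ≤ s → |-1 * ℓ * s + s ^ 2 / 2| ≤ ℓ * s + s ^ 2 / 2 := fun s hs => by
    have := mul_nonneg hℓ hs
    rw [abs_le]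
    constructor <;> nlinarith [sq_nonneg s]
  have e₁ := neg_mul_mul_le ha₁ h₁ hρ (hX k hk)
  have e₂ := neg_mul_mul_le ha₂ h₂ (show |w + n - g| ≤ R by rwa [add_comm w n]) (hX j hj)
  have e₃ : -1 * ((w - n) / (2 * τ)) * k + -1 * ((n - w) / (2 * τ)) * j =
      -(-1 * (n - w) * (k - j) / (2 * τ)) := by ring
  have e₄ : 0 ≤ -1 * (n - w) * (k - j) / (2 * τ) := by positivity
  linarith

/-- Where one density exceeds M, the space charge is nonnegative because the other density is
nonnegative and g ≤ M. All contributions then have the favourable sign, and the Grönwall constant is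
0. -/
theorem upper_source_le {a₁ a₂ τ M n w g : ℝ} (ha₁ : 0 ≤ a₁) (ha₂ : 0 ≤ a₂) (hn : 0 ≤ n)
    (hw : 0 ≤ w) (hg : g ≤ M) (hτ : 0 < τ) (hM : 0 ≤ M) :
    -(a₁ * ((n + w - g) * (1 * M * max (1 * (n - M)) 0 + max (1 * (n - M)) 0 ^ 2 / 2))) +
        1 * ((w - n) / (2 * τ) - 0) * max (1 * (n - M)) 0 +
      (-(a₂ * ((w + n - g) * (1 * M * max (1 * (w - M)) 0 + max (1 * (w - M)) 0 ^ 2 / 2))) +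
        1 * ((n - w) / (2 * τ) - 0) * max (1 * (w - M)) 0) ≤
      0 * (max (1 * (n - M)) 0 ^ 2 / 2 + max (1 * (w - M)) 0 ^ 2 / 2) := by
  have hx := mul_max_sub_max_nonneg 1 n w M
  have hS : ∀ u v : ℝ, 0 ≤ v →
      0 ≤ (u + v - g) * (1 * M * max (1 * (u - M)) 0 + max (1 * (u - M)) 0 ^ 2 / 2) := by
    intro u v hv
    rcases le_total u M with h | h
    · have : max (1 * (u - M)) 0 = 0 := max_eq_right (by linarith)
      rw [this]
      simp
    · have : (0 : ℝ) ≤ max (1 * (u - M)) 0 := le_max_right _ _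
      have h' : 0 ≤ u + v - g := by linarith
      positivity
  have e₁ := mul_nonneg ha₁ (hS n w hw)
  have e₂ := mul_nonneg ha₂ (hS w n hn)
  set k := max (1 * (n - M)) 0
  set j := max (1 * (w - M)) 0
  have e₃ : 1 * ((w - n) / (2 * τ) - 0) * k + 1 * ((n - w) / (2 * τ) - 0) * j =
      -(1 * (n - w) * (k - j) / (2 * τ)) := by ring
  have e₄ : 0 ≤ 1 * (n - w) * (k - j) / (2 * τ) := by positivity
  rw [zero_mul]
  linarith

variable {Ω : Set E3} {lam D p τ m M : ℝ} {g nD VD np0 nm0 : E3 → ℝ} {GD : E3 → E3}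
  {np nm V : ℝ → E3 → ℝ}

/-- Both densities stay above an exponentially decaying barrier. -/
theorem IsWeakSolution.exists_pos_le (hΩ : IsOpen Ω) (hΩb : Bornology.IsBounded Ω)
    (hlam : 0 < lam) (hD : 0 < D) (hp0 : 0 ≤ p) (hp1 : p < 1) (hτ : 0 < τ)
    (hnD : HasH1Grad Ω (fun x => nD x / 2) GD) (hnDc : ContinuousOn (fun x => nD x / 2) (closure Ω))
    (hg : MemLp g ⊤ (volume.restrict Ω)) (hm : 0 < m) (hmD : ∀ x ∈ frontier Ω, m ≤ nD x / 2)
    (hmp : ∀ᵐ x ∂(volume.restrict Ω), m ≤ np0 x) (hmm : ∀ᵐ x ∂(volume.restrict Ω), m ≤ nm0 x)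
    (h : IsWeakSolution Ω lam D p τ g nD VD np0 nm0 np nm V) {t : ℝ} (ht : 0 < t) :
    ∃ c : ℝ, 0 < c ∧ ∀ᵐ x ∂(volume.restrict Ω), c ≤ np t x ∧ c ≤ nm t x := by
  obtain ⟨K₁, hK₁⟩ := h.np_reg.bdd t ht
  obtain ⟨K₂, hK₂⟩ := h.nm_reg.bdd t ht
  obtain ⟨Kg, hKg0, hKg⟩ := exists_ae_abs_le hg
  have hp2 : 0 < 1 - p := by linarith
  have hA : (0 : ℝ) ≤ D / (1 - p) / lam ^ 2 := by positivity
  have hAle : D / (1 + p) / lam ^ 2 ≤ D / (1 - p) / lam ^ 2 := by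
    gcongr
    linarith
  set A := D / (1 - p) / lam ^ 2 with hAdef
  -- R bounds the space charge on [0, t] and depends on the solution; A is the larger of the two
  -- ratios of diffusion constant to λ².
  set R := |K₁| + |K₂| + Kg with hR
  have hl : ∀ s : ℝ, HasDerivAt (fun s => m * Real.exp (-(A * R * s)))
      (-(A * R * (m * Real.exp (-(A * R * s))))) s := fun s => by
    have := ((((hasDerivAt_id s).const_mul (A * R)).neg).exp).const_mul m
    exact this.congr_deriv (by simp; ring)
  have hAR : 0 ≤ A * R := by positivity
  have hlm : ∀ s, 0 ≤ s → m * Real.exp (-(A * R * s)) ≤ m := fun s hs => by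
    have : Real.exp (-(A * R * s)) ≤ 1 := Real.exp_le_one_iff.2 (by
      have := mul_nonneg hAR hs
      linarith)
    nlinarith
  have key := barrier_comparison (σ := -1) (C := A * R) hΩ hΩb hlam
    (div_nonneg hD.le (by linarith) : 0 ≤ D / (1 + p)) (div_nonneg hD.le hp2.le) hnD hnDc hg
    h.np_reg h.nm_reg h.V_reg h.np_eqn h.nm_eqn h.poisson (by norm_num) hl (by fun_prop) ht
    (fun s hs x hx => by linarith [hlm s hs.1.le, hmD x hx])
    (by
      filter_upwards [h.np_init, hmp] with x h1 h2
      rw [h1]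
      linarith [hlm 0 le_rfl])
    (by
      filter_upwards [h.nm_init, hmm] with x h1 h2
      rw [h1]
      linarith [hlm 0 le_rfl])
    (fun s hs => by
      filter_upwards [hK₁ s ⟨hs.1.le, hs.2.le⟩, hK₂ s ⟨hs.1.le, hs.2.le⟩, hKg] with x h1 h2 h3
      refine lower_source_le (by positivity) hA hAle le_rfl ?_ hτ (by positivity)
      have e1 := abs_sub (np s x + nm s x) (g x)
      have e2 := abs_add_le (np s x) (nm s x)
      linarith [le_abs_self K₁, le_abs_self K₂]) t ⟨ht, le_rfl⟩
  refine ⟨m * Real.exp (-(A * R * t)), by positivity, ?_⟩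
  filter_upwards [key.1, key.2] with x h1 h2
  constructor <;> linarith

/-- Upper bound, uniform in time. -/
theorem IsWeakSolution.le_of_nonneg (hΩ : IsOpen Ω) (hΩb : Bornology.IsBounded Ω)
    (hlam : 0 < lam) (hD : 0 < D) (hp0 : 0 ≤ p) (hp1 : p < 1) (hτ : 0 < τ)
    (hnD : HasH1Grad Ω (fun x => nD x / 2) GD) (hnDc : ContinuousOn (fun x => nD x / 2) (closure Ω))
    (hg : MemLp g ⊤ (volume.restrict Ω)) (hM : 0 ≤ M) (hMD : ∀ x ∈ frontier Ω, nD x / 2 ≤ M)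
    (hgM : ∀ᵐ x ∂(volume.restrict Ω), g x ≤ M)
    (hMp : ∀ᵐ x ∂(volume.restrict Ω), np0 x ≤ M) (hMm : ∀ᵐ x ∂(volume.restrict Ω), nm0 x ≤ M)
    (h : IsWeakSolution Ω lam D p τ g nD VD np0 nm0 np nm V)
    (h0 : ∀ t, 0 < t → ∀ᵐ x ∂(volume.restrict Ω), 0 ≤ np t x ∧ 0 ≤ nm t x) {t : ℝ} (ht : 0 < t) :
    ∀ᵐ x ∂(volume.restrict Ω), np t x ≤ M ∧ nm t x ≤ M := by
  have hp2 : 0 < 1 - p := by linarith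
  have key := barrier_comparison (σ := 1) (C := 0) (l := fun _ => M) (l' := fun _ => 0) hΩ hΩb hlam
    (div_nonneg hD.le (by linarith) : 0 ≤ D / (1 + p)) (div_nonneg hD.le hp2.le) hnD hnDc hg
    h.np_reg h.nm_reg h.V_reg h.np_eqn h.nm_eqn h.poisson (by norm_num)
    (fun s => hasDerivAt_const s M) continuous_const ht
    (fun s hs x hx => by linarith [hMD x hx])
    (by
      filter_upwards [h.np_init, hMp] with x h1 h2
      rw [h1]
      linarith)
    (by
      filter_upwards [h.nm_init, hMm] with x h1 h2
      rw [h1]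
      linarith)
    (fun s hs => by
      filter_upwards [h0 s hs.1, hgM] with x h1 h2
      exact upper_source_le (by positivity) (by positivity) h1.1 h1.2 h2 hτ hM) t ⟨ht, le_rfl⟩
  filter_upwards [key.1, key.2] with x h1 h2
  constructor <;> linarith

end DensityBounds

/-! ### Bounds for the stationary density -/

section Stationary

variable {Ω : Set E3} {lam : ℝ} {g nD VD n V : E3 → ℝ} {GnD GVD : E3 → E3}

theorem ae_abs_le_of_continuousOn (hΩ : IsOpen Ω) (hΩb : Bornology.IsBounded Ω) {u : E3 → ℝ}
    (hu : ContinuousOn u (closure Ω)) :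
    ∃ K : ℝ, 0 ≤ K ∧ (∀ x ∈ closure Ω, |u x| ≤ K) ∧ ∀ᵐ x ∂(volume.restrict Ω), |u x| ≤ K := by
  obtain ⟨K, hK⟩ := hΩb.isCompact_closure.exists_bound_of_continuousOn hu
  have h : ∀ x ∈ closure Ω, |u x| ≤ |K| := fun x hx => (hK x hx).trans (le_abs_self K)
  refine ⟨|K|, abs_nonneg K, h, ?_⟩
  filter_upwards [ae_restrict_mem hΩ.measurableSet] with x hx using h x (subset_closure hx)

/-- Testing the stationary continuity equation with functions in `H¹₀`. -/
theorem IsStationarySolution.test (hΩ : IsOpen Ω) (h : IsStationarySolution Ω lam g nD VD n V)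
    {Q : E3 → ℝ} {H : E3 → E3} (hQ : HasH10Grad Ω Q H) :
    ∫ x in Ω, inner ℝ (weakGrad Ω n x + n x • weakGrad Ω V x) (H x) = 0 := by
  obtain ⟨K, -, hK⟩ := exists_ae_abs_le h.n_bdd
  have hJ : MemLp (fun x => weakGrad Ω n x + n x • weakGrad Ω V x) 2 (volume.restrict Ω) :=
    (h.n_mem.hasH1Grad hΩ).memLp_grad.add
      (memLp_smul_bdd h.n_mem.1.1 hK (h.poisson.mem.hasH1Grad hΩ).memLp_grad)
  have := hQ.annih (fun _ => 0) _ (by simp) hJ fun φ hφ => by simpa using h.n_eqn φ hφ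
  simpa using this

/-- Testing with k = (n - M)⁺ and removing the drift through the Poisson equation leaves ∫(n - g)(Mk
+ k²/2) ≤ 0. The integrand is nonnegative because g ≤ M, and positive wherever n > M. -/
theorem IsStationarySolution.le (hΩ : IsOpen Ω) (hΩb : Bornology.IsBounded Ω) (hlam : 0 < lam)
    (hnD : HasH1Grad Ω nD GnD) (hnDc : ContinuousOn nD (closure Ω))
    (hg : MemLp g ⊤ (volume.restrict Ω)) {M : ℝ} (hM : 0 < M) (hMD : ∀ x ∈ frontier Ω, nD x ≤ M)
    (hgM : ∀ᵐ x ∂(volume.restrict Ω), g x ≤ M) (h : IsStationarySolution Ω lam g nD VD n V) :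
    ∀ᵐ x ∂(volume.restrict Ω), n x ≤ M := by
  have : IsFiniteMeasure (volume.restrict Ω) := ⟨by simpa using hΩb.measure_lt_top⟩
  obtain ⟨K, -, hK⟩ := exists_ae_abs_le h.n_bdd
  have hn := h.n_mem.hasH1Grad hΩ
  have hV := h.poisson.mem.hasH1Grad hΩ
  have hB : HasH10Grad Ω (fun x => max (1 * (n x - M)) 0)
      (fun x => (if 0 < 1 * (n x - M) then (1 : ℝ) else 0) • (1 : ℝ) • weakGrad Ω n x) := by
    have h3 := h.n_bdry.hasH10Grad_of_hasH1Grad hΩ (hn.sub hnD)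
    simp only [one_mul, one_smul]
    refine HasH10Grad.posPart (b := fun x => nD x - M) (B := GnD) hΩ hΩb ?_
      (hnDc.sub continuousOn_const) (fun x hx => by linarith [hMD x hx]) ?_
    · refine (hnD.sub (HasH1Grad.const M)).congr EventuallyEq.rfl ?_
      exact Eventually.of_forall fun x => by simp
    · exact h3.congr (Eventually.of_forall fun x => by ring) EventuallyEq.rfl
  have hρ : MemLp (fun x => n x - g x) ⊤ (volume.restrict Ω) := h.n_bdd.sub hg
  have hle := integral_flux_inner_le (d := 1) (σ := 1) hΩ hlam zero_le_one (by norm_num) hn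
    hV.memLp_grad (hV.hasWeakGrad hΩ) hK (hρ.mono_exponent le_top) h.poisson hB
  have hz := h.test hΩ hB
  simp only [mul_one, neg_smul, one_smul, inner_neg_left, integral_neg, one_mul] at hle hz
  rw [hz] at hle
  have hk : MemLp (fun x => max (n x - M) 0) ⊤ (volume.restrict Ω) :=
    memLp_top_max_zero (h.n_bdd.sub (memLp_const M))
  have hi : Integrable (fun x => (n x - g x) * (M * max (n x - M) 0 + max (n x - M) 0 ^ 2 / 2))
      (volume.restrict Ω) := by
    have := MemLp.mul_top hρ ((hk.const_mul M).add ((MemLp.mul_top hk hk).const_mul 2⁻¹))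
    refine (this.integrable le_top).congr (Eventually.of_forall fun x => ?_)
    simp [div_eq_inv_mul, pow_two]
  have h0 : 0 ≤ᵐ[volume.restrict Ω]
      fun x => (n x - g x) * (M * max (n x - M) 0 + max (n x - M) 0 ^ 2 / 2) := by
    filter_upwards [hgM] with x hx
    rcases le_total (n x) M with h' | h'
    · simp [max_eq_right (sub_nonpos.2 h')]
    · have h1 : 0 ≤ n x - g x := by linarith
      have h2 : (0 : ℝ) ≤ max (n x - M) 0 := le_max_right _ _
      simp only [Pi.zero_apply]
      positivity
  have hI : ∫ x in Ω, (n x - g x) * (M * max (n x - M) 0 + max (n x - M) 0 ^ 2 / 2) = 0 := by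
    refine le_antisymm ?_ (integral_nonneg_of_ae h0)
    have hl : 0 < 1 / lam ^ 2 := by positivity
    by_contra hneg
    push Not at hneg
    have := mul_pos hl hneg
    linarith
  filter_upwards [(integral_eq_zero_iff_of_nonneg_ae h0 hi).1 hI, hgM] with x hx hgx
  by_contra hlt
  push Not at hlt
  have h1 : 0 < n x - g x := by linarith
  have h2 : 0 < n x - M := by linarith
  rw [max_eq_left h2.le, Pi.zero_apply] at hx
  have : 0 < (n x - g x) * (M * (n x - M) + (n x - M) ^ 2 / 2) := by positivity
  linarith

/-- The Slotboom variable w = n e^V satisfies ∇w = e^V(∇n + n∇V). Testing the equation with (κ -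
w)⁺, where κ is a lower bound for w on the boundary, makes the flux vanish on {w < κ}. The
truncation thus has zero gradient and, by Poincaré, is zero. Boundedness of V turns w ≥ κ into a
bound for n. -/
theorem IsStationarySolution.exists_pos_le (hΩ : IsOpen Ω) (hΩb : Bornology.IsBounded Ω)
    (hnD : HasH1Grad Ω nD GnD) (hnDc : ContinuousOn nD (closure Ω))
    (hVD : HasH1Grad Ω VD GVD) (hVDc : ContinuousOn VD (closure Ω)) {m : ℝ} (hm : 0 < m)
    (hmD : ∀ x ∈ frontier Ω, m ≤ nD x) (h : IsStationarySolution Ω lam g nD VD n V) :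
    ∃ c : ℝ, 0 < c ∧ ∀ᵐ x ∂(volume.restrict Ω), c ≤ n x := by
  have : IsFiniteMeasure (volume.restrict Ω) := ⟨by simpa using hΩb.measure_lt_top⟩
  obtain ⟨K₁, -, hK₁⟩ := exists_ae_abs_le h.n_bdd
  obtain ⟨K₂, -, hK₂⟩ := exists_ae_abs_le h.V_bdd
  obtain ⟨K₃, -, -, hK₃⟩ := ae_abs_le_of_continuousOn hΩ hΩb hnDc
  obtain ⟨K₄, hK₄0, hK₄', hK₄⟩ := ae_abs_le_of_continuousOn hΩ hΩb hVDc
  have hn := h.n_mem.hasH1Grad hΩ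
  have hV := h.poisson.mem.hasH1Grad hΩ
  set L := max K₂ K₄ with hL
  have hL0 : 0 ≤ L := hK₄0.trans (le_max_right _ _)
  have hVL : ∀ᵐ x ∂(volume.restrict Ω), V x ∈ Icc (-L) L := by
    filter_upwards [hK₂] with x hx using abs_le.1 (hx.trans (le_max_left _ _))
  have hVDL : ∀ᵐ x ∂(volume.restrict Ω), VD x ∈ Icc (-L) L := by
    filter_upwards [hK₄] with x hx using abs_le.1 (hx.trans (le_max_right _ _))
  have hLL : -L ≤ L := by linarith
  have heV := h.poisson.bdry.hasH10Grad_of_hasH1Grad hΩ (hV.sub hVD)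
  have hen := h.n_bdry.hasH10Grad_of_hasH1Grad hΩ (hn.sub hnD)
  have hexp := HasH10Grad.comp_sub_comp_of_mem_Icc (Φ := Real.exp) (Φ' := Real.exp) hΩ hVD heV hLL
    hVL hVDL (fun s _ => Real.hasDerivAt_exp s) Real.continuous_exp.continuousOn
  have hexpD := HasH1Grad.comp_of_mem_Icc (Φ := Real.exp) (Φ' := Real.exp) hΩ hVD hLL hVDL
    (fun s _ => Real.hasDerivAt_exp s) Real.continuous_exp.continuousOn
  set K := max (max K₁ K₃) (Real.exp L) with hKdef
  have b1 : ∀ᵐ x ∂(volume.restrict Ω), |n x| ≤ K := by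
    filter_upwards [hK₁] with x hx using hx.trans ((le_max_left _ _).trans (le_max_left _ _))
  have b2 : ∀ᵐ x ∂(volume.restrict Ω), |nD x| ≤ K := by
    filter_upwards [hK₃] with x hx using hx.trans ((le_max_right _ _).trans (le_max_left _ _))
  have b3 : ∀ᵐ x ∂(volume.restrict Ω), |Real.exp (V x)| ≤ K := by
    filter_upwards [hVL] with x hx
    rw [Real.abs_exp]
    exact (Real.exp_le_exp.2 hx.2).trans (le_max_right _ _)
  have b4 : ∀ᵐ x ∂(volume.restrict Ω), |Real.exp (VD x)| ≤ K := by
    filter_upwards [hVDL] with x hx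
    rw [Real.abs_exp]
    exact (Real.exp_le_exp.2 hx.2).trans (le_max_right _ _)
  have hbD := HasH1Grad.mul hΩ hnD hexpD b2 b4
  have hw := HasH10Grad.mul_sub_mul hΩ hnD hexpD hen hexp b1 b2 b3 b4
  set κ := m * Real.exp (-L) with hκ
  have hB := HasH10Grad.posPart (u := fun x => κ - n x * Real.exp (V x))
    (G := fun x => -(Real.exp (V x) • weakGrad Ω n x + n x • Real.exp (V x) • weakGrad Ω V x))
    (b := fun x => κ - nD x * Real.exp (VD x)) hΩ hΩb
    ((HasH1Grad.const κ).sub hbD) (continuousOn_const.sub (hnDc.mul hVDc.rexp))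
    (fun x hx => by
      have h1 := hK₄' x (frontier_subset_closure hx)
      have h2 : Real.exp (-L) ≤ Real.exp (VD x) := Real.exp_le_exp.2 (by
        have := (abs_le.1 h1).1
        have := le_max_right K₂ K₄
        linarith)
      have := mul_le_mul (hmD x hx) h2 (Real.exp_pos _).le (hm.le.trans (hmD x hx))
      linarith)
    (hw.neg.congr (Eventually.of_forall fun x => by ring)
      (Eventually.of_forall fun x => by simp only; abel))
  have hJ : MemLp (fun x => weakGrad Ω n x + n x • weakGrad Ω V x) 2 (volume.restrict Ω) :=
    hn.memLp_grad.add (memLp_smul_bdd h.n_mem.1.1 hK₁ hV.memLp_grad)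
  have hz := h.test hΩ hB
  have hfac : ∀ x, -(Real.exp (V x) • weakGrad Ω n x + n x • Real.exp (V x) • weakGrad Ω V x) =
      -Real.exp (V x) • (weakGrad Ω n x + n x • weakGrad Ω V x) := fun x => by
    rw [smul_comm (n x), neg_smul, smul_add]
  have h0 : 0 ≤ᵐ[volume.restrict Ω] fun x =>
      -inner ℝ (weakGrad Ω n x + n x • weakGrad Ω V x)
        ((if 0 < κ - n x * Real.exp (V x) then (1 : ℝ) else 0) •
          -(Real.exp (V x) • weakGrad Ω n x + n x • Real.exp (V x) • weakGrad Ω V x)) :=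
    Eventually.of_forall fun x => by
      simp only [Pi.zero_apply, hfac]
      split_ifs
      · rw [one_smul, inner_smul_right, neg_mul, neg_neg]
        exact mul_nonneg (Real.exp_pos _).le real_inner_self_nonneg
      · simp
  -- A nonnegative integrand, e^V times the squared flux on {w < κ}, with zero integral vanishes
  -- almost everywhere.
  have hC0 := (integral_eq_zero_iff_of_nonneg_ae h0
    (MemLp.integrable_inner_two hJ hB.memLp_grad).neg).1 (by rw [integral_neg, hz, neg_zero])
  obtain ⟨CP, -, hCP⟩ := exists_poincare hΩ hΩb
  have hP := hCP _ _ hB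
  rw [integral_eq_zero_of_ae (f := fun x => ‖_‖ ^ 2), mul_zero] at hP
  swap
  · filter_upwards [hC0] with x hx
    simp only [Pi.zero_apply, hfac] at hx ⊢
    split_ifs at hx ⊢
    · rw [one_smul, inner_smul_right, neg_mul, neg_neg, mul_eq_zero, inner_self_eq_zero] at hx
      rw [hx.resolve_left (Real.exp_pos _).ne']
      simp
    · simp
  have hu : MemLp (fun x => κ - n x * Real.exp (V x)) 2 (volume.restrict Ω) := by
    refine ((memLp_const κ).sub (hw.memLp.add hbD.memLp)).ae_eq (Eventually.of_forall fun x => ?_)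
    simp
  have hle := ae_nonpos_of_integral_max_sq_eq_zero hu
    (le_antisymm hP (integral_nonneg fun x => sq_nonneg _))
  refine ⟨κ * Real.exp (-L), by positivity, ?_⟩
  filter_upwards [hle, hVL] with x hx hVx
  have h1 : κ ≤ n x * Real.exp (V x) := by linarith
  have h2 : Real.exp (-L) ≤ Real.exp (-V x) := Real.exp_le_exp.2 (by linarith [hVx.2])
  calc κ * Real.exp (-L) ≤ n x * Real.exp (V x) * Real.exp (-V x) :=
        mul_le_mul h1 h2 (Real.exp_pos _).le (le_trans (by positivity) h1)
    _ = n x := by rw [mul_assoc, ← Real.exp_add]; simp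

end Stationary

/-! ### Pointwise inequalities for the relative entropy -/

section Entropy

/-- For x ≤ 1, s ≤ sinh s at s = -log x yields -x log x ≤ (1 - x²)/2, which is exactly what is
needed. For x ≥ 1, log(1 + s) ≥ 2s/(s + 2) at s = x - 1 leaves the nonnegative remainder (x -
1)³/(2x(x + 1)). -/
theorem sq_div_le_mul_log_sub {x : ℝ} (hx : 0 < x) :
    (x - 1) ^ 2 / (2 * max x 1) ≤ x * Real.log x - x + 1 := by
  rcases le_total x 1 with h | h
  · rw [max_eq_right h]
    have h1 : 0 ≤ Real.log x⁻¹ := Real.log_nonneg ((one_le_inv₀ hx).2 h)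
    have h2 := Real.self_le_sinh_iff.2 h1
    rw [Real.sinh_log (inv_pos.2 hx), inv_inv, Real.log_inv] at h2
    have h3 := mul_le_mul_of_nonneg_left h2 hx.le
    have h4 : x * ((x⁻¹ - x) / 2) = (1 - x ^ 2) / 2 := by field_simp
    rw [h4] at h3
    linarith
  · rw [max_eq_left h]
    have h1 := Real.le_log_one_add_of_nonneg (sub_nonneg.2 h)
    rw [add_sub_cancel] at h1
    have h2 := mul_le_mul_of_nonneg_left h1 hx.le
    have h3 : (x - 1) ^ 2 / (2 * x) + x - 1 ≤ x * (2 * (x - 1) / (x - 1 + 2)) := by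
      have h5 : 0 < x - 1 + 2 := by linarith
      have e : x * (2 * (x - 1) / (x - 1 + 2)) - ((x - 1) ^ 2 / (2 * x) + x - 1) =
          (x - 1) ^ 3 / (2 * x * (x - 1 + 2)) := by
        field_simp
        ring
      have : 0 ≤ (x - 1) ^ 3 / (2 * x * (x - 1 + 2)) :=
        div_nonneg (pow_nonneg (sub_nonneg.2 h) 3) (by positivity)
      linarith
    linarith

variable {n b M c : ℝ}

theorem relEntropy_two_mul (n b : ℝ) : relEntropy n (2 * b) = n * Real.log (n / b) - n + b := by
  rw [relEntropy, mul_div_mul_left _ _ two_ne_zero, mul_div_cancel_left₀ _ two_ne_zero]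

/-- Scale the one-variable inequality at x = n/b by b; then b max(n/b, 1) = max(n, b) ≤ M. -/
theorem sq_div_le_relEntropy (hn : 0 < n) (hb : 0 < b) (hnM : n ≤ M) (hbM : b ≤ M) :
    (n - b) ^ 2 / (2 * M) ≤ relEntropy n (2 * b) := by
  rw [relEntropy_two_mul]
  have h := mul_le_mul_of_nonneg_left (sq_div_le_mul_log_sub (div_pos hn hb)) hb.le
  have hM : b * max (n / b) 1 ≤ M := by
    rw [mul_max_of_nonneg _ _ hb.le, mul_div_cancel₀ _ hb.ne', mul_one]
    exact max_le hnM hbM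
  have hpos : 0 < max (n / b) 1 := lt_max_of_lt_right one_pos
  calc (n - b) ^ 2 / (2 * M) ≤ (n - b) ^ 2 / (2 * (b * max (n / b) 1)) := by gcongr
    _ = b * ((n / b - 1) ^ 2 / (2 * max (n / b) 1)) := by field_simp
    _ ≤ _ := h
    _ = _ := by field_simp

/-- From log y ≤ y - 1 at y = n/b one gets b - n ≤ -b log(n/b). -/
theorem relEntropy_le_sub_mul_log (hn : 0 < n) (hb : 0 < b) :
    relEntropy n (2 * b) ≤ (n - b) * (Real.log n - Real.log b) := by
  rw [relEntropy_two_mul, ← Real.log_div hn.ne' hb.ne']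
  have h := mul_le_mul_of_nonneg_left (Real.log_le_sub_one_of_pos (div_pos hn hb)) hb.le
  have e : b * (n / b - 1) = n - b := by field_simp
  rw [e] at h
  linarith

/-- The symmetrized entropy h(n | 2b) + h(b | 2n) equals (n - b)(log n - log b), and each summand is
at least (n - b)²/(2M). -/
theorem sq_sub_le_mul_log (hn : 0 < n) (hb : 0 < b) (hnM : n ≤ M) (hbM : b ≤ M) :
    (n - b) ^ 2 ≤ M * ((n - b) * (Real.log n - Real.log b)) := by
  have hM : 0 < M := hn.trans_le hnM
  have h1 := sq_div_le_relEntropy hn hb hnM hbM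
  have h2 := sq_div_le_relEntropy hb hn hbM hnM
  rw [relEntropy_two_mul, Real.log_div hn.ne' hb.ne', div_le_iff₀ (by positivity)] at h1
  rw [relEntropy_two_mul, Real.log_div hb.ne' hn.ne', div_le_iff₀ (by positivity)] at h2
  nlinarith

/-- The bound M²/c depends on the qualitative lower bound c; it serves only for integrability. -/
theorem relEntropy_le_div (hc : 0 < c) (hcn : c ≤ n) (hcb : c ≤ b) (hnM : n ≤ M) (hbM : b ≤ M) :
    relEntropy n (2 * b) ≤ M ^ 2 / c := by
  have hn := hc.trans_le hcn
  have hb := hc.trans_le hcb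
  rw [relEntropy_two_mul]
  have h := mul_le_mul_of_nonneg_left (Real.log_le_sub_one_of_pos (div_pos hn hb)) hn.le
  have e : n * (n / b - 1) - n + b = (n - b) ^ 2 / b := by field_simp; ring
  calc n * Real.log (n / b) - n + b ≤ (n - b) ^ 2 / b := by linarith
    _ ≤ M ^ 2 / c := by
      gcongr ?_ / ?_
      exact sq_le_sq' (by linarith) (by linarith)

end Entropy

/-! ### Integrability and lower bound of the free energy; the key quadratic estimate -/

section FreeEnergy

variable {Ω : Set E3} {lam c M : ℝ} {g VD np nm V ninf Vinf : E3 → ℝ}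

theorem integrable_relEntropy [IsFiniteMeasure (volume.restrict Ω)] {n b : E3 → ℝ} (hc : 0 < c)
    (hn : AEStronglyMeasurable n (volume.restrict Ω))
    (hb : AEStronglyMeasurable b (volume.restrict Ω))
    (hnM : ∀ᵐ x ∂(volume.restrict Ω), c ≤ n x ∧ n x ≤ M)
    (hbM : ∀ᵐ x ∂(volume.restrict Ω), c ≤ b x / 2 ∧ b x / 2 ≤ M) :
    Integrable (fun x => relEntropy (n x) (b x)) (volume.restrict Ω) := by
  have hm : AEStronglyMeasurable (fun x => relEntropy (n x) (b x)) (volume.restrict Ω) := by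
    have h1 := hn.aemeasurable
    have h2 := hb.aemeasurable
    unfold relEntropy
    exact AEMeasurable.aestronglyMeasurable (by fun_prop)
  refine Integrable.of_bound hm (M ^ 2 / c) ?_
  filter_upwards [hnM, hbM] with x h1 h2
  have e : b x = 2 * (b x / 2) := by ring
  have hn0 := hc.trans_le h1.1
  have hb0 := hc.trans_le h2.1
  have hM : 0 < M := hn0.trans_le h1.2
  rw [Real.norm_eq_abs, e, abs_of_nonneg]
  · exact relEntropy_le_div hc h1.1 h2.1 h1.2 h2.2
  · exact le_trans (by positivity) (sq_div_le_relEntropy hn0 hb0 h1.2 h2.2)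

theorem integrableOn_freeEnergyDensity [IsFiniteMeasure (volume.restrict Ω)] (hΩ : IsOpen Ω)
    (hc : 0 < c) (hnp : MemLp np 2 (volume.restrict Ω)) (hnm : MemLp nm 2 (volume.restrict Ω))
    (hb : MemLp ninf 2 (volume.restrict Ω)) (hV : MemH1 Ω V) (hVinf : MemH1 Ω Vinf)
    (hpM : ∀ᵐ x ∂(volume.restrict Ω), c ≤ np x ∧ np x ≤ M)
    (hmM : ∀ᵐ x ∂(volume.restrict Ω), c ≤ nm x ∧ nm x ≤ M)
    (hbM : ∀ᵐ x ∂(volume.restrict Ω), c ≤ ninf x / 2 ∧ ninf x / 2 ≤ M) :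
    IntegrableOn (freeEnergyDensity Ω lam ninf Vinf np nm V) Ω := by
  have hW := (((hV.hasH1Grad hΩ).sub (hVinf.hasH1Grad hΩ)).memH1 hΩ).hasH1Grad hΩ
  exact ((integrable_relEntropy hc hnp.1 hb.1 hpM hbM).add
    (integrable_relEntropy hc hnm.1 hb.1 hmM hbM)).add
    ((hW.memLp_grad.integrable_norm_pow two_ne_zero).const_mul (lam ^ 2 / 2))

theorem sq_le_freeEnergy [IsFiniteMeasure (volume.restrict Ω)] (hΩ : IsOpen Ω)
    (hc : 0 < c) (hnp : MemLp np 2 (volume.restrict Ω))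
    (hnm : MemLp nm 2 (volume.restrict Ω))
    (hb : MemLp ninf 2 (volume.restrict Ω)) (hV : MemH1 Ω V) (hVinf : MemH1 Ω Vinf)
    (hpM : ∀ᵐ x ∂(volume.restrict Ω), c ≤ np x ∧ np x ≤ M)
    (hmM : ∀ᵐ x ∂(volume.restrict Ω), c ≤ nm x ∧ nm x ≤ M)
    (hbM : ∀ᵐ x ∂(volume.restrict Ω), c ≤ ninf x / 2 ∧ ninf x / 2 ≤ M) :
    1 / (2 * M) * ((∫ x in Ω, (np x - ninf x / 2) ^ 2) + ∫ x in Ω, (nm x - ninf x / 2) ^ 2) ≤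
      freeEnergy Ω lam ninf Vinf np nm V := by
  have hb2 : MemLp (fun x => ninf x / 2) 2 (volume.restrict Ω) := by
    simpa only [div_eq_inv_mul] using hb.const_mul 2⁻¹
  have i1 : Integrable (fun x => (np x - ninf x / 2) ^ 2) (volume.restrict Ω) :=
    (hnp.sub hb2).integrable_sq
  have i2 : Integrable (fun x => (nm x - ninf x / 2) ^ 2) (volume.restrict Ω) :=
    (hnm.sub hb2).integrable_sq
  rw [← integral_add i1 i2, ← integral_const_mul]
  refine integral_mono_ae ((i1.add i2).const_mul _)
    (integrableOn_freeEnergyDensity hΩ hc hnp hnm hb hV hVinf hpM hmM hbM) ?_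
  filter_upwards [hpM, hmM, hbM] with x h1 h2 h3
  have e : ninf x = 2 * (ninf x / 2) := by ring
  have e1 := sq_div_le_relEntropy (hc.trans_le h1.1) (hc.trans_le h3.1) h1.2 h3.2
  have e2 := sq_div_le_relEntropy (hc.trans_le h2.1) (hc.trans_le h3.1) h2.2 h3.2
  rw [← e] at e1 e2
  have : 0 ≤ lam ^ 2 / 2 * ‖weakGrad Ω (fun y => V y - Vinf y) x‖ ^ 2 := by positivity
  rw [freeEnergyDensity, one_div_mul_eq_div, add_div]
  linarith

/-- The `H¹₀` part of the difference of the chemical potentials. -/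
theorem HasH10Grad.log_sub_log_add [IsFiniteMeasure (volume.restrict Ω)] (hΩ : IsOpen Ω)
    {n b W : E3 → ℝ} {Gn Gb GW : E3 → E3} (hc : 0 < c) (hb : HasH1Grad Ω b Gb)
    (hn : HasH10Grad Ω (fun x => n x - b x) (fun x => Gn x - Gb x)) (hW : HasH10Grad Ω W GW)
    (hnM : ∀ᵐ x ∂(volume.restrict Ω), c ≤ n x ∧ n x ≤ M)
    (hbM : ∀ᵐ x ∂(volume.restrict Ω), c ≤ b x ∧ b x ≤ M) (hcM : c ≤ M) :
    HasH10Grad Ω (fun x => Real.log (n x) - Real.log (b x) + W x)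
      (fun x => (n x)⁻¹ • Gn x - (b x)⁻¹ • Gb x + GW x) :=
  (HasH10Grad.comp_sub_comp_of_mem_Icc (Φ := Real.log) (Φ' := fun s => s⁻¹) hΩ hb hn hcM hnM hbM
    (fun _ hs => Real.hasDerivAt_log (hc.trans_le hs.1).ne')
    (continuousOn_inv₀.mono fun _ hs => (hc.trans_le hs.1).ne')).add hW

/-- Write a = n - b, s = log n - log b, ψ = s + W. Since a²/M ≤ as, ½as + aW ≤ aψ - a²/(2M), and
this is at most (M/2)ψ² by completing the square. Half of as is kept so that the sum can still
dominate the entropy. -/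
theorem integral_sub_mul_le [IsFiniteMeasure (volume.restrict Ω)] {n b W : E3 → ℝ} (hc : 0 < c)
    (hn : MemLp n 2 (volume.restrict Ω)) (hb : MemLp b 2 (volume.restrict Ω))
    (hθ : MemLp (fun x => Real.log (n x) - Real.log (b x)) 2 (volume.restrict Ω))
    (hW : MemLp W 2 (volume.restrict Ω))
    (hnM : ∀ᵐ x ∂(volume.restrict Ω), c ≤ n x ∧ n x ≤ M)
    (hbM : ∀ᵐ x ∂(volume.restrict Ω), c ≤ b x ∧ b x ≤ M) :
    1 / 2 * (∫ x in Ω, (n x - b x) * (Real.log (n x) - Real.log (b x))) +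
      ∫ x in Ω, (n x - b x) * W x ≤
    M / 2 * ∫ x in Ω, (Real.log (n x) - Real.log (b x) + W x) ^ 2 := by
  have i1 : Integrable (fun x => (n x - b x) * (Real.log (n x) - Real.log (b x)))
      (volume.restrict Ω) := MemLp.integrable_mul_two (hn.sub hb) hθ
  have i2 : Integrable (fun x => (n x - b x) * W x) (volume.restrict Ω) :=
    MemLp.integrable_mul_two (hn.sub hb) hW
  have i3 : Integrable (fun x => (Real.log (n x) - Real.log (b x) + W x) ^ 2)
      (volume.restrict Ω) := (hθ.add hW).integrable_sq
  rw [← integral_const_mul, ← integral_add (i1.const_mul _) i2, ← integral_const_mul]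
  refine integral_mono_ae ((i1.const_mul _).add i2) (i3.const_mul _) ?_
  filter_upwards [hnM, hbM] with x h1 h2
  have h := sq_sub_le_mul_log (hc.trans_le h1.1) (hc.trans_le h2.1) h1.2 h2.2
  have hM : 0 < M := (hc.trans_le h1.1).trans_le h1.2
  set a := n x - b x
  set s := Real.log (n x) - Real.log (b x)
  have h' : a ^ 2 / M ≤ a * s := by
    rw [div_le_iff₀ hM]
    linarith
  have e : M / 2 * (s + W x) ^ 2 - a * (s + W x) + a ^ 2 / M / 2 =
      M / 2 * (s + W x - a / M) ^ 2 := by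
    field_simp
    ring
  have : 0 ≤ M / 2 * (s + W x - a / M) ^ 2 := by positivity
  linarith

end FreeEnergy

/-! ### Upper bound of the free energy and the theorem -/

section Conclusion

variable {Ω : Set E3} {lam c M CP : ℝ} {g VD np nm V ninf Vinf : E3 → ℝ} {Gp Gm Gb : E3 → E3}

/-- The chemical potentials differ by -log 2 on the boundary. Replacing n_∞ by n_∞/2 removes this
constant and puts the difference into H¹₀ without changing its gradient. -/
theorem chemPot_sub_chemPot_ae [IsFiniteMeasure (volume.restrict Ω)] (hΩ : IsOpen Ω)
    {n : E3 → ℝ} {G : E3 → E3} (hc : 0 < c)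
    (hψ : HasH10Grad Ω (fun x => Real.log (n x) - Real.log (ninf x / 2) + (V x - Vinf x)) G)
    (hbM : ∀ᵐ x ∂(volume.restrict Ω), c ≤ ninf x / 2 ∧ ninf x / 2 ≤ M) :
    MemH1 Ω (fun x => chemPot n V x - chemPot ninf Vinf x) ∧
      weakGrad Ω (fun x => chemPot n V x - chemPot ninf Vinf x) =ᵐ[volume.restrict Ω] G := by
  have h : HasH1Grad Ω (fun x => chemPot n V x - chemPot ninf Vinf x) G := by
    refine (hψ.hasH1Grad.sub (HasH1Grad.const (Real.log 2))).congr ?_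
      (Eventually.of_forall fun x => sub_zero _)
    filter_upwards [hbM] with x hx
    have h0 : ninf x ≠ 0 := fun h0 => by
      rw [h0] at hx
      linarith [hx.1]
    simp only [chemPot]
    rw [Real.log_div h0 two_ne_zero]
    ring
  exact ⟨h.memH1 hΩ, (h.hasWeakGrad hΩ).weakGrad_ae_eq hΩ⟩

/-- Upper bound for the relative free energy in terms of the dissipation. -/
theorem freeEnergy_le [IsFiniteMeasure (volume.restrict Ω)] (hΩ : IsOpen Ω)
    (hCP : ∀ u G, HasH10Grad Ω u G → ∫ x in Ω, u x ^ 2 ≤ CP * ∫ x in Ω, ‖G x‖ ^ 2)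
    (hc : 0 < c) (hM : 0 < M) (hcM : c ≤ M) (hb : HasH1Grad Ω (fun x => ninf x / 2) Gb)
    (hp : HasH10Grad Ω (fun x => np x - ninf x / 2) (fun x => Gp x - Gb x))
    (hm : HasH10Grad Ω (fun x => nm x - ninf x / 2) (fun x => Gm x - Gb x))
    (hg : MemLp g 2 (volume.restrict Ω))
    (hV : IsPoissonSol Ω lam VD (fun x => np x + nm x - g x) V)
    (hVinf : IsPoissonSol Ω lam VD (fun x => ninf x - g x) Vinf)
    (hpM : ∀ᵐ x ∂(volume.restrict Ω), c ≤ np x ∧ np x ≤ M)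
    (hmM : ∀ᵐ x ∂(volume.restrict Ω), c ≤ nm x ∧ nm x ≤ M)
    (hbM : ∀ᵐ x ∂(volume.restrict Ω), c ≤ ninf x / 2 ∧ ninf x / 2 ≤ M) :
    MemH1 Ω (fun x => chemPot np V x - chemPot ninf Vinf x) ∧
    MemH1 Ω (fun x => chemPot nm V x - chemPot ninf Vinf x) ∧
    freeEnergy Ω lam ninf Vinf np nm V ≤ M * CP *
      ((∫ x in Ω, ‖weakGrad Ω (fun y => chemPot np V y - chemPot ninf Vinf y) x‖ ^ 2) +
        ∫ x in Ω, ‖weakGrad Ω (fun y => chemPot nm V y - chemPot ninf Vinf y) x‖ ^ 2) := by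
  have hVg := hV.mem.hasH1Grad hΩ
  have hVig := hVinf.mem.hasH1Grad hΩ
  set GW : E3 → E3 := fun x => weakGrad Ω V x - weakGrad Ω Vinf x with hGW
  -- The common boundary value V_D cancels.
  have hW : HasH10Grad Ω (fun x => V x - Vinf x) GW := by
    have h := ((hV.bdry.hasH10Grad hΩ).sub (hVinf.bdry.hasH10Grad hΩ)).congr
      (Eventually.of_forall fun x => sub_sub_sub_cancel_right (V x) (Vinf x) (VD x)) EventuallyEq.rfl
    exact h.congr EventuallyEq.rfl
      ((h.hasH1Grad.hasWeakGrad hΩ).unique hΩ ((hVg.sub hVig).hasWeakGrad hΩ))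
  have hnp : MemLp np 2 (volume.restrict Ω) :=
    (hp.memLp.add hb.memLp).ae_eq (Eventually.of_forall fun x => by simp)
  have hnm : MemLp nm 2 (volume.restrict Ω) :=
    (hm.memLp.add hb.memLp).ae_eq (Eventually.of_forall fun x => by simp)
  have hni : MemLp ninf 2 (volume.restrict Ω) :=
    (hb.memLp.const_mul 2).ae_eq (Eventually.of_forall fun x => by ring)
  have hψp := HasH10Grad.log_sub_log_add hΩ hc hb hp hW hpM hbM hcM
  have hψm := HasH10Grad.log_sub_log_add hΩ hc hb hm hW hmM hbM hcM
  obtain ⟨cp, cp'⟩ := chemPot_sub_chemPot_ae hΩ hc hψp hbM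
  obtain ⟨cm, cm'⟩ := chemPot_sub_chemPot_ae hΩ hc hψm hbM
  refine ⟨cp, cm, ?_⟩
  have ep := integral_congr_ae (cp'.fun_comp fun z => ‖z‖ ^ 2)
  have em := integral_congr_ae (cm'.fun_comp fun z => ‖z‖ ^ 2)
  simp only [Function.comp_def] at ep em
  rw [ep, em]
  have hθ : ∀ {n : E3 → ℝ},
      MemLp (fun x => Real.log (n x) - Real.log (ninf x / 2) + (V x - Vinf x)) 2
        (volume.restrict Ω) →
      MemLp (fun x => Real.log (n x) - Real.log (ninf x / 2)) 2 (volume.restrict Ω) := fun h =>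
    (h.sub hW.memLp).ae_eq (Eventually.of_forall fun x => by simp)
  have kp := integral_sub_mul_le hc hnp hb.memLp (hθ hψp.memLp) hW.memLp hpM hbM
  have km := integral_sub_mul_le hc hnm hb.memLp (hθ hψm.memLp) hW.memLp hmM hbM
  have pp := mul_le_mul_of_nonneg_left (hCP _ _ hψp) hM.le
  have pm := mul_le_mul_of_nonneg_left (hCP _ _ hψm) hM.le
  -- Both Poisson equations are tested with W and subtracted; the doping g cancels and n_∞ is
  -- divided evenly between the two species.
  have eW : lam ^ 2 * ∫ x in Ω, ‖GW x‖ ^ 2 =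
      (∫ x in Ω, (np x - ninf x / 2) * (V x - Vinf x)) +
        ∫ x in Ω, (nm x - ninf x / 2) * (V x - Vinf x) := by
    have t1 := hV.test hΩ ((hnp.add hnm).sub hg) hW
    have t2 := hVinf.test hΩ (hni.sub hg) hW
    have s1 : ∫ x in Ω, ‖GW x‖ ^ 2 = (∫ x in Ω, inner ℝ (weakGrad Ω V x) (GW x)) -
        ∫ x in Ω, inner ℝ (weakGrad Ω Vinf x) (GW x) := by
      rw [← integral_sub (MemLp.integrable_inner_two hVg.memLp_grad hW.memLp_grad)
        (MemLp.integrable_inner_two hVig.memLp_grad hW.memLp_grad)]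
      congr 1 with x
      rw [← inner_sub_left, ← real_inner_self_eq_norm_sq]
    have j1 : Integrable (fun x => (np x + nm x - g x) * (V x - Vinf x)) (volume.restrict Ω) :=
      MemLp.integrable_mul_two ((hnp.add hnm).sub hg) hW.memLp
    have j2 : Integrable (fun x => (ninf x - g x) * (V x - Vinf x)) (volume.restrict Ω) :=
      MemLp.integrable_mul_two (hni.sub hg) hW.memLp
    rw [s1, mul_sub, t1, t2, ← integral_sub j1 j2,
      ← integral_add (MemLp.integrable_mul_two hp.memLp hW.memLp)
        (MemLp.integrable_mul_two hm.memLp hW.memLp)]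
    congr 1 with x
    ring
  have hGW' : weakGrad Ω (fun y => V y - Vinf y) =ᵐ[volume.restrict Ω] GW :=
    ((hVg.sub hVig).hasWeakGrad hΩ).weakGrad_ae_eq hΩ
  have i1 : Integrable (fun x => (np x - ninf x / 2) * (Real.log (np x) - Real.log (ninf x / 2)))
      (volume.restrict Ω) := MemLp.integrable_mul_two hp.memLp (hθ hψp.memLp)
  have i2 : Integrable (fun x => (nm x - ninf x / 2) * (Real.log (nm x) - Real.log (ninf x / 2)))
      (volume.restrict Ω) := MemLp.integrable_mul_two hm.memLp (hθ hψm.memLp)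
  have i3 := (hW.memLp_grad.integrable_norm_pow two_ne_zero).const_mul (lam ^ 2 / 2)
  have hH : freeEnergy Ω lam ninf Vinf np nm V ≤
      (∫ x in Ω, (np x - ninf x / 2) * (Real.log (np x) - Real.log (ninf x / 2))) +
      (∫ x in Ω, (nm x - ninf x / 2) * (Real.log (nm x) - Real.log (ninf x / 2))) +
      lam ^ 2 / 2 * ∫ x in Ω, ‖GW x‖ ^ 2 := by
    have key := integral_mono_ae (integrableOn_freeEnergyDensity (lam := lam) hΩ hc hnp hnm hni
      hV.mem hVinf.mem hpM hmM hbM) ((i1.add i2).add i3) (by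
        filter_upwards [hpM, hmM, hbM, hGW'] with x h1 h2 h3 h4
        have e : ninf x = 2 * (ninf x / 2) := by ring
        have e1 := relEntropy_le_sub_mul_log (hc.trans_le h1.1) (hc.trans_le h3.1)
        have e2 := relEntropy_le_sub_mul_log (hc.trans_le h2.1) (hc.trans_le h3.1)
        rw [← e] at e1 e2
        rw [freeEnergyDensity, h4]
        exact add_le_add (add_le_add e1 e2) le_rfl)
    rw [integral_add' (i1.add i2) i3, integral_add' i1 i2, integral_const_mul] at key
    exact key
  have hpos : 0 ≤ lam ^ 2 * ∫ x in Ω, ‖GW x‖ ^ 2 :=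
    mul_nonneg (sq_nonneg _) (integral_nonneg fun x => sq_nonneg _)
  -- Twice the sum of `kp` and `km` contains the field energy as 2λ²∫|∇W|², which dominates the
  -- ½λ²∫|∇W|² in the free energy.
  linarith

theorem MemW2.hasH1Grad [IsFiniteMeasure (volume.restrict Ω)] (hΩ : IsOpen Ω) {q : ℝ≥0∞}
    (hq : 2 ≤ q) {u : E3 → ℝ} (h : MemW2 Ω q u) : HasH1Grad Ω u (weakGrad Ω u) := by
  obtain ⟨hu, G, hG, hG', -⟩ := h
  exact MemH1.hasH1Grad hΩ ⟨hu.mono_exponent hq, G, hG, hG'.mono_exponent hq⟩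

end Conclusion

end SpinDrift

theorem lemma3p5 (Ω : Set E3) (hΩo : IsOpen Ω) (hΩc : IsConnected Ω)
    (hΩb : Bornology.IsBounded Ω) (hΩr : HasC11Boundary Ω)
    (mstar lam D p τ q₀ : ℝ) (mu : E3)
    (hm0 : 0 < mstar) (hm1 : mstar < 1) (hlam : 0 < lam) (hD : 0 < D)
    (hp0 : 0 ≤ p) (hp1 : p < 1) (hτ : 0 < τ) (hq₀ : 3 < q₀) (hmu : ‖mu‖ = 1)
    (g nD VD : E3 → ℝ)
    (hg : MemLp g ∞ (volume.restrict Ω)) (hg0 : ∀ᵐ x ∂(volume.restrict Ω), 0 ≤ g x)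
    (hnD : MemW2 Ω (ENNReal.ofReal q₀) nD) (hnDc : ContinuousOn nD (closure Ω))
    (hVD : MemW2 Ω (ENNReal.ofReal q₀) VD) (hVDc : ContinuousOn VD (closure Ω))
    (hnDm : ∀ x ∈ frontier Ω, mstar ≤ nD x)
    (M₀ : ℝ) :
    ∃ Cφ CH : ℝ, 0 < Cφ ∧ 0 < CH ∧
      -- initial data
      ∀ (n00 : E3 → ℝ) (nvec0 : E3 → E3),
        MemLp n00 ∞ (volume.restrict Ω) →
        MemLp (fun x => inner ℝ (nvec0 x) mu) ∞ (volume.restrict Ω) →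
        (∀ᵐ x ∂(volume.restrict Ω), mstar / 2 ≤ n00 x / 2 + inner ℝ (nvec0 x) mu) →
        (∀ᵐ x ∂(volume.restrict Ω), mstar / 2 ≤ n00 x / 2 - inner ℝ (nvec0 x) mu) →
        (∀ᵐ x ∂(volume.restrict Ω), n00 x ≤ M₀) →
      -- transient and stationary solutions
      ∀ np nm V : ℝ → E3 → ℝ,
        IsWeakSolution Ω lam D p τ g nD VD
          (fun x => n00 x / 2 + inner ℝ (nvec0 x) mu)
          (fun x => n00 x / 2 - inner ℝ (nvec0 x) mu) np nm V →
      ∀ ninf Vinf : E3 → ℝ, IsStationarySolution Ω lam g nD VD ninf Vinf →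
      ∀ t : ℝ, 0 < t →
        -- the densities are positive, so that the logarithms are meaningful, and `H(t)` is finite
        (∀ᵐ x ∂(volume.restrict Ω), 0 < ninf x ∧ 0 < np t x ∧ 0 < nm t x) ∧
        IntegrableOn (freeEnergyDensity Ω lam ninf Vinf (np t) (nm t) (V t)) Ω ∧
        -- upper bound, at every `t` at which the boundary condition holds in the `H¹` sense
        -- (almost every `t`, by the definition of weak solutions)
        (MemH10 Ω (fun x => np t x - nD x / 2) → MemH10 Ω (fun x => nm t x - nD x / 2) →
          MemH1 Ω (fun x => chemPot (np t) (V t) x - chemPot ninf Vinf x) ∧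
          MemH1 Ω (fun x => chemPot (nm t) (V t) x - chemPot ninf Vinf x) ∧
          freeEnergy Ω lam ninf Vinf (np t) (nm t) (V t) ≤
            Cφ * ((∫ x in Ω, ‖weakGrad Ω
                    (fun y => chemPot (np t) (V t) y - chemPot ninf Vinf y) x‖ ^ 2)
                + ∫ x in Ω, ‖weakGrad Ω
                    (fun y => chemPot (nm t) (V t) y - chemPot ninf Vinf y) x‖ ^ 2)) ∧
        -- lower bound
        CH * ((∫ x in Ω, (np t x - ninf x / 2) ^ 2) + ∫ x in Ω, (nm t x - ninf x / 2) ^ 2) ≤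
          freeEnergy Ω lam ninf Vinf (np t) (nm t) (V t) := by
  have : IsFiniteMeasure (volume.restrict Ω) := ⟨by simpa using hΩb.measure_lt_top⟩
  have hq : (2 : ℝ≥0∞) ≤ ENNReal.ofReal q₀ := by
    rw [← ENNReal.ofReal_ofNat]
    exact ENNReal.ofReal_le_ofReal (by linarith)
  have hnD1 := hnD.hasH1Grad hΩo hq
  have hVD1 := hVD.hasH1Grad hΩo hq
  have hnD2 : HasH1Grad Ω (fun x => nD x / 2) (fun x => (2 : ℝ)⁻¹ • weakGrad Ω nD x) := by
    simpa only [div_eq_inv_mul] using hnD1.const_mul 2⁻¹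
  have hnD2c : ContinuousOn (fun x => nD x / 2) (closure Ω) := hnDc.div_const 2
  obtain ⟨Kg, -, hKg⟩ := exists_ae_abs_le hg
  obtain ⟨KD, -, hKD, -⟩ := ae_abs_le_of_continuousOn hΩo hΩb hnDc
  obtain ⟨CP, hCP0, hCP⟩ := exists_poincare hΩo hΩb
  -- M collects every level the truncations need: initial data, g and boundary data. The 1 ensures M
  -- > 0 and leaves room for c ≤ 1 ≤ M.
  set M : ℝ := max (max 1 M₀) (max Kg KD) with hMdef
  have hM1 : 1 ≤ M := (le_max_left _ _).trans (le_max_left _ _)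
  have hMM : M₀ ≤ M := (le_max_right _ _).trans (le_max_left _ _)
  have hMg : Kg ≤ M := (le_max_left _ _).trans (le_max_right _ _)
  have hMD : KD ≤ M := (le_max_right _ _).trans (le_max_right _ _)
  have hM : 0 < M := one_pos.trans_le hM1
  have hgM : ∀ᵐ x ∂(volume.restrict Ω), g x ≤ M := by
    filter_upwards [hKg] with x hx using (le_abs_self _).trans (hx.trans hMg)
  have hDM : ∀ x ∈ frontier Ω, nD x ≤ M := fun x hx =>
    (le_abs_self _).trans ((hKD x (frontier_subset_closure hx)).trans hMD)
  -- The Poincaré constant is only known to be nonnegative; the summand 1 makes the constant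
  -- positive.
  refine ⟨M * CP + 1, 1 / (2 * M), by positivity, by positivity, ?_⟩
  intro n00 nvec0 _ _ hi1 hi2 hi3 np nm V hw ninf Vinf hs t ht
  -- Positivity is needed at all times, not only at t, because the upper comparison runs over the
  -- whole interval up to t.
  have hlow : ∀ s, 0 < s → ∃ c : ℝ, 0 < c ∧
      ∀ᵐ x ∂(volume.restrict Ω), c ≤ np s x ∧ c ≤ nm s x := fun s hs' =>
    hw.exists_pos_le hΩo hΩb hlam hD hp0 hp1 hτ hnD2 hnD2c hg (half_pos hm0)
      (fun x hx => by linarith [hnDm x hx]) hi1 hi2 hs'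
  have hup := hw.le_of_nonneg hΩo hΩb hlam hD hp0 hp1 hτ hnD2 hnD2c hg hM.le
    (fun x hx => by linarith [hDM x hx, hnDm x hx]) hgM
    (by
      -- The initial densities add up to n₀⁰ ≤ M₀ and the other one is positive, so each is at most
      -- M₀.
      filter_upwards [hi2, hi3] with x h2 h3
      linarith)
    (by
      filter_upwards [hi1, hi3] with x h1 h3
      linarith)
    (fun s hs' => by
      obtain ⟨c, hc, h⟩ := hlow s hs'
      filter_upwards [h] with x hx using ⟨hc.le.trans hx.1, hc.le.trans hx.2⟩) ht
  obtain ⟨c₁, hc₁, hc₁'⟩ := hlow t ht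
  obtain ⟨c₂, hc₂, hc₂'⟩ := hs.exists_pos_le hΩo hΩb hnD1 hnDc hVD1 hVDc hm0 hnDm
  have hinf := hs.le hΩo hΩb hlam hnD1 hnDc hg hM hDM hgM
  -- A common lower bound for n_±(t) and n_∞/2, not uniform in t; it does not enter the constants.
  set c := min (min c₁ (c₂ / 2)) 1 with hcdef
  have hc : 0 < c := lt_min (lt_min hc₁ (half_pos hc₂)) one_pos
  have hcc₁ : c ≤ c₁ := (min_le_left _ _).trans (min_le_left _ _)
  have hcc₂ : c ≤ c₂ / 2 := (min_le_left _ _).trans (min_le_right _ _)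
  have hcM : c ≤ M := (min_le_right _ _).trans hM1
  have hpM : ∀ᵐ x ∂(volume.restrict Ω), c ≤ np t x ∧ np t x ≤ M := by
    filter_upwards [hc₁', hup] with x h1 h2 using ⟨hcc₁.trans h1.1, h2.1⟩
  have hmM : ∀ᵐ x ∂(volume.restrict Ω), c ≤ nm t x ∧ nm t x ≤ M := by
    filter_upwards [hc₁', hup] with x h1 h2 using ⟨hcc₁.trans h1.2, h2.2⟩
  have hbM : ∀ᵐ x ∂(volume.restrict Ω), c ≤ ninf x / 2 ∧ ninf x / 2 ≤ M := by
    filter_upwards [hc₂', hinf] with x h1 h2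
    constructor <;> linarith
  have hVt := hw.poisson t ht
  have hnp := hw.np_reg.memL2 t ht.le
  have hnm := hw.nm_reg.memL2 t ht.le
  refine ⟨?_, integrableOn_freeEnergyDensity hΩo hc hnp hnm hs.n_mem.1 hVt.mem hs.poisson.mem
    hpM hmM hbM, ?_, sq_le_freeEnergy hΩo hc hnp hnm hs.n_mem.1 hVt.mem hs.poisson.mem hpM hmM hbM⟩
  · filter_upwards [hpM, hmM, hbM] with x h1 h2 h3
    exact ⟨by linarith, by linarith, by linarith⟩
  · intro bp bm
    have hni := hs.n_mem.hasH1Grad hΩo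
    have hb : HasH1Grad Ω (fun x => ninf x / 2) (fun x => (2 : ℝ)⁻¹ • weakGrad Ω ninf x) := by
      simpa only [div_eq_inv_mul] using hni.const_mul 2⁻¹
    have hbD := (hs.n_bdry.hasH10Grad_of_hasH1Grad hΩo (hni.sub hnD1)).const_mul 2⁻¹
    have hd : ∀ {n : E3 → ℝ}, MemH10 Ω (fun x => n x - nD x / 2) →
        HasH10Grad Ω (fun x => n x - ninf x / 2)
          (fun x => (weakGrad Ω (fun x => n x - nD x / 2) x + (2 : ℝ)⁻¹ • weakGrad Ω nD x) -
            (2 : ℝ)⁻¹ • weakGrad Ω ninf x) := fun h => by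
      refine ((h.hasH10Grad hΩo).sub hbD).congr (Eventually.of_forall fun x => ?_)
        (Eventually.of_forall fun x => ?_)
      · simp only
        ring
      · simp only [smul_sub]
        abel
    obtain ⟨r1, r2, r3⟩ := freeEnergy_le hΩo hCP hc hM hcM hb (hd bp) (hd bm)
      (hg.mono_exponent le_top) hVt hs.poisson hpM hmM hbM
    refine ⟨r1, r2, r3.trans ?_⟩
    refine mul_le_mul_of_nonneg_right (by linarith) ?_
    exact add_nonneg (integral_nonneg fun x => sq_nonneg _) (integral_nonneg fun x => sq_nonneg _)
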